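/- Let $n\ge 2$, $m\in\mathbb N$, let $\Omega\subset\mathbb R^n$ be bounded and open, and let $p:\Omega\to[1,\infty)$ be measurable and log-Hölder continuous, i.e. there is $c>0$ with $|p(x)-p(y)|\le c/\log(e+\frac1{|x-y|})$ for all $x,y\in\Omega$. Put $p^+:=\operatorname{ess\,sup}_\Omega p$. Let $f:\mathbb R^{m\times n}\to[0,\infty)$ satisfy, with $|\cdot|$ the Euclidean norm on matrices: (H0) $f$ is continuous and $f(0)=0$; (H2) there is $c_0>0$ with $c_0|\xi|\le f(\xi)$ for all $\xi$; (H3) there is $M\ge1$ with $f(\xi)\le M(1+|\xi|)$ for all $\xi$. Notation. Let $\varphi(x,t):=\frac1{p(x)}t^{p(x)}$ and $\varphi^*(x,t):=\sup_{s\ge0}(st-\varphi(x,s))$. For open $A\subset\Omega$ and $\psi\in\{\varphi,\varphi^*\}$ let $\|g\|_{L^\psi(A)}:=\inf\{\lambda>0:\int_A\psi(x,|g(x)|/\lambda)\,dx\le1\}$. The space $L^{p(\cdot)}(A)$ consists of the measurable $g$ with $\int_A\varphi(x,\lambda|g|)\,dx<\infty$ for some $\lambda>0$, with norm $\|\cdot\|_{L^\varphi(A)}$;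 $W^{1,p(\cdot)}(A;\mathbb R^m)$ is the space of $v\in L^{p(\cdot)}(A;\mathbb R^m)$ whose weak gradient $\nabla v$ belongs to $L^{p(\cdot)}(A;\mathbb R^{m\times n})$. For $u\in L^{p(\cdot)}(\Omega;\mathbb R^m)$ and open $A\subset\Omega$ let $$V^m_{p(\cdot)}(u;A):=\sup\Big\{\sum_{\alpha=1}^m\int_A u_\alpha\operatorname{div}w_\alpha\,dx \;\Big|\; w\in[C^1_0(A;\mathbb R^n)]^m,\ \|w\|_{L^{\varphi^*}(A)}\le1\Big\},$$ where $C^1_0(A;\mathbb R^n)$ denotes the $C^1$ fields with compact support in $A$, and let $u\in \mathrm{BV}^{p(\cdot)}(\Omega;\mathbb R^m)$ mean that $u\in L^{p(\cdot)}(\Omega;\mathbb R^m)$ and $\|u\|_{L^\varphi(\Omega)}+V^m_{p(\cdot)}(u;\Omega)<\infty$. Finally let $$\mathcal F(u,A):=\inf\Big\{\liminf_{h\to\infty}\int_A f(\nabla u_h)^{p(x)}\,dx \;\Big|\; u_h\in W^{1,p(\cdot)}(A;\mathbb R^m),\ u_h\to u\text{ in }L^{p(\cdot)}(A;\mathbb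 R^m)\Big\}.$$ Then there is a constant $C\ge 0$, independent of $u$ and $A$, such that $$\mathcal F(u,A)\le C\big(|A|+V^m_{p(\cdot)}(u;A)+V^m_{p(\cdot)}(u;A)^{p^+}\big)$$ for every $u\in\mathrm{BV}^{p(\cdot)}(\Omega;\mathbb R^m)$ and every open $A\subset\Omega$. Moreover, for every fixed $u\in\mathrm{BV}^{p(\cdot)}(\Omega;\mathbb R^m)$, the set function $A\mapsto\mathcal F(u,A)$ is the restriction to the open subsets of $\Omega$ of a finite Radon measure in $\Omega$. -/

import Mathlib

open MeasureTheory Filter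
open scoped ENNReal NNReal Topology ContDiff

namespace VarExp

/-- `ℝⁿ` with its Euclidean norm. -/
abbrev Vec (n : ℕ) : Type := EuclideanSpace ℝ (Fin n)

/-- `m × n` real matrices with the Euclidean (Frobenius) norm; the entry in row `α` and
column `i` of `ξ` is `ξ (α, i)`. -/
abbrev Mat (m n : ℕ) : Type := EuclideanSpace ℝ (Fin m × Fin n)

/-! ### Generalized Orlicz spaces

Functions on a set `A ⊆ ℝⁿ` are represented by functions on `ℝⁿ` of which only the restriction
to `A` (up to null sets) is ever used. A generalized Orlicz function is
`φ : ℝⁿ → ℝ → [0, ∞]`, where only the arguments `t ≥ 0` are used. -/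

/-- The modular `∫_A φ(x, |g(x)|) dx`. -/
noncomputable def modular {n : ℕ} {F : Type*} [NormedAddCommGroup F]
    (φ : Vec n → ℝ → ℝ≥0∞) (A : Set (Vec n)) (g : Vec n → F) : ℝ≥0∞ :=
  ∫⁻ x in A, φ x ‖g x‖

/-- `g ∈ L^φ(A; F)`: `g` is measurable on `A` and `∫_A φ(x, c |g(x)|) dx < ∞` for some `c > 0`. -/
def MemLphi {n : ℕ} {F : Type*} [NormedAddCommGroup F] [NormedSpace ℝ F]
    (φ : Vec n → ℝ → ℝ≥0∞) (A : Set (Vec n)) (g : Vec n → F) : Prop :=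
  AEStronglyMeasurable g (volume.restrict A) ∧
    ∃ c : ℝ, 0 < c ∧ modular φ A (fun x => c • g x) < ⊤

/-- The Luxemburg norm `inf {c > 0 | ∫_A φ(x, |g(x)| / c) dx ≤ 1}`, equal to `∞` if there is
no such `c`. -/
noncomputable def luxNorm {n : ℕ} {F : Type*} [NormedAddCommGroup F] [NormedSpace ℝ F]
    (φ : Vec n → ℝ → ℝ≥0∞) (A : Set (Vec n)) (g : Vec n → F) : ℝ≥0∞ :=
  ⨅ (c : ℝ) (_ : 0 < c) (_ : modular φ A (fun x => c⁻¹ • g x) ≤ 1), ENNReal.ofReal c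

/-- The conjugate function `φ*(x, t) = sup_{s ≥ 0} (s t - φ(x, s))`. The subtraction in `[0, ∞]`
is truncated at `0`, which does not change the supremum because `φ(x, 0) = 0`. -/
noncomputable def conj {n : ℕ} (φ : Vec n → ℝ → ℝ≥0∞) (x : Vec n) (t : ℝ) : ℝ≥0∞ :=
  ⨆ (s : ℝ) (_ : 0 ≤ s), (ENNReal.ofReal (s * t) - φ x s)

/-! ### Variable exponents -/

/-- `p : Ω → [1, ∞)` is measurable. -/
def IsVariableExponent {n : ℕ} (Ω : Set (Vec n)) (p : Vec n → ℝ) : Prop :=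
  Measurable (fun x : Ω => p x) ∧ ∀ x ∈ Ω, 1 ≤ p x

/-- Log-Hölder continuity of `p` in `Ω`. -/
def IsLogHolder {n : ℕ} (Ω : Set (Vec n)) (p : Vec n → ℝ) : Prop :=
  ∃ C : ℝ, 0 < C ∧ ∀ x ∈ Ω, ∀ y ∈ Ω,
    |p x - p y| ≤ C / Real.log (Real.exp 1 + 1 / ‖x - y‖)

/-- `p⁺`, the essential supremum of `p` over `Ω`. -/
noncomputable def pPlus {n : ℕ} (Ω : Set (Vec n)) (p : Vec n → ℝ) : ℝ :=
  essSup p (volume.restrict Ω)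

/-- `φ(x, t) = t ^ p(x) / p(x)`. -/
noncomputable def powPhi {n : ℕ} (p : Vec n → ℝ) (x : Vec n) (t : ℝ) : ℝ≥0∞ :=
  ENNReal.ofReal (t ^ p x / p x)

/-! ### Functions of bounded variation -/

/-- `w ∈ [C¹_0(A; ℝⁿ)]ᵐ`: continuously differentiable with compact support in `A`. -/
def IsTestField {n m : ℕ} (A : Set (Vec n)) (w : Vec n → Mat m n) : Prop :=
  ContDiff ℝ 1 w ∧ HasCompactSupport w ∧ tsupport w ⊆ A

/-- The divergence of the row `w_α` of a matrix field at the point `x`. -/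
noncomputable def rowDiv {n m : ℕ} (w : Vec n → Mat m n) (α : Fin m) (x : Vec n) : ℝ :=
  ∑ i : Fin n, fderiv ℝ w x (EuclideanSpace.single i 1) (α, i)

/-- The variation
`V_φ^m(u; A) = sup {∑_α ∫_A u_α div w_α dx | w ∈ [C¹_0(A; ℝⁿ)]ᵐ, ‖w‖_{φ*} ≤ 1}`.
The supremum is nonnegative since `w = 0` is admissible. -/
noncomputable def variation {n m : ℕ} (φ : Vec n → ℝ → ℝ≥0∞) (u : Vec n → Vec m)
    (A : Set (Vec n)) : ℝ≥0∞ :=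
  ⨆ (w : Vec n → Mat m n) (_ : IsTestField A w) (_ : luxNorm (conj φ) A w ≤ 1),
    ENNReal.ofReal (∑ α : Fin m, ∫ x in A, u x α * rowDiv w α x)

/-- `u ∈ BV^φ(Ω; ℝᵐ)`. -/
def MemBV {n m : ℕ} (φ : Vec n → ℝ → ℝ≥0∞) (Ω : Set (Vec n)) (u : Vec n → Vec m) : Prop :=
  MemLphi φ Ω u ∧ luxNorm φ Ω u + variation φ u Ω < ⊤

/-! ### Sobolev functions and the relaxed functional -/

/-- `G` is the weak gradient of `v` in the open set `A`: `G_{α i} = ∂_i v_α` in the sense of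
distributions. -/
def IsWeakGradient {n m : ℕ} (A : Set (Vec n)) (v : Vec n → Vec m) (G : Vec n → Mat m n) :
    Prop :=
  LocallyIntegrableOn v A ∧ LocallyIntegrableOn G A ∧
    ∀ ψ : Vec n → ℝ, ContDiff ℝ ∞ ψ → HasCompactSupport ψ → tsupport ψ ⊆ A →
      ∀ (α : Fin m) (i : Fin n),
        ∫ x in A, v x α * fderiv ℝ ψ x (EuclideanSpace.single i 1) =
          - ∫ x in A, G x (α, i) * ψ x

/-- `v ∈ W^{1,p(·)}(A; ℝᵐ)` with weak gradient `G`. -/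
def MemSobolev {n m : ℕ} (p : Vec n → ℝ) (A : Set (Vec n)) (v : Vec n → Vec m)
    (G : Vec n → Mat m n) : Prop :=
  MemLphi (powPhi p) A v ∧ IsWeakGradient A v G ∧ MemLphi (powPhi p) A G

/-- The energy `∫_A f(G(x)) ^ p(x) dx`. -/
noncomputable def energy {n m : ℕ} (p : Vec n → ℝ) (f : Mat m n → ℝ) (A : Set (Vec n))
    (G : Vec n → Mat m n) : ℝ≥0∞ :=
  ∫⁻ x in A, ENNReal.ofReal (f (G x) ^ p x)

/-- The relaxed functional: the infimum of `liminf_h ∫_A f(∇u_h) ^ p(x) dx` over all sequences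
`u_h ∈ W^{1,p(·)}(A; ℝᵐ)` with `u_h → u` in `L^{p(·)}(A; ℝᵐ)`. -/
noncomputable def relaxed {n m : ℕ} (p : Vec n → ℝ) (f : Mat m n → ℝ) (u : Vec n → Vec m)
    (A : Set (Vec n)) : ℝ≥0∞ :=
  ⨅ (v : ℕ → Vec n → Vec m) (G : ℕ → Vec n → Mat m n)
    (_ : ∀ h, MemSobolev p A (v h) (G h))
    (_ : Tendsto (fun h => luxNorm (powPhi p) A (fun x => v h x - u x)) atTop (𝓝 0)),
    liminf (fun h => energy p f A (G h)) atTop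

end VarExp

/-! The exponent may equal 1, so `Du` is in general only a measure, and the variation is a norm of
it, not additive in `A`. The proof therefore works with the modular counterpart `dualEnergy`, the
supremum of `⟨Du, w⟩ - ∫ φ*(x, |w|)`, which plays the role of `∫_A φ(x, |Du|)`. By the De
Giorgi–Letta criterion it is the restriction of a finite measure `μ` to open sets, and a scaling
argument bounds it by `V + V ^ p⁺` (`dualEnergy_powPhi_le`).

For the upper bound, `u` is mollified at `x` with a radius `e x` which is 1/2-Lipschitz and positive
exactly in `A`. The balls `B(x, e x)` then stay in `A`, so no extension of `u` is needed. Although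
the radius varies, the gradient of the mollification is still a pairing of `Du` with a test field in
`B(x, e x)` of size `(e x)⁻ⁿ` (`sum_fderiv_kernelField`). Testing the dual energy with a suitable
multiple of this field, and using log-Hölder continuity to freeze the exponent in the ball, gives
`|∇u_e(x)| ^ p(x) ≤ C (1 + (e x)⁻ⁿ μ(B(x, e x)))` (`divPairing_le`). Tonelli's theorem integrates
this to `C (|A| + μ(A))`. A similar pointwise bound for `u_e` itself gives convergence in
`L^{p(·)}`, and the growth of `f` turns the gradient bound into an energy bound.

The measure property of `relaxed` is De Giorgi–Letta once more. Superadditivity comes from the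
additivity of the integral. Subadditivity is De Giorgi's slicing: near-optimal functions on `A` and
`B` are joined by a cutoff whose transition layer is the cheapest of many disjoint ones
(`exists_glue_near`). Inner regularity follows from subadditivity and the upper bound, because the
functional is dominated by a finite measure near the boundary of `A` (`exists_lt_relaxed`). -/

namespace VarExp

/-! ### Measures from set functions on open sets -/

/-- The **De Giorgi–Letta criterion**: an increasing function of open sets which is superadditive
on disjoint sets, subadditive and inner regular is the restriction of a Borel measure. -/
theorem exists_measure_eq_on_isOpen {E : Type*} [MetricSpace E] [LocallyCompactSpace E]
    [MeasurableSpace E] [BorelSpace E] {Ω : Set E} (hΩ : IsOpen Ω) (F : Set E → ℝ≥0∞)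
    (mono : ∀ A B, IsOpen A → IsOpen B → A ⊆ B → B ⊆ Ω → F A ≤ F B)
    (empty : F ∅ = 0)
    (superadd : ∀ A B, IsOpen A → IsOpen B → A ⊆ Ω → B ⊆ Ω → Disjoint A B →
      F A + F B ≤ F (A ∪ B))
    (nested : ∀ A' A B, IsOpen A' → IsOpen A → IsOpen B → A ⊆ Ω → B ⊆ Ω →
      IsCompact (closure A') → closure A' ⊆ A → F (A' ∪ B) ≤ F A + F B)
    (inner : ∀ A, IsOpen A → A ⊆ Ω → ∀ a < F A, ∃ A', IsOpen A' ∧ IsCompact (closure A') ∧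
      closure A' ⊆ A ∧ a < F A')
    (fin : F Ω < ⊤) :
    ∃ μ : Measure E, IsFiniteMeasure μ ∧ μ Ωᶜ = 0 ∧ ∀ A, IsOpen A → A ⊆ Ω → F A = μ A := by
  classical
  -- The gap between `V i` and `U i` is what `nested` consumes, one set at a time.
  have finite_sub : ∀ (t : Finset ℕ) (V U : ℕ → Set E), (∀ i, IsOpen (V i)) →
      (∀ i, IsOpen (U i)) → (∀ i, U i ⊆ Ω) → (∀ i, IsCompact (closure (V i))) →
      (∀ i, closure (V i) ⊆ U i) → F (⋃ i ∈ t, V i) ≤ ∑ i ∈ t, F (U i) := by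
    intro t V U hV hU hUΩ hVc hVU
    induction t using Finset.induction_on with
    | empty => simp [empty]
    | insert j t hj ih =>
      rw [Finset.set_biUnion_insert, Finset.sum_insert hj]
      refine (nested (V j) (U j) _ (hV j) (hU j) (isOpen_biUnion fun i _ => hV i) (hUΩ j) ?_
        (hVc j) (hVU j)).trans (add_le_add le_rfl ih)
      exact Set.iUnion₂_subset fun i _ => (subset_closure.trans (hVU i)).trans (hUΩ i)
  have countable_sub : ∀ U : ℕ → Set E, (∀ i, IsOpen (U i)) → (∀ i, U i ⊆ Ω) →
      F (⋃ i, U i) ≤ ∑' i, F (U i) := by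
    intro U hU hUΩ
    -- Inner regularity leaves a set with compact closure in the union. Finitely many `U i` cover
    -- this closure, and the cover can be shrunk to sets compactly contained in the `U i`.
    refine le_of_forall_lt fun a ha => ?_
    obtain ⟨A', hA', hcomp, hsub, haF⟩ :=
      inner _ (isOpen_iUnion hU) (Set.iUnion_subset hUΩ) a ha
    obtain ⟨t, ht⟩ := hcomp.elim_finite_subcover U hU hsub
    obtain ⟨K, hK, hKU, hKt⟩ := hcomp.finite_compact_cover t U (fun i _ => hU i) ht
    have hex := fun i => exists_open_between_and_isCompact_closure (hK i) (hU i) (hKU i)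
    choose V hV hKV hVU hVc using hex
    refine haF.trans_le (le_trans (mono A' (⋃ i ∈ t, V i) hA' (isOpen_biUnion fun i _ => hV i)
      ?_ ?_) ((finite_sub t V U hV hU hUΩ hVc hVU).trans (ENNReal.sum_le_tsum t)))
    · refine subset_closure.trans ?_
      rw [hKt]
      exact Set.iUnion₂_mono fun i _ => hKV i
    · exact Set.iUnion₂_subset fun i _ => (subset_closure.trans (hVU i)).trans (hUΩ i)
  -- Intersecting with `Ω` defines the set function on all open sets, as the induced outer measure
  -- requires.
  let m : ∀ s : Set E, IsOpen s → ℝ≥0∞ := fun s _ => F (s ∩ Ω)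
  have m0 : m ∅ isOpen_empty = 0 := by simp [m, empty]
  have msU : ∀ ⦃f : ℕ → Set E⦄ (hm : ∀ i, IsOpen (f i)),
      m (⋃ i, f i) (isOpen_iUnion hm) ≤ ∑' i, m (f i) (hm i) := by
    intro f hf
    simp only [m, Set.iUnion_inter]
    exact countable_sub _ (fun i => (hf i).inter hΩ) fun i => Set.inter_subset_right
  have m_mono : ∀ ⦃s₁ s₂ : Set E⦄ (hs₁ : IsOpen s₁) (hs₂ : IsOpen s₂), s₁ ⊆ s₂ →
      m s₁ hs₁ ≤ m s₂ hs₂ := fun s₁ s₂ h₁ h₂ h =>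
    mono _ _ (h₁.inter hΩ) (h₂.inter hΩ) (Set.inter_subset_inter_left _ h) Set.inter_subset_right
  let ν : OuterMeasure E := inducedOuterMeasure m isOpen_empty m0
  have hν : ∀ s (hs : IsOpen s), ν s = F (s ∩ Ω) := fun s hs =>
    inducedOuterMeasure_eq' (fun _ h => isOpen_iUnion h) msU m_mono hs
  -- By Carathéodory's criterion, additivity on sets at positive distance `r` makes Borel sets
  -- measurable. Inside any open `w` containing both sets, their `r / 2`-neighbourhoods are disjoint
  -- and open, so superadditivity applies to them.
  have hmetric : ν.IsMetric := by
    intro s t ⟨r, hr, hst⟩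
    refine le_antisymm (measure_union_le s t) ?_
    rw [show ν (s ∪ t) = ⨅ (w : Set E) (hw : IsOpen w) (_ : s ∪ t ⊆ w), m w hw from
      inducedOuterMeasure_eq_iInf (fun _ h => isOpen_iUnion h) msU m_mono _]
    refine le_iInf fun w => le_iInf fun hw => le_iInf fun hstw => ?_
    let S : Set E := w ∩ ⋃ x ∈ s, Metric.eball x (r / 2)
    let T : Set E := w ∩ ⋃ x ∈ t, Metric.eball x (r / 2)
    have hS : IsOpen S := hw.inter (isOpen_biUnion fun _ _ => Metric.isOpen_eball)
    have hT : IsOpen T := hw.inter (isOpen_biUnion fun _ _ => Metric.isOpen_eball)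
    have hr2 : 0 < r / 2 := ENNReal.half_pos hr
    have hsS : s ⊆ S := fun x hx => ⟨hstw (Or.inl hx),
      Set.mem_biUnion hx (Metric.mem_eball_self hr2)⟩
    have htT : t ⊆ T := fun x hx => ⟨hstw (Or.inr hx),
      Set.mem_biUnion hx (Metric.mem_eball_self hr2)⟩
    have hdisj : Disjoint S T := by
      rw [Set.disjoint_left]
      rintro z ⟨_, hz⟩ ⟨_, hz'⟩
      obtain ⟨x, hx, hzx⟩ := Set.mem_iUnion₂.1 hz
      obtain ⟨y, hy, hzy⟩ := Set.mem_iUnion₂.1 hz'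
      have h1 := hst x hx y hy
      have h2 : edist x y < r / 2 + r / 2 :=
        (edist_triangle_left x y z).trans_lt (ENNReal.add_lt_add hzx hzy)
      rw [ENNReal.add_halves] at h2
      exact absurd h1 (not_le.2 h2)
    calc ν s + ν t ≤ ν S + ν T := add_le_add (measure_mono hsS) (measure_mono htT)
      _ = F (S ∩ Ω) + F (T ∩ Ω) := by rw [hν S hS, hν T hT]
      _ ≤ F (S ∩ Ω ∪ T ∩ Ω) := superadd _ _ (hS.inter hΩ) (hT.inter hΩ) Set.inter_subset_right
          Set.inter_subset_right (hdisj.mono Set.inter_subset_left Set.inter_subset_left)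
      _ ≤ m w hw := mono _ _ ((hS.inter hΩ).union (hT.inter hΩ)) (hw.inter hΩ)
          (Set.union_subset (Set.inter_subset_inter_left _ Set.inter_subset_left)
            (Set.inter_subset_inter_left _ Set.inter_subset_left)) Set.inter_subset_right
  have hcar : ‹MeasurableSpace E› ≤ ν.caratheodory := by
    rw [BorelSpace.measurable_eq (α := E)]
    exact hmetric.borel_le_caratheodory
  have hμ : ∀ s (hs : IsOpen s), ν.toMeasure hcar s = F (s ∩ Ω) := fun s hs => by
    rw [toMeasure_apply _ _ hs.measurableSet, hν s hs]
  refine ⟨(ν.toMeasure hcar).restrict Ω, ⟨?_⟩, ?_, ?_⟩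
  · rw [Measure.restrict_apply_univ, hμ Ω hΩ, Set.inter_self]
    exact fin
  · rw [Measure.restrict_apply hΩ.measurableSet.compl]
    simp
  · intro A hA hAΩ
    rw [Measure.restrict_apply hA.measurableSet, hμ _ (hA.inter hΩ),
      Set.inter_eq_left.2 hAΩ, Set.inter_eq_left.2 hAΩ]

variable {n m : ℕ}

/-! ### The conjugate function -/

theorem conj_zero (φ : Vec n → ℝ → ℝ≥0∞) (x : Vec n) : conj φ x 0 = 0 := by
  simp [conj]

theorem conj_mono (φ : Vec n → ℝ → ℝ≥0∞) (x : Vec n) : Monotone (conj φ x) := by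
  intro t t' h
  refine iSup₂_mono fun s hs => ?_
  gcongr

/-- Convexity and `φ*(x, 0) = 0`; directly, `θ s t - φ(x, s) ≤ θ (s t - φ(x, s))` because `θ ≤ 1`.
-/
theorem conj_mul_le (φ : Vec n → ℝ → ℝ≥0∞) (x : Vec n) {θ : ℝ} (h0 : 0 ≤ θ) (h1 : θ ≤ 1) (t : ℝ) :
    conj φ x (θ * t) ≤ ENNReal.ofReal θ * conj φ x t := by
  refine iSup₂_le fun s hs => ?_
  calc ENNReal.ofReal (s * (θ * t)) - φ x s
      ≤ ENNReal.ofReal θ * ENNReal.ofReal (s * t) - ENNReal.ofReal θ * φ x s := by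
        rw [← ENNReal.ofReal_mul h0, show s * (θ * t) = θ * (s * t) by ring]
        refine tsub_le_tsub_left ?_ _
        exact mul_le_of_le_one_left' (ENNReal.ofReal_le_one.2 h1)
    _ = ENNReal.ofReal θ * (ENNReal.ofReal (s * t) - φ x s) := by
        rw [ENNReal.mul_sub fun _ _ => ENNReal.ofReal_ne_top]
    _ ≤ _ := by
        gcongr
        exact le_iSup₂ (f := fun (s : ℝ) (_ : 0 ≤ s) => ENNReal.ofReal (s * t) - φ x s) s hs

/-- The dual form of `φ(x, b r) ≥ b ^ P φ(x, r)`, obtained by substituting `s = b r`. The gain over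
convexity alone, `b ^ P` against `b ^ (P - 1)`, is what produces the power `V ^ P` with no larger
exponent. -/
theorem conj_powPhi_rpow_mul_le {p : Vec n → ℝ} {x : Vec n} {P b : ℝ} (hp : 1 ≤ p x)
    (hP : p x ≤ P) (hb : 0 < b) (hb1 : b ≤ 1) (t : ℝ) :
    conj (powPhi p) x (b ^ (P - 1) * t) ≤ ENNReal.ofReal (b ^ P) * conj (powPhi p) x t := by
  have hbP : 0 ≤ b ^ P := Real.rpow_nonneg hb.le _
  refine iSup₂_le fun s hs => ?_
  have hr : 0 ≤ s / b := div_nonneg hs hb.le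
  calc ENNReal.ofReal (s * (b ^ (P - 1) * t)) - powPhi p x s
      ≤ ENNReal.ofReal (b ^ P) * ENNReal.ofReal (s / b * t)
          - ENNReal.ofReal (b ^ P) * powPhi p x (s / b) := by
        unfold powPhi
        rw [← ENNReal.ofReal_mul hbP, ← ENNReal.ofReal_mul hbP]
        refine tsub_le_tsub (le_of_eq ?_) (ENNReal.ofReal_le_ofReal ?_)
        · congr 1
          rw [Real.rpow_sub hb, Real.rpow_one]
          ring
        · rw [Real.div_rpow hs hb.le, ← mul_div_assoc]
          gcongr
          have h2 : b ^ P ≤ b ^ p x := Real.rpow_le_rpow_of_exponent_ge hb hb1 hP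
          have h3 : 0 < b ^ p x := Real.rpow_pos_of_pos hb _
          rw [mul_div_assoc', div_le_iff₀ h3, mul_comm]
          exact mul_le_mul_of_nonneg_left h2 (Real.rpow_nonneg hs _)
    _ = ENNReal.ofReal (b ^ P) * (ENNReal.ofReal (s / b * t) - powPhi p x (s / b)) := by
        rw [ENNReal.mul_sub fun _ _ => ENNReal.ofReal_ne_top]
    _ ≤ _ := by
        gcongr
        exact le_iSup₂ (f := fun (s : ℝ) (_ : 0 ≤ s) => ENNReal.ofReal (s * t) - powPhi p x s) _ hr

/-! ### Test fields -/

namespace IsTestField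

variable {A B : Set (Vec n)} {w w' : Vec n → Mat m n}

theorem mono (hw : IsTestField A w) (h : A ⊆ B) : IsTestField B w :=
  ⟨hw.1, hw.2.1, hw.2.2.trans h⟩

theorem add (hw : IsTestField A w) (hw' : IsTestField A w') : IsTestField A (w + w') :=
  ⟨hw.1.add hw'.1, hw.2.1.add hw'.2.1,
    (tsupport_add w w').trans (Set.union_subset hw.2.2 hw'.2.2)⟩

theorem const_smul (hw : IsTestField A w) (c : ℝ) : IsTestField A (c • w) :=
  ⟨hw.1.const_smul c, hw.2.1.of_isClosed_subset (isClosed_tsupport _)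
    (tsupport_smul_subset_right (fun _ => c) w),
    (tsupport_smul_subset_right (fun _ => c) w).trans hw.2.2⟩

theorem smul {ζ : Vec n → ℝ} (hw : IsTestField A w) (hζ : ContDiff ℝ 1 ζ)
    (h : tsupport ζ ∩ tsupport w ⊆ B) : IsTestField B (fun x => ζ x • w x) :=
  ⟨hζ.smul hw.1, hw.2.1.of_isClosed_subset (isClosed_tsupport _)
    (tsupport_smul_subset_right ζ w), (Set.subset_inter (tsupport_smul_subset_left ζ w)
    (tsupport_smul_subset_right ζ w)).trans h⟩

theorem differentiable (hw : IsTestField A w) : Differentiable ℝ w :=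
  hw.1.differentiable one_ne_zero

theorem eq_zero (hw : IsTestField A w) {x : Vec n} (hx : x ∉ A) : w x = 0 :=
  image_eq_zero_of_notMem_tsupport fun h => hx (hw.2.2 h)

theorem rowDiv_eq_zero (hw : IsTestField A w) (α : Fin m) {x : Vec n} (hx : x ∉ A) :
    rowDiv w α x = 0 := by
  have h : fderiv ℝ w x = 0 := by
    by_contra h
    exact hx (hw.2.2 (support_fderiv_subset ℝ h))
  simp [rowDiv, h]

theorem continuous_rowDiv (hw : IsTestField A w) (α : Fin m) : Continuous (rowDiv w α) := by
  unfold rowDiv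
  have := hw.1.continuous_fderiv one_ne_zero
  fun_prop

theorem exists_rowDiv_bound (hw : IsTestField A w) (α : Fin m) :
    ∃ C, ∀ x, ‖rowDiv w α x‖ ≤ C := by
  refine HasCompactSupport.exists_bound_of_continuous ?_ (hw.continuous_rowDiv α)
  refine hw.2.1.of_isClosed_subset (isClosed_tsupport _) (closure_minimal ?_ (isClosed_tsupport w))
  intro x hx
  by_contra h
  exact hx (IsTestField.rowDiv_eq_zero ⟨hw.1, hw.2.1, subset_rfl⟩ α h)

end IsTestField

theorem rowDiv_add {w w' : Vec n → Mat m n} (hw : Differentiable ℝ w) (hw' : Differentiable ℝ w')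
    (α : Fin m) (x : Vec n) : rowDiv (w + w') α x = rowDiv w α x + rowDiv w' α x := by
  simp [rowDiv, fderiv_add (hw x) (hw' x), Finset.sum_add_distrib]

theorem rowDiv_const_smul {w : Vec n → Mat m n} (hw : Differentiable ℝ w) (c : ℝ)
    (α : Fin m) (x : Vec n) : rowDiv (c • w) α x = c * rowDiv w α x := by
  simp [rowDiv, fderiv_const_smul (hw x), Finset.mul_sum]

/-! ### The distributional gradient as a linear functional -/

/-- The pairing `∑_α ∫_Ω u_α div w_α dx`. -/
noncomputable def divPairing (Ω : Set (Vec n)) (u : Vec n → Vec m) (w : Vec n → Mat m n) : ℝ :=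
  ∑ α : Fin m, ∫ x in Ω, u x α * rowDiv w α x

theorem integrableOn_apply {Ω : Set (Vec n)} {u : Vec n → Vec m} (hu : IntegrableOn u Ω)
    (α : Fin m) : IntegrableOn (fun x => u x α) Ω :=
  (EuclideanSpace.proj (𝕜 := ℝ) α : Vec m →L[ℝ] ℝ).integrable_comp hu

theorem integrableOn_mul_rowDiv {Ω A : Set (Vec n)} {u : Vec n → Vec m} (hu : IntegrableOn u Ω)
    {w : Vec n → Mat m n} (hw : IsTestField A w) (α : Fin m) :
    IntegrableOn (fun x => u x α * rowDiv w α x) Ω := by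
  obtain ⟨C, hC⟩ := hw.exists_rowDiv_bound α
  exact (integrableOn_apply hu α).mul_bdd
    (hw.continuous_rowDiv α).aestronglyMeasurable (ae_of_all _ hC)

theorem divPairing_add {Ω A : Set (Vec n)} {u : Vec n → Vec m} (hu : IntegrableOn u Ω)
    {w w' : Vec n → Mat m n} (hw : IsTestField A w) (hw' : IsTestField A w') :
    divPairing Ω u (w + w') = divPairing Ω u w + divPairing Ω u w' := by
  simp only [divPairing, rowDiv_add hw.differentiable hw'.differentiable, mul_add]
  rw [← Finset.sum_add_distrib]
  exact Finset.sum_congr rfl fun α _ =>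
    integral_add (integrableOn_mul_rowDiv hu hw α) (integrableOn_mul_rowDiv hu hw' α)

theorem divPairing_const_smul {Ω A : Set (Vec n)} (u : Vec n → Vec m)
    {w : Vec n → Mat m n} (hw : IsTestField A w) (c : ℝ) :
    divPairing Ω u (c • w) = c * divPairing Ω u w := by
  simp only [divPairing, rowDiv_const_smul hw.differentiable, mul_left_comm _ c,
    integral_const_mul, Finset.mul_sum]

theorem divPairing_eq_of_subset {Ω A : Set (Vec n)} (hΩ : IsOpen Ω) (hA : A ⊆ Ω)
    (u : Vec n → Vec m) {w : Vec n → Mat m n} (hw : IsTestField A w) :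
    ∑ α : Fin m, ∫ x in A, u x α * rowDiv w α x = divPairing Ω u w := by
  refine Finset.sum_congr rfl fun α _ => ?_
  refine (setIntegral_eq_of_subset_of_forall_sdiff_eq_zero hΩ.measurableSet hA ?_).symm
  intro x hx
  rw [hw.rowDiv_eq_zero α hx.2, mul_zero]

/-! ### The dual energy -/

/-- `sup {⟨Du, w⟩ - ∫_Ω φ*(x, |w|) dx}` over the test fields `w` in `A`. Its value is the integral
of `φ(x, |Du|)` over `A`, and unlike the variation it is a measure as a function of `A`. -/
noncomputable def dualEnergy (φ : Vec n → ℝ → ℝ≥0∞) (Ω : Set (Vec n)) (u : Vec n → Vec m)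
    (A : Set (Vec n)) : ℝ≥0∞ :=
  ⨆ (w : Vec n → Mat m n) (_ : IsTestField A w),
    (ENNReal.ofReal (divPairing Ω u w) - modular (conj φ) Ω w)

section DualEnergy

variable {φ : Vec n → ℝ → ℝ≥0∞} {Ω : Set (Vec n)} {u : Vec n → Vec m}

theorem le_dualEnergy {A : Set (Vec n)} {w : Vec n → Mat m n} (hw : IsTestField A w) :
    ENNReal.ofReal (divPairing Ω u w) - modular (conj φ) Ω w ≤ dualEnergy φ Ω u A :=
  le_iSup₂ (f := fun (w : Vec n → Mat m n) (_ : IsTestField A w) =>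
    ENNReal.ofReal (divPairing Ω u w) - modular (conj φ) Ω w) w hw

theorem dualEnergy_mono {A B : Set (Vec n)} (h : A ⊆ B) :
    dualEnergy φ Ω u A ≤ dualEnergy φ Ω u B :=
  iSup₂_le fun _ hw => le_dualEnergy (hw.mono h)

theorem dualEnergy_empty : dualEnergy φ Ω u ∅ = 0 := by
  refine le_antisymm (iSup₂_le fun w hw => ?_) zero_le
  have : w = 0 := funext fun x => hw.eq_zero (Set.notMem_empty x)
  simp [this, divPairing, rowDiv]

theorem modular_conj_add_le {A B : Set (Vec n)} (hA : IsOpen A)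
    (hAB : Disjoint A B) {w w' : Vec n → Mat m n} (hw : IsTestField A w) (hw' : IsTestField B w') :
    modular (conj φ) Ω (w + w') ≤ modular (conj φ) Ω w + modular (conj φ) Ω w' := by
  unfold modular
  rw [← lintegral_add_compl (μ := volume.restrict Ω) (fun x => conj φ x ‖(w + w') x‖)
    hA.measurableSet]
  refine add_le_add ?_ ?_
  · refine le_trans (le_of_eq ?_) (setLIntegral_le_lintegral A _)
    refine setLIntegral_congr_fun hA.measurableSet fun x hx => ?_
    simp [hw'.eq_zero (Set.disjoint_left.1 hAB hx)]
  · refine le_trans (le_of_eq ?_) (setLIntegral_le_lintegral Aᶜ _)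
    refine setLIntegral_congr_fun hA.measurableSet.compl fun x hx => ?_
    simp [hw.eq_zero hx]

/-- Competitors on disjoint sets can be added: the pairing is linear and the modular of the sum
splits. -/
theorem dualEnergy_superadditive (hu : IntegrableOn u Ω) {A B : Set (Vec n)} (hA : IsOpen A)
    (hAB : Disjoint A B) :
    dualEnergy φ Ω u A + dualEnergy φ Ω u B ≤ dualEnergy φ Ω u (A ∪ B) := by
  refine ENNReal.iSup_add_iSup_le fun w w' => ?_
  by_cases hw : IsTestField A w
  swap
  · simpa [hw] using fun hw' => le_dualEnergy (IsTestField.mono hw' Set.subset_union_right)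
  by_cases hw' : IsTestField B w'
  swap
  · simpa [hw, hw'] using le_dualEnergy (IsTestField.mono hw Set.subset_union_left)
  simp only [hw, hw', iSup_pos]
  have hwAB := hw.mono (Set.subset_union_left (s := A) (t := B))
  have hwAB' := hw'.mono (Set.subset_union_right (s := A) (t := B))
  -- Subtraction is truncated. In the degenerate cases one of the two terms is zero and the other
  -- competitor alone suffices; afterwards both differences are genuine and can be added.
  rcases le_or_gt (divPairing Ω u w) 0 with h0 | h0
  · simpa [ENNReal.ofReal_of_nonpos h0] using le_dualEnergy (φ := φ) (Ω := Ω) (u := u) hwAB'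
  rcases le_or_gt (divPairing Ω u w') 0 with h0' | h0'
  · simpa [ENNReal.ofReal_of_nonpos h0'] using le_dualEnergy (φ := φ) (Ω := Ω) (u := u) hwAB
  rcases eq_or_ne (modular (conj φ) Ω w) ⊤ with ht | ht
  · simpa [ht] using le_dualEnergy (φ := φ) (Ω := Ω) (u := u) hwAB'
  rcases eq_or_ne (modular (conj φ) Ω w') ⊤ with ht' | ht'
  · simpa [ht'] using le_dualEnergy (φ := φ) (Ω := Ω) (u := u) hwAB
  rcases le_total (ENNReal.ofReal (divPairing Ω u w)) (modular (conj φ) Ω w) with h1 | h1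
  · simpa [tsub_eq_zero_of_le h1] using le_dualEnergy (φ := φ) (Ω := Ω) (u := u) hwAB'
  rcases le_total (ENNReal.ofReal (divPairing Ω u w')) (modular (conj φ) Ω w') with h1' | h1'
  · simpa [tsub_eq_zero_of_le h1'] using le_dualEnergy (φ := φ) (Ω := Ω) (u := u) hwAB
  refine le_trans ?_ (le_dualEnergy (hwAB.add hwAB'))
  rw [divPairing_add hu hwAB hwAB', ENNReal.ofReal_add h0.le h0'.le]
  calc _ = ENNReal.ofReal (divPairing Ω u w) + ENNReal.ofReal (divPairing Ω u w')
        - (modular (conj φ) Ω w + modular (conj φ) Ω w') := by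
        refine ENNReal.eq_sub_of_add_eq (ENNReal.add_ne_top.2 ⟨ht, ht'⟩) ?_
        rw [add_add_add_comm, tsub_add_cancel_of_le h1, tsub_add_cancel_of_le h1']
    _ ≤ _ := tsub_le_tsub_left (modular_conj_add_le hA hAB hw hw') _

/-- A near-optimal test field has compact support in `A`, so it already competes on a smaller set.
-/
theorem exists_lt_dualEnergy {A : Set (Vec n)} (hA : IsOpen A) {a : ℝ≥0∞}
    (ha : a < dualEnergy φ Ω u A) : ∃ A', IsOpen A' ∧ IsCompact (closure A') ∧ closure A' ⊆ A ∧
      a < dualEnergy φ Ω u A' := by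
  obtain ⟨w, hw⟩ := lt_iSup_iff.1 ha
  obtain ⟨hwA, haw⟩ := lt_iSup_iff.1 hw
  obtain ⟨V, hV, hKV, hVA, hVc⟩ := exists_open_between_and_isCompact_closure hwA.2.1 hA hwA.2.2
  exact ⟨V, hV, hVc, hVA, haw.trans_le (le_dualEnergy ⟨hwA.1, hwA.2.1, hKV⟩)⟩

end DualEnergy

theorem exists_cutoff {K A : Set (Vec n)} (hK : IsCompact K) (hA : IsOpen A) (hKA : K ⊆ A) :
    ∃ ζ : Vec n → ℝ, ContDiff ℝ ∞ ζ ∧ HasCompactSupport ζ ∧ tsupport ζ ⊆ A ∧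
      (∀ x, 0 ≤ ζ x) ∧ (∀ x, ζ x ≤ 1) ∧ ∀ x ∈ K, ζ x = 1 := by
  obtain ⟨V, hV, hKV, hVA, hVc⟩ := exists_open_between_and_isCompact_closure hK hA hKA
  obtain ⟨ζ, h1, h2, h3, h4⟩ := exists_contMDiff_support_eq_eq_one_iff
    (modelWithCornersSelf ℝ (Vec n)) (n := (⊤ : ℕ∞)) hV hK.isClosed hKV
  have hts : tsupport ζ = closure V := by rw [tsupport, h3]
  refine ⟨ζ, contMDiff_iff_contDiff.1 h1, ?_, hts ▸ hVA, fun x => (h2 ⟨x, rfl⟩).1,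
    fun x => (h2 ⟨x, rfl⟩).2, fun x hx => (h4 x).1 hx⟩
  rw [HasCompactSupport, hts]
  exact hVc

theorem tsupport_one_sub_inter_subset {ζ : Vec n → ℝ} {A' S B : Set (Vec n)} (hA' : IsOpen A')
    (h1 : ∀ x ∈ A', ζ x = 1) (hS : S ⊆ A' ∪ B) : tsupport (fun x => 1 - ζ x) ∩ S ⊆ B := by
  rintro x ⟨hx, hxS⟩
  refine (hS hxS).resolve_left fun hxA' => ?_
  refine notMem_tsupport_iff_eventuallyEq.2 ?_ hx
  filter_upwards [hA'.mem_nhds hxA'] with y hy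
  simp [h1 y hy]

/-- Splitting `w = ζ w + (1 - ζ) w` by a cutoff costs nothing: the pairing is linear, and
`conj_mul_le` gives `φ*(ζ t) + φ*((1 - ζ) t) ≤ φ*(t)`. No derivative of `ζ` appears. -/
theorem dualEnergy_nested {φ : Vec n → ℝ → ℝ≥0∞} {Ω : Set (Vec n)} {u : Vec n → Vec m}
    (hu : IntegrableOn u Ω) {A' A B : Set (Vec n)} (hA' : IsOpen A') (hA : IsOpen A)
    (hc : IsCompact (closure A')) (hA'A : closure A' ⊆ A) :
    dualEnergy φ Ω u (A' ∪ B) ≤ dualEnergy φ Ω u A + dualEnergy φ Ω u B := by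
  obtain ⟨ζ, hζ, hζc, hζA, hζ0, hζ1, hζK⟩ := exists_cutoff hc hA hA'A
  refine iSup₂_le fun w hw => ?_
  have hζ' : ContDiff ℝ 1 ζ := hζ.of_le (by exact_mod_cast le_top)
  have hw1 : IsTestField A (fun x => ζ x • w x) :=
    hw.smul hζ' (Set.inter_subset_left.trans hζA)
  have hw2 : IsTestField B (fun x => (1 - ζ x) • w x) :=
    hw.smul (contDiff_const.sub hζ')
      (tsupport_one_sub_inter_subset hA' (fun x hx => hζK x (subset_closure hx)) hw.2.2)
  have hsum : w = (fun x => ζ x • w x) + (fun x => (1 - ζ x) • w x) := by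
    funext x
    simp [← add_smul]
  have hpair : divPairing Ω u w = divPairing Ω u (fun x => ζ x • w x)
      + divPairing Ω u (fun x => (1 - ζ x) • w x) := by
    rw [← divPairing_add hu (hw1.mono Set.subset_union_left) (hw2.mono Set.subset_union_right),
      ← hsum]
  have hmod : modular (conj φ) Ω (fun x => ζ x • w x)
      + modular (conj φ) Ω (fun x => (1 - ζ x) • w x) ≤ modular (conj φ) Ω w := by
    refine (le_lintegral_add _ _).trans (lintegral_mono fun x => ?_)
    have h1 : (0 : ℝ) ≤ 1 - ζ x := sub_nonneg.2 (hζ1 x)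
    rw [norm_smul, norm_smul, Real.norm_of_nonneg (hζ0 x), Real.norm_of_nonneg h1]
    refine (add_le_add (conj_mul_le φ x (hζ0 x) (hζ1 x) _)
      (conj_mul_le φ x h1 (by linarith [hζ0 x]) _)).trans ?_
    rw [← add_mul, ← ENNReal.ofReal_add (hζ0 x) h1]
    simp
  rw [hpair]
  calc _ ≤ ENNReal.ofReal (divPairing Ω u (fun x => ζ x • w x))
          + ENNReal.ofReal (divPairing Ω u (fun x => (1 - ζ x) • w x))
        - (modular (conj φ) Ω (fun x => ζ x • w x)
          + modular (conj φ) Ω (fun x => (1 - ζ x) • w x)) :=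
        tsub_le_tsub ENNReal.ofReal_add_le hmod
    _ ≤ _ := add_tsub_add_le_tsub_add_tsub
    _ ≤ _ := add_le_add (le_dualEnergy hw1) (le_dualEnergy hw2)

/-- Additivity is what allows the values on the balls `B(x, e x)` to be integrated in `x` by
Tonelli's theorem. -/
theorem exists_measure_eq_dualEnergy {φ : Vec n → ℝ → ℝ≥0∞} {Ω : Set (Vec n)} (hΩ : IsOpen Ω)
    {u : Vec n → Vec m} (hu : IntegrableOn u Ω) (hfin : dualEnergy φ Ω u Ω < ⊤) :
    ∃ μ : Measure (Vec n), IsFiniteMeasure μ ∧ μ Ωᶜ = 0 ∧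
      ∀ A, IsOpen A → A ⊆ Ω → dualEnergy φ Ω u A = μ A :=
  exists_measure_eq_on_isOpen hΩ _ (fun _ _ _ _ h _ => dualEnergy_mono h) dualEnergy_empty
    (fun _ _ hA _ _ _ hAB => dualEnergy_superadditive hu hA hAB)
    (fun _ _ _ hA' hA _ _ _ hc hA'A => dualEnergy_nested hu hA' hA hc hA'A)
    (fun _ hA _ _ ha => exists_lt_dualEnergy hA ha) hfin

/-- If `w / l` has modular at most 1, then `⟨Du, w⟩ ≤ l v`. The scale `l` is chosen in terms of `v`
and of the modular `r` of `w` so that `l v ≤ v + v ^ P + r`; the term `r` is then cancelled by the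
subtracted modular. The bound `p ≤ P` is required only almost everywhere, so `P = p⁺` is admissible.
-/
theorem dualEnergy_powPhi_le {Ω A : Set (Vec n)} (hΩ : IsOpen Ω) (hA : A ⊆ Ω)
    {p : Vec n → ℝ} {P : ℝ} (hP0 : 0 ≤ P) (hp : ∀ x ∈ Ω, 1 ≤ p x)
    (hP : ∀ᵐ x ∂volume.restrict Ω, p x ≤ P)
    (u : Vec n → Vec m) :
    dualEnergy (powPhi p) Ω u A ≤
      variation (powPhi p) u A + variation (powPhi p) u A ^ P := by
  rcases eq_or_ne (variation (powPhi p) u A) ⊤ with hV | hV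
  · simp [hV]
  set v := (variation (powPhi p) u A).toReal with hv
  have hv0 : 0 ≤ v := ENNReal.toReal_nonneg
  have hVv : variation (powPhi p) u A = ENNReal.ofReal v := (ENNReal.ofReal_toReal hV).symm
  refine iSup₂_le fun w hw => ?_
  rcases eq_or_ne (modular (conj (powPhi p)) Ω w) ⊤ with hρ | hρ
  · simp [hρ]
  set r := (modular (conj (powPhi p)) Ω w).toReal with hr
  have hr0 : 0 ≤ r := ENNReal.toReal_nonneg
  have hρr : modular (conj (powPhi p)) Ω w = ENNReal.ofReal r := (ENNReal.ofReal_toReal hρ).symm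
  have key : ∀ l : ℝ, 0 < l → modular (conj (powPhi p)) Ω (l⁻¹ • w) ≤ 1 →
      divPairing Ω u w ≤ l * v := by
    intro l hl hmod
    have htest := hw.const_smul l⁻¹
    have hlux : luxNorm (conj (powPhi p)) A (l⁻¹ • w) ≤ 1 := by
      refine (iInf_le _ 1).trans ((iInf_le _ one_pos).trans ((iInf_le _ ?_).trans (by simp)))
      refine le_trans ?_ hmod
      simp only [inv_one, one_smul]
      exact lintegral_mono_set hA
    have h1 : ENNReal.ofReal (divPairing Ω u (l⁻¹ • w)) ≤ variation (powPhi p) u A := by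
      rw [← divPairing_eq_of_subset hΩ hA u htest]
      exact le_iSup₂_of_le _ htest (le_iSup_of_le hlux le_rfl)
    rw [hVv, divPairing_const_smul u hw, ENNReal.ofReal_le_ofReal_iff hv0] at h1
    rwa [inv_mul_le_iff₀ hl] at h1
  -- The scale is `l = y ^ (P - 1) θ`. Dividing by `y ^ (P - 1)` multiplies the modular by at most
  -- `y ^ (-P)`, and `θ` absorbs what may still exceed 1.
  set y := max 1 v with hy
  have hy1 : 1 ≤ y := le_max_left _ _
  have hy0 : 0 < y := one_pos.trans_le hy1
  set θ := max 1 (r * y⁻¹ ^ P) with hθ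
  have hθ1 : 1 ≤ θ := le_max_left _ _
  have hθ0 : 0 < θ := one_pos.trans_le hθ1
  have hl0 : 0 < y ^ (P - 1) * θ := mul_pos (Real.rpow_pos_of_pos hy0 _) hθ0
  have hyP : 0 < y⁻¹ ^ P := Real.rpow_pos_of_pos (inv_pos.2 hy0) _
  have hmod : modular (conj (powPhi p)) Ω ((y ^ (P - 1) * θ)⁻¹ • w) ≤ 1 := by
    have h1 : modular (conj (powPhi p)) Ω ((y ^ (P - 1) * θ)⁻¹ • w) ≤
        ∫⁻ x in Ω, ENNReal.ofReal (θ⁻¹ * y⁻¹ ^ P) * conj (powPhi p) x ‖w x‖ := by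
      refine lintegral_mono_ae ?_
      filter_upwards [hP, ae_restrict_mem hΩ.measurableSet] with x hxP hxΩ
      have h2 : ‖((y ^ (P - 1) * θ)⁻¹ • w) x‖ = θ⁻¹ * (y⁻¹ ^ (P - 1) * ‖w x‖) := by
        rw [Pi.smul_apply, norm_smul, Real.norm_of_nonneg (inv_nonneg.2 hl0.le),
          Real.inv_rpow hy0.le, mul_inv]
        ring
      rw [h2]
      refine (conj_mul_le _ x (inv_nonneg.2 hθ0.le) (inv_le_one_of_one_le₀ hθ1) _).trans ?_
      rw [ENNReal.ofReal_mul (inv_nonneg.2 hθ0.le), mul_assoc]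
      gcongr
      exact conj_powPhi_rpow_mul_le (hp x hxΩ) hxP (inv_pos.2 hy0) (inv_le_one_of_one_le₀ hy1) _
    refine h1.trans ?_
    rw [lintegral_const_mul' _ _ ENNReal.ofReal_ne_top]
    change _ * modular (conj (powPhi p)) Ω w ≤ 1
    rw [hρr, ← ENNReal.ofReal_mul (by positivity), ENNReal.ofReal_le_one]
    rw [mul_assoc, inv_mul_le_iff₀ hθ0, mul_one, mul_comm]
    exact le_max_right _ _
  have hL := key _ hl0 hmod
  rw [tsub_le_iff_right, hVv, hρr, ENNReal.ofReal_rpow_of_nonneg hv0 hP0,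
    ← ENNReal.ofReal_add hv0 (Real.rpow_nonneg hv0 _),
    ← ENNReal.ofReal_add (add_nonneg hv0 (Real.rpow_nonneg hv0 _)) hr0]
  refine ENNReal.ofReal_le_ofReal (hL.trans ?_)
  have hvP := Real.rpow_nonneg hv0 P
  -- For `v ≤ 1`, `l v = max(1, r) v ≤ v + r`; for `v ≥ 1`, `l v = max(v ^ P, r)`.
  rcases le_total v 1 with hv1 | hv1
  · have hy' : y = 1 := max_eq_left hv1
    simp only [hy', Real.one_rpow, inv_one, one_mul, mul_one] at hθ ⊢
    have : θ ≤ 1 + r := hθ ▸ max_le (by linarith) (by linarith)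
    nlinarith
  · have hy' : y = v := max_eq_right hv1
    rw [hy'] at hθ hyP ⊢
    have hv' : 0 < v := by linarith
    have hvP' : 0 < v ^ P := Real.rpow_pos_of_pos hv' _
    have h1 : v ^ (P - 1) * θ * v = v ^ P * θ := by
      rw [Real.rpow_sub hv', Real.rpow_one]
      field_simp
    have h2 : v ^ P * θ ≤ v ^ P + r := by
      rw [hθ, Real.inv_rpow hv'.le, mul_max_of_nonneg _ _ hvP'.le]
      refine max_le (by linarith) ?_
      rw [mul_left_comm, mul_inv_cancel₀ hvP'.ne']
      linarith
    linarith

/-! ### Log-Hölder exponents and the pointwise estimate of the gradient -/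

/-- `p` is a log-Hölder continuous exponent in the open set `Ω` with values in `[1, P]` and
log-Hölder constant `L`. -/
structure IsLogExponent (Ω : Set (Vec n)) (p : Vec n → ℝ) (P L : ℝ) : Prop where
  isOpen : IsOpen Ω
  aemeasurable : AEMeasurable p (volume.restrict Ω)
  one_le : ∀ x ∈ Ω, 1 ≤ p x
  le : ∀ x ∈ Ω, p x ≤ P
  pos : 0 < L
  logHolder : ∀ x ∈ Ω, ∀ y ∈ Ω, |p x - p y| ≤ L / Real.log (Real.exp 1 + 1 / ‖x - y‖)

namespace IsLogExponent

variable {Ω : Set (Vec n)} {p : Vec n → ℝ} {P L : ℝ}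

/-- The oscillation of a log-Hölder exponent in a ball of radius `ε` is compensated by powers
of `ε`. -/
theorem rpow_sub_le (hp : IsLogExponent Ω p P L) {x y : Vec n} (hx : x ∈ Ω) (hy : y ∈ Ω)
    {ε R T : ℝ} (hε : 0 < ε) (hε2 : ε ≤ 1 / 2) (hR : ε * R ≤ 1) (hxy : ‖x - y‖ ≤ ε)
    (hT1 : 1 ≤ T) (hT : T ≤ 1 + ε⁻¹ ^ n * R) :
    T ^ (p x - p y) ≤ Real.exp (L * (n + 2)) := by
  have hT0 : 0 < T := one_pos.trans_le hT1
  rcases eq_or_ne x y with rfl | hne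
  · rw [sub_self, Real.rpow_zero]
    exact Real.one_le_exp (mul_nonneg hp.pos.le (by positivity))
  have hnorm : 0 < ‖x - y‖ := norm_sub_pos_iff.2 hne
  set a := ε⁻¹ with ha
  have ha2 : 2 ≤ a := by
    rw [ha, le_inv_comm₀ two_pos hε]
    linarith
  have hRa : R ≤ a := by
    rw [ha, ← one_div, le_div_iff₀ hε]
    linarith
  -- With `T` at most a power of `a = 1 / ε`, `log T` is at most `n + 2` times `log (e + a)`, the
  -- very quantity that divides `L` in the oscillation of `p`.
  have hTa : T ≤ a ^ (n + 2) := by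
    have h1 : (1 : ℝ) ≤ a ^ (n + 1) := one_le_pow₀ (by linarith)
    calc T ≤ 1 + a ^ n * R := hT
      _ ≤ a ^ (n + 1) + a ^ n * a := by gcongr
      _ = 2 * a ^ (n + 1) := by ring
      _ ≤ a * a ^ (n + 1) := by gcongr
      _ = a ^ (n + 2) := by ring
  have hlogT : Real.log T ≤ (n + 2) * Real.log (Real.exp 1 + a) := by
    calc Real.log T ≤ Real.log (a ^ (n + 2)) := Real.log_le_log hT0 hTa
      _ = (n + 2) * Real.log a := by rw [Real.log_pow]; push_cast; ring
      _ ≤ _ := by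
        gcongr
        linarith [Real.exp_pos 1]
  have hD : 1 ≤ Real.log (Real.exp 1 + a) := by
    rw [Real.le_log_iff_exp_le (by positivity)]
    linarith
  have hq : |p x - p y| ≤ L / Real.log (Real.exp 1 + a) := by
    refine (hp.logHolder x hx y hy).trans ?_
    have hL := hp.pos.le
    gcongr
    rw [ha, ← one_div]
    gcongr
  rw [Real.rpow_def_of_pos hT0]
  refine Real.exp_le_exp.2 ?_
  calc Real.log T * (p x - p y) ≤ Real.log T * |p x - p y| := by
        gcongr
        · exact Real.log_nonneg hT1
        · exact le_abs_self _
    _ ≤ ((n + 2) * Real.log (Real.exp 1 + a)) * (L / Real.log (Real.exp 1 + a)) := by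
        gcongr
    _ = L * (n + 2) := by
        field_simp

end IsLogExponent

/-- For `s ≤ T` one has `s τ ≤ T τ`, while for `s ≥ T` the hypothesis gives `s τ ≤ s ^ p / p`, so
the supremum ignores such `s`. The argument covers `p = 1`, where `φ*` takes the value `∞`. -/
theorem conj_powPhi_le {p : Vec n → ℝ} {y : Vec n} (hp : 1 ≤ p y) {T τ : ℝ} (hT : 0 < T)
    (hτ : 0 ≤ τ) (h : τ * p y ≤ T ^ (p y - 1)) :
    conj (powPhi p) y τ ≤ ENNReal.ofReal (T * τ) := by
  refine iSup₂_le fun s hs => ?_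
  rcases le_total s T with hsT | hsT
  · exact tsub_le_self.trans (ENNReal.ofReal_le_ofReal (by gcongr))
  · have hs0 : 0 < s := hT.trans_le hsT
    refine le_of_eq_of_le (tsub_eq_zero_of_le (ENNReal.ofReal_le_ofReal ?_)) zero_le
    rw [le_div_iff₀ (one_pos.trans_le hp)]
    calc s * τ * p y = s * (τ * p y) := by ring
      _ ≤ s * T ^ (p y - 1) := by gcongr
      _ ≤ s * s ^ (p y - 1) := by gcongr
      _ = s ^ p y := by
        rw [Real.rpow_sub hs0, Real.rpow_one]
        field_simp

/-- The volume of the unit ball. -/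
noncomputable def unitBallVolume (n : ℕ) : ℝ := (volume (Metric.ball (0 : Vec n) 1)).toReal

theorem volume_ball_eq (x : Vec n) {ε : ℝ} (hε : 0 < ε) :
    volume (Metric.ball x ε) = ENNReal.ofReal (ε ^ n * unitBallVolume n) := by
  rw [Measure.addHaar_ball_of_pos _ x hε, ENNReal.ofReal_mul (by positivity), unitBallVolume,
    ENNReal.ofReal_toReal measure_ball_lt_top.ne]
  simp

theorem unitBallVolume_nonneg (n : ℕ) : 0 ≤ unitBallVolume n := ENNReal.toReal_nonneg

/-- The constant in the pointwise estimate of the gradient of a mollification. -/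
noncomputable def gradConst (n : ℕ) (P L c : ℝ) : ℝ :=
  (1 + unitBallVolume n * (P * Real.exp (L * (n + 2)))⁻¹) * c * (P * Real.exp (L * (n + 2)))

/-- A substitute for Jensen's inequality when `Du` is only a functional. The dual energy is tested
with the largest multiple `s w` for which `φ*(y, |s w|)` stays controlled in the whole ball;
dividing by `s` leaves a multiple of `T`. -/
theorem IsLogExponent.divPairing_le {Ω : Set (Vec n)} {p : Vec n → ℝ} {P L : ℝ}
    (hp : IsLogExponent Ω p P L) {u : Vec n → Vec m} {x : Vec n} (hx : x ∈ Ω) {ε R c : ℝ}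
    (hε : 0 < ε) (hε2 : ε ≤ 1 / 2) (hR0 : 0 ≤ R) (hR : ε * R ≤ 1)
    (hball : Metric.ball x ε ⊆ Ω) (hc : 0 < c)
    (hfin : dualEnergy (powPhi p) Ω u (Metric.ball x ε) ≤ ENNReal.ofReal R)
    {w : Vec n → Mat m n} (hw : IsTestField (Metric.ball x ε) w)
    (hwc : ∀ y, ‖w y‖ ≤ c * ε⁻¹ ^ n) :
    divPairing Ω u w ≤ gradConst n P L c *
      (1 + ε⁻¹ ^ n * (dualEnergy (powPhi p) Ω u (Metric.ball x ε)).toReal) ^ (p x)⁻¹ := by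
  have hP : 1 ≤ P := (hp.one_le x hx).trans (hp.le x hx)
  have hω := unitBallVolume_nonneg n
  have hE := Real.exp_pos (L * (n + 2))
  have hpx := hp.one_le x hx
  set r := (dualEnergy (powPhi p) Ω u (Metric.ball x ε)).toReal with hr
  have hr0 : 0 ≤ r := ENNReal.toReal_nonneg
  have hrE : dualEnergy (powPhi p) Ω u (Metric.ball x ε) = ENNReal.ofReal r :=
    (ENNReal.ofReal_toReal (ne_top_of_le_ne_top ENNReal.ofReal_ne_top hfin)).symm
  set h := ε⁻¹ ^ n with hh
  have hh0 : 0 < h := by positivity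
  have hhr : 0 ≤ h * r := by positivity
  -- `T` is the expected size of the mollified gradient: `T ^ p x` is 1 plus the dual energy of the
  -- ball divided by `ε ^ n`.
  set T := (1 + h * r) ^ (p x)⁻¹ with hT
  have hT1 : 1 ≤ T := Real.one_le_rpow (by linarith) (by positivity)
  have hT0 : 0 < T := one_pos.trans_le hT1
  have hTp : T ^ p x = 1 + h * r := by
    rw [hT, ← Real.rpow_mul (by linarith), inv_mul_cancel₀ (by linarith), Real.rpow_one]
  have hTle : T ≤ 1 + h * R := by
    calc T ≤ (1 + h * r) ^ (1 : ℝ) :=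
          Real.rpow_le_rpow_of_exponent_le (by linarith) (inv_le_one_of_one_le₀ hpx)
      _ = 1 + h * r := Real.rpow_one _
      _ ≤ 1 + h * R := by
          rw [hrE, ENNReal.ofReal_le_ofReal_iff hR0] at hfin
          gcongr
  -- `δ` absorbs both the factor `p y` and the oscillation `T ^ (p x - p y)`, so that
  -- `conj_powPhi_le` applies at every `y` of the ball with the same `τ`.
  set δ := (P * Real.exp (L * (n + 2)))⁻¹ with hδ
  have hδ0 : 0 < δ := by positivity
  set τ := δ * T ^ (p x - 1) with hτ
  have hTx1 : 0 < T ^ (p x - 1) := Real.rpow_pos_of_pos hT0 _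
  have hτ0 : 0 < τ := mul_pos hδ0 hTx1
  have hTτ : T * τ = δ * T ^ p x := by
    rw [hτ, Real.rpow_sub hT0, Real.rpow_one]
    field_simp
  have hconj : ∀ y ∈ Metric.ball x ε, conj (powPhi p) y τ ≤ ENNReal.ofReal (T * τ) := by
    intro y hy
    refine conj_powPhi_le (hp.one_le y (hball hy)) hT0 hτ0.le ?_
    have hosc := hp.rpow_sub_le hx (hball hy) hε hε2 hR
      (by rw [← dist_eq_norm, dist_comm]; exact (Metric.mem_ball.1 hy).le) hT1 hTle
    have hsplit : T ^ (p x - 1) = T ^ (p x - p y) * T ^ (p y - 1) := by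
      rw [← Real.rpow_add hT0]
      congr 1
      ring
    have hTy : 0 < T ^ (p y - 1) := Real.rpow_pos_of_pos hT0 _
    have hpy0 : 0 ≤ p y := zero_le_one.trans (hp.one_le y (hball hy))
    calc τ * p y = δ * (T ^ (p x - p y) * p y) * T ^ (p y - 1) := by rw [hτ, hsplit]; ring
      _ ≤ δ * (Real.exp (L * (n + 2)) * P) * T ^ (p y - 1) := by
          gcongr
          exact hp.le y (hball hy)
      _ = T ^ (p y - 1) := by
          rw [hδ, mul_comm P]
          field_simp
  -- Since `‖w‖ ≤ c h`, this gives `‖s w‖ ≤ τ`.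
  set s := τ / (c * h) with hs
  have hs0 : 0 < s := by positivity
  have hmod : modular (conj (powPhi p)) Ω (s • w) ≤
      ENNReal.ofReal (T * τ * (ε ^ n * unitBallVolume n)) := by
    calc modular (conj (powPhi p)) Ω (s • w)
        ≤ ∫⁻ y in Ω, (Metric.ball x ε).indicator (fun _ => ENNReal.ofReal (T * τ)) y := by
          refine lintegral_mono fun y => ?_
          by_cases hy : y ∈ Metric.ball x ε
          · rw [Set.indicator_of_mem hy]
            refine le_trans (conj_mono _ _ ?_) (hconj y hy)
            rw [Pi.smul_apply, norm_smul, Real.norm_of_nonneg hs0.le]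
            calc s * ‖w y‖ ≤ s * (c * h) := by gcongr; exact hwc y
              _ = τ := by rw [hs]; field_simp
          · simp [Set.indicator_of_notMem hy, hw.eq_zero hy, conj_zero]
      _ ≤ ∫⁻ y, (Metric.ball x ε).indicator (fun _ => ENNReal.ofReal (T * τ)) y :=
          setLIntegral_le_lintegral _ _
      _ = ENNReal.ofReal (T * τ * (ε ^ n * unitBallVolume n)) := by
          rw [lintegral_indicator Metric.isOpen_ball.measurableSet, setLIntegral_const,
            volume_ball_eq x hε, ← ENNReal.ofReal_mul (by positivity)]
  have hmain : s * divPairing Ω u w ≤ r + T * τ * (ε ^ n * unitBallVolume n) := by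
    have h1 := tsub_le_iff_right.1
      (le_dualEnergy (φ := powPhi p) (Ω := Ω) (u := u) (hw.const_smul s))
    rw [divPairing_const_smul u hw, hrE] at h1
    have h2 := h1.trans (add_le_add le_rfl hmod)
    rw [← ENNReal.ofReal_add hr0 (by positivity)] at h2
    exact (ENNReal.ofReal_le_ofReal_iff (by positivity)).1 h2
  have hεh : ε ^ n * h = 1 := by
    rw [hh, ← mul_pow, mul_inv_cancel₀ hε.ne', one_pow]
  have hr' : r ≤ ε ^ n * T ^ p x := by
    rw [hTp, mul_add, ← mul_assoc, hεh]
    have : 0 < ε ^ n := by positivity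
    linarith
  have h3 : s * divPairing Ω u w ≤ ε ^ n * T ^ p x * (1 + unitBallVolume n * δ) := by
    refine hmain.trans ?_
    rw [hTτ]
    linarith
  have h4 : T ^ p x = T * T ^ (p x - 1) := by
    rw [Real.rpow_sub hT0, Real.rpow_one]
    field_simp
  have h5 : ε ^ n * T ^ p x * (1 + unitBallVolume n * δ)
      = s * ((1 + unitBallVolume n * δ) * c * δ⁻¹ * T) := by
    rw [h4, hs, hτ]
    rw [eq_inv_of_mul_eq_one_left hεh]
    field_simp
  rw [h5] at h3
  have h6 := le_of_mul_le_mul_left h3 hs0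
  rwa [gradConst, ← hδ, ← inv_inv (P * Real.exp (L * (n + 2))), ← hδ]

/-! ### Mollification with a variable radius -/

/-- `e` is an admissible mollification radius in `A`: a nonnegative `C¹` function with small
gradient which is positive precisely in `A`. -/
structure IsScale (A : Set (Vec n)) (e : Vec n → ℝ) : Prop where
  contDiff : ContDiff ℝ 1 e
  nonneg : ∀ x, 0 ≤ e x
  pos_iff : ∀ x, 0 < e x ↔ x ∈ A
  fderiv_le : ∀ x, ‖fderiv ℝ e x‖ ≤ 1 / 2

namespace IsScale

variable {A : Set (Vec n)} {e : Vec n → ℝ}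

theorem abs_sub_le (he : IsScale A e) (x y : Vec n) : |e x - e y| ≤ 1 / 2 * dist x y := by
  have := Convex.norm_image_sub_le_of_norm_fderiv_le (𝕜 := ℝ) (f := e) (s := Set.univ)
    (fun x _ => he.contDiff.differentiable one_ne_zero x) (fun x _ => he.fderiv_le x) convex_univ
    (Set.mem_univ y) (Set.mem_univ x)
  rwa [← dist_eq_norm x y, Real.norm_eq_abs] at this

theorem le_two_mul (he : IsScale A e) {x y : Vec n} (h : dist x y < e x) : e x ≤ 2 * e y := by
  have := (abs_le.1 (he.abs_sub_le x y)).2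
  linarith

theorem le_three_halves_mul (he : IsScale A e) {x y : Vec n} (h : dist x y < e x) :
    e y ≤ 3 / 2 * e x := by
  have := (abs_le.1 (he.abs_sub_le x y)).1
  linarith

theorem ball_subset (he : IsScale A e) (x : Vec n) : Metric.ball x (e x) ⊆ A := by
  intro y hy
  have hy' : dist x y < e x := Metric.mem_ball'.1 hy
  have := he.le_two_mul hy'
  have hx : 0 < e x := dist_nonneg.trans_lt hy'
  exact (he.pos_iff y).1 (by linarith)

/-- After exchanging the integrals, a fixed `y` is seen only from points `x` of `B(y, 2 e y)`, where
`(e x)⁻¹ ≤ 3 / 2 (e y)⁻¹`. The constant is `(3 / 2) ^ n 2 ^ n = 3 ^ n` times the volume of the unit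
ball. -/
theorem lintegral_measure_ball_le (he : IsScale A e) (hA : MeasurableSet A) (ν : Measure (Vec n))
    [SFinite ν] :
    ∫⁻ x in A, ENNReal.ofReal ((e x)⁻¹ ^ n) * ν (Metric.ball x (e x)) ≤
      ENNReal.ofReal (3 ^ n * unitBallVolume n) * ν A := by
  have hec : Continuous e := he.contDiff.continuous
  let S : Set (Vec n × Vec n) := {q | dist q.2 q.1 < e q.1}
  have hS : MeasurableSet S :=
    (isOpen_lt (continuous_snd.dist continuous_fst) (hec.comp continuous_fst)).measurableSet
  let f : Vec n → Vec n → ℝ≥0∞ := fun x y =>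
    S.indicator (fun q => ENNReal.ofReal ((e q.1)⁻¹ ^ n)) (x, y)
  have hf : Measurable (Function.uncurry f) := by
    refine Measurable.indicator ?_ hS
    exact (((hec.measurable.comp measurable_fst).inv).pow_const n).ennreal_ofReal
  have h1 : ∀ x, ENNReal.ofReal ((e x)⁻¹ ^ n) * ν (Metric.ball x (e x)) = ∫⁻ y, f x y ∂ν := by
    intro x
    rw [← lintegral_indicator_const Metric.isOpen_ball.measurableSet]
    rfl
  calc ∫⁻ x in A, ENNReal.ofReal ((e x)⁻¹ ^ n) * ν (Metric.ball x (e x))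
      ≤ ∫⁻ x, (∫⁻ y, f x y ∂ν) := by
        simp only [h1]
        exact setLIntegral_le_lintegral _ _
    _ = ∫⁻ y, (∫⁻ x, f x y) ∂ν := lintegral_lintegral_swap hf.aemeasurable
    _ ≤ ∫⁻ y, A.indicator (fun _ => ENNReal.ofReal (3 ^ n * unitBallVolume n)) y ∂ν := by
        refine lintegral_mono fun y => ?_
        by_cases hy : y ∈ A
        · have hey : 0 < e y := (he.pos_iff y).2 hy
          rw [Set.indicator_of_mem hy]
          calc ∫⁻ x, f x y ≤ ∫⁻ x, (Metric.ball y (2 * e y)).indicator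
                (fun _ => ENNReal.ofReal ((3 / 2 * (e y)⁻¹) ^ n)) x := by
                refine lintegral_mono fun x => ?_
                by_cases hxy : dist y x < e x
                · have hx : 0 < e x := dist_nonneg.trans_lt hxy
                  rw [dist_comm] at hxy
                  have hmem : x ∈ Metric.ball y (2 * e y) :=
                    Metric.mem_ball.2 (hxy.trans_le (he.le_two_mul hxy))
                  have hSm : (x, y) ∈ S := by simpa [S, dist_comm] using hxy
                  simp only [f, Set.indicator_of_mem hSm, Set.indicator_of_mem hmem]
                  refine ENNReal.ofReal_le_ofReal (pow_le_pow_left₀ (inv_nonneg.2 hx.le) ?_ n)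
                  rw [inv_le_iff_one_le_mul₀ hx, mul_assoc, ← div_eq_inv_mul, mul_div_assoc',
                    le_div_iff₀ hey]
                  linarith [he.le_three_halves_mul hxy]
                · have hSm : (x, y) ∉ S := hxy
                  simp [f, Set.indicator_of_notMem hSm]
            _ = ENNReal.ofReal (3 ^ n * unitBallVolume n) := by
                rw [lintegral_indicator_const Metric.isOpen_ball.measurableSet,
                  volume_ball_eq y (by positivity), ← ENNReal.ofReal_mul (by positivity),
                  ← mul_assoc, ← mul_pow]
                congr 3
                field_simp
        · rw [Set.indicator_of_notMem hy]
          refine le_of_eq (lintegral_eq_zero_of_ae_eq_zero (ae_of_all _ fun x => ?_))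
          have hSm : (x, y) ∉ S := fun h => hy (he.ball_subset x h)
          simp [f, Set.indicator_of_notMem hSm]
    _ = ENNReal.ofReal (3 ^ n * unitBallVolume n) * ν A := lintegral_indicator_const hA _

end IsScale

/-! ### The mollification kernel and its gradient field -/

/-- A smooth mollifier supported in the ball of radius `1/2`. -/
noncomputable def bump (n : ℕ) : Vec n → ℝ :=
  ContDiffBump.normed (⟨1 / 4, 1 / 2, by norm_num, by norm_num⟩ : ContDiffBump (0 : Vec n)) volume

theorem contDiff_bump : ContDiff ℝ ∞ (bump n) := ContDiffBump.contDiff_normed _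

theorem bump_nonneg (z : Vec n) : 0 ≤ bump n z := ContDiffBump.nonneg_normed _ _

theorem integral_bump : ∫ z, bump n z = 1 := ContDiffBump.integral_normed _

theorem tsupport_bump : tsupport (bump n) = Metric.closedBall 0 (1 / 2) :=
  ContDiffBump.tsupport_normed_eq _

theorem hasCompactSupport_bump : HasCompactSupport (bump n) :=
  ContDiffBump.hasCompactSupport_normed _

theorem bump_eq_zero {z : Vec n} (h : 1 / 2 < ‖z‖) : bump n z = 0 := by
  refine image_eq_zero_of_notMem_tsupport fun h' => ?_
  rw [tsupport_bump, mem_closedBall_zero_iff] at h'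
  linarith

theorem fderiv_bump_eq_zero {z : Vec n} (h : 1 / 2 < ‖z‖) : fderiv ℝ (bump n) z = 0 := by
  by_contra h0
  have h' := support_fderiv_subset ℝ h0
  rw [tsupport_bump, mem_closedBall_zero_iff] at h'
  linarith

theorem exists_bump_le (n : ℕ) :
    ∃ C : ℝ, 1 ≤ C ∧ (∀ z, bump n z ≤ C) ∧ ∀ z, ‖fderiv ℝ (bump n) z‖ ≤ C := by
  obtain ⟨C, hC⟩ := hasCompactSupport_bump.exists_bound_of_continuous
    (contDiff_bump (n := n)).continuous
  obtain ⟨C', hC'⟩ := (hasCompactSupport_bump.fderiv ℝ).exists_bound_of_continuous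
    ((contDiff_bump (n := n)).continuous_fderiv (by simp))
  refine ⟨max 1 (max C C'), le_max_left _ _, fun z => ?_, fun z => ?_⟩
  · exact (le_abs_self _).trans ((hC z).trans ((le_max_left _ _).trans (le_max_right _ _)))
  · exact (hC' z).trans ((le_max_right _ _).trans (le_max_right _ _))

/-- A bound for the mollifier and its gradient. -/
noncomputable def bumpBound (n : ℕ) : ℝ := (exists_bump_le n).choose

theorem one_le_bumpBound : 1 ≤ bumpBound n := (exists_bump_le n).choose_spec.1

theorem bump_le (z : Vec n) : bump n z ≤ bumpBound n := (exists_bump_le n).choose_spec.2.1 z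

theorem norm_fderiv_bump_le (z : Vec n) : ‖fderiv ℝ (bump n) z‖ ≤ bumpBound n :=
  (exists_bump_le n).choose_spec.2.2 z

/-- The mollification kernel with radius `e x` at the point `x`. -/
noncomputable def kernel (e : Vec n → ℝ) (x y : Vec n) : ℝ :=
  (e x)⁻¹ ^ n * bump n ((e x)⁻¹ • (x - y))

/-- The derivative of the mollification kernel with respect to `x`. -/
noncomputable def kernelDeriv (e : Vec n → ℝ) (x y : Vec n) : Vec n →L[ℝ] ℝ :=
  (e x)⁻¹ ^ (n + 1) • (fderiv ℝ (bump n) ((e x)⁻¹ • (x - y)) -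
    (fderiv ℝ (bump n) ((e x)⁻¹ • (x - y)) ((e x)⁻¹ • (x - y))
      + n * bump n ((e x)⁻¹ • (x - y))) • fderiv ℝ e x)

theorem hasFDerivAt_bump (z : Vec n) : HasFDerivAt (bump n) (fderiv ℝ (bump n) z) z :=
  (contDiff_bump.differentiable (by simp) z).hasFDerivAt

theorem hasFDerivAt_kernel {e : Vec n → ℝ} {x : Vec n} (he : DifferentiableAt ℝ e x)
    (hx : e x ≠ 0) (y : Vec n) :
    HasFDerivAt (fun x => kernel e x y) (kernelDeriv e x y) x := by
  have h1 : HasFDerivAt (fun x => (e x)⁻¹) ((-(e x ^ 2)⁻¹) • fderiv ℝ e x) x :=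
    (hasDerivAt_inv hx).comp_hasFDerivAt x he.hasFDerivAt
  have h2 : HasFDerivAt (fun x => (e x)⁻¹ • (x - y)) _ x :=
    h1.smul ((hasFDerivAt_id x).sub_const y)
  have h3 := (h1.pow n).mul ((hasFDerivAt_bump ((e x)⁻¹ • (x - y))).comp x h2)
  refine h3.congr_fderiv ?_
  ext v
  -- The power rule produces the exponent `n - 1`, so `n = 0` is treated apart; there every vector
  -- is zero.
  rcases n with _ | k
  · simp [Subsingleton.elim v 0]
  · simp [kernelDeriv]
    field_simp
    ring

theorem kernel_nonneg {e : Vec n → ℝ} {x : Vec n} (hx : 0 ≤ e x) (y : Vec n) :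
    0 ≤ kernel e x y :=
  mul_nonneg (pow_nonneg (inv_nonneg.2 hx) _) (bump_nonneg _)

theorem kernel_le {e : Vec n → ℝ} {x : Vec n} (hx : 0 ≤ e x) (y : Vec n) :
    kernel e x y ≤ bumpBound n * (e x)⁻¹ ^ n := by
  rw [kernel, mul_comm]
  exact mul_le_mul_of_nonneg_right (bump_le _) (pow_nonneg (inv_nonneg.2 hx) _)

theorem half_lt_norm_of_half_lt_dist {a : ℝ} (ha : 0 < a) {x y : Vec n} (h : a / 2 < dist x y) :
    1 / 2 < ‖a⁻¹ • (x - y)‖ := by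
  rw [norm_smul, norm_inv, Real.norm_of_nonneg ha.le, ← dist_eq_norm, ← div_eq_inv_mul,
    lt_div_iff₀ ha]
  linarith

theorem kernel_eq_zero {e : Vec n → ℝ} {x y : Vec n} (hx : 0 < e x) (h : e x / 2 < dist x y) :
    kernel e x y = 0 := by
  rw [kernel, bump_eq_zero (half_lt_norm_of_half_lt_dist hx h), mul_zero]

theorem integral_kernel {e : Vec n → ℝ} {x : Vec n} (hx : 0 < e x) : ∫ y, kernel e x y = 1 := by
  simp only [kernel]
  rw [integral_const_mul, integral_sub_left_eq_self (fun y => bump n ((e x)⁻¹ • y)) volume x,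
    Measure.integral_comp_smul, integral_bump]
  simp [abs_of_pos hx, hx.ne']

/-- A crude bound with the extra factor `(e x)⁻¹`, serving to dominate the derivative under the
integral sign. -/
theorem norm_kernelDeriv_le {A : Set (Vec n)} {e : Vec n → ℝ} (he : IsScale A e) {x : Vec n}
    (hx : 0 < e x) (y : Vec n) :
    ‖kernelDeriv e x y‖ ≤ (e x)⁻¹ ^ (n + 1) * (bumpBound n * (2 + n)) := by
  have hB := one_le_bumpBound (n := n)
  rw [kernelDeriv, norm_smul, Real.norm_of_nonneg (by positivity)]
  gcongr
  set z := (e x)⁻¹ • (x - y)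
  have h1 : ‖fderiv ℝ (bump n) z z‖ ≤ bumpBound n := by
    rcases le_or_gt ‖z‖ (1 / 2) with hz | hz
    · refine (ContinuousLinearMap.le_opNorm _ _).trans ?_
      nlinarith [norm_fderiv_bump_le z, norm_nonneg z, norm_nonneg (fderiv ℝ (bump n) z)]
    · simp only [fderiv_bump_eq_zero hz, FunLike.coe_zero, Pi.zero_apply, norm_zero]
      linarith
  have h2 : ‖(n : ℝ) * bump n z‖ ≤ n * bumpBound n := by
    rw [norm_mul, Real.norm_of_nonneg (bump_nonneg z), Real.norm_of_nonneg (Nat.cast_nonneg n)]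
    gcongr
    exact bump_le z
  have h3 : ‖fderiv ℝ (bump n) z z + n * bump n z‖ ≤ bumpBound n + n * bumpBound n :=
    (norm_add_le _ _).trans (add_le_add h1 h2)
  refine (norm_sub_le _ _).trans ?_
  rw [norm_smul]
  have h4 := norm_fderiv_bump_le z
  have h5 := he.fderiv_le x
  have h6 := norm_nonneg (fderiv ℝ e x)
  have h7 := norm_nonneg (fderiv ℝ (bump n) z z + n * bump n z)
  have h8 : (0:ℝ) ≤ n * bumpBound n := by positivity
  nlinarith

/-- The embedding of vectors as the `α`-th row of a matrix. -/
noncomputable def rowEmbed (n : ℕ) {m : ℕ} (α : Fin m) : Vec n →L[ℝ] Mat m n :=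
  LinearMap.toContinuousLinearMap
    { toFun := fun v => WithLp.toLp 2 fun q => if q.1 = α then v q.2 else 0
      map_add' := fun v w => by ext q; by_cases h : q.1 = α <;> simp [h]
      map_smul' := fun c v => by ext q; by_cases h : q.1 = α <;> simp [h] }

theorem rowEmbed_apply (α β : Fin m) (v : Vec n) (i : Fin n) :
    rowEmbed n α v (β, i) = if β = α then v i else 0 := rfl

theorem norm_rowEmbed (α : Fin m) (v : Vec n) : ‖rowEmbed n α v‖ = ‖v‖ := by
  rw [EuclideanSpace.norm_eq, EuclideanSpace.norm_eq, Fintype.sum_prod_type]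
  congr 1
  rw [Finset.sum_eq_single α]
  · simp [rowEmbed_apply]
  · intro β _ hβ
    simp [rowEmbed_apply, hβ]
  · simp

theorem rowDiv_rowEmbed {W : Vec n → Vec n} {y : Vec n} (hW : DifferentiableAt ℝ W y)
    (α β : Fin m) : rowDiv (fun y => rowEmbed n α (W y)) β y =
      if β = α then ∑ j, fderiv ℝ W y (EuclideanSpace.single j 1) j else 0 := by
  have h : fderiv ℝ (fun y => rowEmbed n α (W y)) y = (rowEmbed n α).comp (fderiv ℝ W y) :=
    ((rowEmbed n α).hasFDerivAt.comp y hW.hasFDerivAt).fderiv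
  simp only [rowDiv, h, ContinuousLinearMap.comp_apply, rowEmbed_apply]
  split_ifs <;> simp

theorem sum_apply_single_mul (l : Vec n →L[ℝ] ℝ) (v : Vec n) :
    ∑ j, l (EuclideanSpace.single j 1) * v j = l v := by
  conv_rhs => rw [← (EuclideanSpace.basisFun (Fin n) ℝ).sum_repr v]
  simp [map_sum, mul_comm]

/-- The vector field whose divergence is the derivative of the kernel in the direction `v`. -/
noncomputable def kernelField (e : Vec n → ℝ) (x v y : Vec n) : Vec n :=
  kernel e x y • (fderiv ℝ e x v • ((e x)⁻¹ • (x - y)) - v)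

theorem contDiff_kernelField (e : Vec n → ℝ) (x v : Vec n) :
    ContDiff ℝ 1 (kernelField e x v) := by
  have h1 : ContDiff ℝ 1 (fun y => (e x)⁻¹ • (x - y)) := by fun_prop
  have h2 : ContDiff ℝ 1 (fun y => bump n ((e x)⁻¹ • (x - y))) :=
    (contDiff_bump.of_le (by exact_mod_cast le_top)).comp h1
  unfold kernelField kernel
  exact (contDiff_const.mul h2).smul ((h1.const_smul (fderiv ℝ e x v)).sub contDiff_const)

/-- Put `z = (x - y) / e x` and `a = De(x) v`. Since `div_y z = -n / e x`, the divergence of `ρ(z)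
(a z - v)` is `(∇ρ(z) · v - a (∇ρ(z) · z + n ρ(z))) / e x`. Thus the terms caused by the varying
radius are themselves part of a divergence, and only `Du`, not `u`, enters the gradient of the
mollification. -/
theorem sum_fderiv_kernelField {e : Vec n → ℝ} {x : Vec n} (hx : e x ≠ 0) (v y : Vec n) :
    ∑ j, fderiv ℝ (kernelField e x v) y (EuclideanSpace.single j 1) j = kernelDeriv e x y v := by
  set z := (e x)⁻¹ • (x - y) with hz
  have h1 : HasFDerivAt (fun y => (e x)⁻¹ • (x - y))
      ((e x)⁻¹ • -ContinuousLinearMap.id ℝ (Vec n)) y :=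
    ((hasFDerivAt_id (𝕜 := ℝ) y).const_sub x).const_smul (e x)⁻¹
  have h2 := ((hasFDerivAt_bump z).comp y h1).const_mul ((e x)⁻¹ ^ n)
  have h3 := h2.smul ((h1.const_smul (fderiv ℝ e x v)).sub_const v)
  have h4 : fderiv ℝ (kernelField e x v) y = _ := h3.fderiv
  rw [h4]
  have h5 := sum_apply_single_mul (fderiv ℝ (bump n) z) (fderiv ℝ e x v • z - v)
  simp only [map_sub, map_smul, smul_eq_mul] at h5
  simp only [kernelDeriv, ← hz]
  simp only [PiLp.sub_apply, PiLp.smul_apply, smul_eq_mul] at h5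
  simp [← hz, Finset.sum_add_distrib]
  have h6 : ∀ j : Fin n, (e x ^ n)⁻¹ * ((e x)⁻¹ * fderiv ℝ (bump n) z (EuclideanSpace.single j 1)) *
      (fderiv ℝ e x v * z j - v j) = (e x ^ n)⁻¹ * (e x)⁻¹ *
        (fderiv ℝ (bump n) z (EuclideanSpace.single j 1) * (fderiv ℝ e x v * z j - v j)) :=
    fun j => by ring
  rw [Finset.sum_congr rfl fun j _ => h6 j, ← Finset.mul_sum, h5]
  field_simp
  ring

/-- In contrast with the derivative of the kernel, there is no further factor `(e x)⁻¹`; this is the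
size required by `divPairing_le`. It uses `|De| ≤ 1 / 2` and that the kernel vanishes for `|z| > 1 /
2`. -/
theorem norm_kernelField_le {A : Set (Vec n)} {e : Vec n → ℝ} (he : IsScale A e) {x : Vec n}
    (hx : 0 < e x) {v : Vec n} (hv : ‖v‖ ≤ 1) (y : Vec n) :
    ‖kernelField e x v y‖ ≤ 2 * bumpBound n * (e x)⁻¹ ^ n := by
  have hB := one_le_bumpBound (n := n)
  rcases lt_or_ge (e x / 2) (dist x y) with h | h
  · rw [kernelField, kernel_eq_zero hx h, zero_smul, norm_zero]
    positivity
  · have hz : ‖(e x)⁻¹ • (x - y)‖ ≤ 1 / 2 := by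
      rw [norm_smul, norm_inv, Real.norm_of_nonneg hx.le, ← dist_eq_norm, inv_mul_le_iff₀ hx]
      linarith
    have h1 : ‖fderiv ℝ e x v‖ ≤ 1 / 2 := by
      refine (ContinuousLinearMap.le_opNorm _ _).trans ?_
      nlinarith [he.fderiv_le x, norm_nonneg v, norm_nonneg (fderiv ℝ e x)]
    have h2 : ‖fderiv ℝ e x v • ((e x)⁻¹ • (x - y)) - v‖ ≤ 2 := by
      refine (norm_sub_le _ _).trans ?_
      rw [norm_smul]
      nlinarith [norm_nonneg ((e x)⁻¹ • (x - y)), norm_nonneg (fderiv ℝ e x v)]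
    rw [kernelField, norm_smul, Real.norm_of_nonneg (kernel_nonneg hx.le y)]
    calc kernel e x y * ‖fderiv ℝ e x v • ((e x)⁻¹ • (x - y)) - v‖
        ≤ bumpBound n * (e x)⁻¹ ^ n * 2 := by
          gcongr
          · exact kernel_le hx.le y
      _ = _ := by ring

theorem isTestField_kernelField {e : Vec n → ℝ} {x : Vec n} (hx : 0 < e x) (v : Vec n)
    (α : Fin m) :
    IsTestField (Metric.ball x (e x)) (fun y => rowEmbed n α (kernelField e x v y)) := by
  have hsub : tsupport (fun y => rowEmbed n α (kernelField e x v y)) ⊆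
      Metric.closedBall x (e x / 2) := by
    refine closure_minimal (fun y hy => ?_) Metric.isClosed_closedBall
    rw [Metric.mem_closedBall, dist_comm]
    by_contra! h
    refine hy ?_
    simp [kernelField, kernel_eq_zero hx h]
  refine ⟨(rowEmbed n α).contDiff.comp (contDiff_kernelField e x v), ?_, ?_⟩
  · exact (isCompact_closedBall x (e x / 2)).of_isClosed_subset (isClosed_tsupport _) hsub
  · exact hsub.trans (Metric.closedBall_subset_ball (by linarith))

/-! ### Mollified functions and their gradients -/

/-- The mollification of `u` with radius `e x` at the point `x`. -/
noncomputable def mollify (Ω : Set (Vec n)) (e : Vec n → ℝ) (u : Vec n → Vec m) (x : Vec n) :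
    Vec m :=
  ∫ y in Ω, kernel e x y • u y

theorem continuous_kernel (e : Vec n → ℝ) (x : Vec n) : Continuous (kernel e x) := by
  have := (contDiff_bump (n := n)).continuous
  unfold kernel
  fun_prop

theorem continuous_kernelDeriv (e : Vec n → ℝ) (x : Vec n) : Continuous (kernelDeriv e x) := by
  have h1 := (contDiff_bump (n := n)).continuous
  have h2 := (contDiff_bump (n := n)).continuous_fderiv (by simp)
  unfold kernelDeriv
  fun_prop

theorem integrableOn_kernel_smul {Ω : Set (Vec n)} {e : Vec n → ℝ} {u : Vec n → Vec m}
    (hu : IntegrableOn u Ω) {x : Vec n} (hx : 0 ≤ e x) :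
    IntegrableOn (fun y => kernel e x y • u y) Ω :=
  Integrable.bdd_smul hu (bumpBound n * (e x)⁻¹ ^ n)
    (continuous_kernel e x).aestronglyMeasurable (ae_of_all _ fun y => by
      rw [Real.norm_of_nonneg (kernel_nonneg hx y)]
      exact kernel_le hx y)

theorem aestronglyMeasurable_smulRight (e : Vec n → ℝ) {Ω : Set (Vec n)} {u : Vec n → Vec m}
    (hu : IntegrableOn u Ω) (x : Vec n) :
    AEStronglyMeasurable (fun y => (kernelDeriv e x y).smulRight (u y)) (volume.restrict Ω) :=
  (ContinuousLinearMap.smulRightL ℝ (Vec n) (Vec m)).aestronglyMeasurable_comp₂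
    (continuous_kernelDeriv e x).aestronglyMeasurable hu.aestronglyMeasurable

theorem norm_smulRight_kernelDeriv_le {A : Set (Vec n)} {e : Vec n → ℝ} (he : IsScale A e)
    {x : Vec n} (hx : 0 < e x) (u : Vec n → Vec m) (y : Vec n) :
    ‖(kernelDeriv e x y).smulRight (u y)‖ ≤
      (e x)⁻¹ ^ (n + 1) * (bumpBound n * (2 + n)) * ‖u y‖ := by
  rw [ContinuousLinearMap.norm_smulRight_apply]
  exact mul_le_mul_of_nonneg_right (norm_kernelDeriv_le he hx y) (norm_nonneg _)

theorem integrableOn_smulRight_kernelDeriv {A Ω : Set (Vec n)} {e : Vec n → ℝ}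
    (he : IsScale A e) {u : Vec n → Vec m} (hu : IntegrableOn u Ω) {x : Vec n} (hx : 0 < e x) :
    IntegrableOn (fun y => (kernelDeriv e x y).smulRight (u y)) Ω :=
  (hu.norm.const_mul _).mono' (aestronglyMeasurable_smulRight e hu x)
    (ae_of_all _ (norm_smulRight_kernelDeriv_le he hx u))

theorem hasFDerivAt_mollify {A Ω : Set (Vec n)} {e : Vec n → ℝ} (he : IsScale A e)
    {u : Vec n → Vec m} (hu : IntegrableOn u Ω) {x : Vec n} (hx : x ∈ A) :
    HasFDerivAt (mollify Ω e u) (∫ y in Ω, (kernelDeriv e x y).smulRight (u y)) x := by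
  have hex : 0 < e x := (he.pos_iff x).2 hx
  -- On this neighbourhood the radius is bounded below, so one integrable function dominates all the
  -- derivatives.
  let s : Set (Vec n) := {x' | e x / 2 < e x'}
  have hs : s ∈ 𝓝 x :=
    (isOpen_lt continuous_const he.contDiff.continuous).mem_nhds (by simp; linarith)
  have hpos : ∀ x' ∈ s, 0 < e x' := fun x' h => by
    have : e x / 2 < e x' := h
    linarith
  have hB := one_le_bumpBound (n := n)
  have h1 : ∀ᶠ x' in 𝓝 x, AEStronglyMeasurable (fun y => kernel e x' y • u y)
      (volume.restrict Ω) := by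
    filter_upwards [hs] with x' hx'
    exact (integrableOn_kernel_smul hu (hpos x' hx').le).aestronglyMeasurable
  have h2 : ∀ᵐ y ∂volume.restrict Ω, ∀ x' ∈ s, ‖(kernelDeriv e x' y).smulRight (u y)‖ ≤
      (e x / 2)⁻¹ ^ (n + 1) * (bumpBound n * (2 + n)) * ‖u y‖ := by
    refine ae_of_all _ fun y x' hx' => ?_
    refine (norm_smulRight_kernelDeriv_le he (hpos x' hx') u y).trans ?_
    have h3 : (e x')⁻¹ ≤ (e x / 2)⁻¹ := inv_anti₀ (by linarith) (le_of_lt hx')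
    have h4 := inv_nonneg.2 (hpos x' hx').le
    gcongr
  have h3 : ∀ᵐ y ∂volume.restrict Ω, ∀ x' ∈ s, HasFDerivAt (fun x' => kernel e x' y • u y)
      ((kernelDeriv e x' y).smulRight (u y)) x' :=
    ae_of_all _ fun y x' hx' =>
      (hasFDerivAt_kernel (he.contDiff.differentiable one_ne_zero x') (hpos x' hx').ne'
        y).smul_const (u y)
  exact hasFDerivAt_integral_of_dominated_of_fderiv_le hs h1 (integrableOn_kernel_smul hu hex.le)
    (aestronglyMeasurable_smulRight e hu x) h2 (hu.norm.const_mul _) h3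

/-- The gradient of the mollification. -/
noncomputable def mollifyGrad (Ω : Set (Vec n)) (e : Vec n → ℝ) (u : Vec n → Vec m) (x : Vec n) :
    Mat m n :=
  WithLp.toLp 2 fun q => fderiv ℝ (mollify Ω e u) x (EuclideanSpace.single q.2 1) q.1

theorem fderiv_mollify_apply {A Ω : Set (Vec n)} {e : Vec n → ℝ} (he : IsScale A e)
    {u : Vec n → Vec m} (hu : IntegrableOn u Ω) {x : Vec n} (hx : x ∈ A) (v : Vec n)
    (α : Fin m) :
    fderiv ℝ (mollify Ω e u) x v α =
      divPairing Ω u (fun y => rowEmbed n α (kernelField e x v y)) := by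
  have hex : 0 < e x := (he.pos_iff x).2 hx
  have hint : IntegrableOn (fun y => (kernelDeriv e x y).smulRight (u y)) Ω :=
    integrableOn_smulRight_kernelDeriv he hu hex
  rw [(hasFDerivAt_mollify he hu hx).fderiv, ContinuousLinearMap.integral_apply hint]
  have h2 := ((EuclideanSpace.proj (𝕜 := ℝ) α : Vec m →L[ℝ] ℝ).integral_comp_comm
    (hint.apply_continuousLinearMap v)).symm
  refine h2.trans ?_
  rw [divPairing, Finset.sum_eq_single α]
  · refine integral_congr_ae (ae_of_all _ fun y => ?_)
    simp only
    rw [rowDiv_rowEmbed ((contDiff_kernelField e x v).differentiable one_ne_zero y), if_pos rfl,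
      sum_fderiv_kernelField hex.ne']
    simp [mul_comm]
  · intro β _ hβ
    refine integral_eq_zero_of_ae (ae_of_all _ fun y => ?_)
    simp only
    rw [rowDiv_rowEmbed ((contDiff_kernelField e x v).differentiable one_ne_zero y), if_neg hβ]
    simp
  · simp

/-- A small multiple of a smooth function whose support is exactly `A`. Boundedness of `A` bounds
its gradient. -/
theorem exists_isScale {A : Set (Vec n)} (hA : IsOpen A) (hb : Bornology.IsBounded A) {ε : ℝ}
    (hε : 0 < ε) : ∃ e : Vec n → ℝ, IsScale A e ∧ ∀ x, e x ≤ ε := by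
  obtain ⟨g, hgs, hg, hgr⟩ := hA.exists_contDiff_support_eq (n := 1)
  have hgc : HasCompactSupport g := by
    rw [HasCompactSupport, tsupport, hgs]
    exact hb.isCompact_closure
  have hg1 : ContDiff ℝ 1 g := by exact_mod_cast hg
  obtain ⟨C, hC⟩ := (hgc.fderiv ℝ).exists_bound_of_continuous (hg1.continuous_fderiv one_ne_zero)
  have hC0 : 0 ≤ C := (norm_nonneg _).trans (hC 0)
  have hg0 : ∀ x, 0 ≤ g x := fun x => (hgr ⟨x, rfl⟩).1
  -- `C + 1` in place of `C` avoids division by zero.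
  set t := min ε (2 * (C + 1))⁻¹ with ht
  have ht0 : 0 < t := lt_min hε (by positivity)
  refine ⟨fun x => t * g x, ⟨contDiff_const.mul hg1, fun x => mul_nonneg ht0.le (hg0 x),
    fun x => ?_, fun x => ?_⟩, fun x => ?_⟩
  · rw [mul_pos_iff_of_pos_left ht0, ← hgs, Function.mem_support]
    exact ⟨fun h => h.ne', fun h => lt_of_le_of_ne (hg0 x) h.symm⟩
  · rw [fderiv_const_mul (hg1.differentiable one_ne_zero x), norm_smul,
      Real.norm_of_nonneg ht0.le]
    calc t * ‖fderiv ℝ g x‖ ≤ (2 * (C + 1))⁻¹ * (C + 1) :=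
          mul_le_mul (min_le_right _ _) ((hC x).trans (by linarith)) (norm_nonneg _)
            (by positivity)
      _ = 1 / 2 := by field_simp
  · exact (mul_le_of_le_one_right ht0.le (hgr ⟨x, rfl⟩).2).trans (min_le_left _ _)

/-! ### Pointwise bounds for mollifications -/

theorem rpow_le_of_le_mul_rpow_inv {X C B q P : ℝ} (hX : 0 ≤ X) (hC : 1 ≤ C) (hB : 0 ≤ B)
    (hq : 1 ≤ q) (hqP : q ≤ P) (h : X ≤ C * B ^ q⁻¹) : X ^ q ≤ C ^ P * B := by
  have hC0 : 0 ≤ C := by linarith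
  calc X ^ q ≤ (C * B ^ q⁻¹) ^ q := Real.rpow_le_rpow hX h (by linarith)
    _ = C ^ q * B := by
      rw [Real.mul_rpow hC0 (Real.rpow_nonneg hB _), ← Real.rpow_mul hB,
        inv_mul_cancel₀ (by linarith), Real.rpow_one]
    _ ≤ C ^ P * B := by
      gcongr

theorem norm_le_of_forall_abs_le {ι : Type*} [Fintype ι] (v : EuclideanSpace ℝ ι) {M : ℝ}
    (hM : 0 ≤ M) (h : ∀ i, |v i| ≤ M) : ‖v‖ ≤ √(Fintype.card ι) * M := by
  rw [EuclideanSpace.norm_eq]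
  refine Real.sqrt_le_iff.2 ⟨by positivity, ?_⟩
  rw [mul_pow, Real.sq_sqrt (Nat.cast_nonneg _)]
  calc ∑ i, ‖v i‖ ^ 2 ≤ ∑ _i : ι, M ^ 2 := by
        refine Finset.sum_le_sum fun i _ => ?_
        rw [Real.norm_eq_abs]
        exact pow_le_pow_left₀ (abs_nonneg _) (h i) 2
    _ = Fintype.card ι * M ^ 2 := by simp

/-- The data for mollifying `u` in `A ⊆ Ω`: the radius `e` is small compared with a bound `R` for
the modulars of `u` and of its gradient. -/
structure IsMollifyRadius (A : Set (Vec n)) (e : Vec n → ℝ) (R : ℝ) : Prop where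
  scale : IsScale A e
  le_half : ∀ x, e x ≤ 1 / 2
  mul_le : ∀ x, e x * R ≤ 1

namespace IsLogExponent

variable {Ω A : Set (Vec n)} {p : Vec n → ℝ} {P L R : ℝ} {e : Vec n → ℝ} {u : Vec n → Vec m}

/-- Jensen's inequality with a frozen exponent: `‖u‖` is split at the level `T`, the expected size
of the mollification, and the log-Hölder condition replaces `p y` by `p x` above that level. -/
theorem norm_mollify_le (hp : IsLogExponent Ω p P L) (he : IsMollifyRadius A e R) (hA : A ⊆ Ω)
    (hR0 : 0 ≤ R) {x : Vec n} (hx : x ∈ A)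
    (hfin : ∫⁻ y in Metric.ball x (e x), ENNReal.ofReal (‖u y‖ ^ p y) ≤ ENNReal.ofReal R) :
    ‖mollify Ω e u x‖ ≤ bumpBound n * (unitBallVolume n + Real.exp (L * (n + 2))) *
      (1 + (e x)⁻¹ ^ n *
        (∫⁻ y in Metric.ball x (e x), ENNReal.ofReal (‖u y‖ ^ p y)).toReal) ^ (p x)⁻¹ := by
  have hε : 0 < e x := (he.scale.pos_iff x).2 hx
  have hball := (he.scale.ball_subset x).trans hA
  have hω := unitBallVolume_nonneg n
  have hB := one_le_bumpBound (n := n)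
  have hpx := hp.one_le x (hA hx)
  set r := (∫⁻ y in Metric.ball x (e x), ENNReal.ofReal (‖u y‖ ^ p y)).toReal with hr
  have hr0 : 0 ≤ r := ENNReal.toReal_nonneg
  have hrE : ∫⁻ y in Metric.ball x (e x), ENNReal.ofReal (‖u y‖ ^ p y) = ENNReal.ofReal r :=
    (ENNReal.ofReal_toReal (ne_top_of_le_ne_top ENNReal.ofReal_ne_top hfin)).symm
  set h := (e x)⁻¹ ^ n with hh
  have hh0 : 0 < h := by positivity
  have hhr : 0 ≤ h * r := by positivity
  set T := (1 + h * r) ^ (p x)⁻¹ with hT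
  have hT1 : 1 ≤ T := Real.one_le_rpow (by linarith) (by positivity)
  have hT0 : 0 < T := one_pos.trans_le hT1
  have hTp : T ^ p x = 1 + h * r := by
    rw [hT, ← Real.rpow_mul (by linarith), inv_mul_cancel₀ (by linarith), Real.rpow_one]
  have hTle : T ≤ 1 + h * R := by
    calc T ≤ (1 + h * r) ^ (1 : ℝ) :=
          Real.rpow_le_rpow_of_exponent_le (by linarith) (inv_le_one_of_one_le₀ hpx)
      _ = 1 + h * r := Real.rpow_one _
      _ ≤ 1 + h * R := by
          rw [hrE, ENNReal.ofReal_le_ofReal_iff hR0] at hfin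
          gcongr
  set K := Real.exp (L * (n + 2)) with hK
  have hK0 : 0 < K := Real.exp_pos _
  set S := K * T ^ (1 - p x) with hS
  have hS0 : 0 ≤ S := by positivity
  -- Where `‖u y‖ > T`, write `‖u y‖ = ‖u y‖ ^ (1 - p y) ‖u y‖ ^ p y` and use that the first power
  -- is decreasing.
  have hpt : ∀ y ∈ Metric.ball x (e x), ‖u y‖ ≤ T + S * ‖u y‖ ^ p y := by
    intro y hy
    rcases le_or_gt ‖u y‖ T with hle | hlt
    · have : 0 ≤ S * ‖u y‖ ^ p y := mul_nonneg hS0 (Real.rpow_nonneg (norm_nonneg _) _)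
      linarith
    · have hosc := hp.rpow_sub_le (hA hx) (hball hy) hε (he.le_half x) (he.mul_le x)
        (by rw [← dist_eq_norm, dist_comm]; exact (Metric.mem_ball.1 hy).le) hT1 hTle
      have hu0 : 0 < ‖u y‖ := hT0.trans hlt
      have hpy := hp.one_le y (hball hy)
      calc ‖u y‖ = ‖u y‖ ^ (1 - p y) * ‖u y‖ ^ p y := by
            rw [← Real.rpow_add hu0, sub_add_cancel, Real.rpow_one]
        _ ≤ T ^ (1 - p y) * ‖u y‖ ^ p y :=
            mul_le_mul_of_nonneg_right (Real.rpow_le_rpow_of_nonpos hT0 hlt.le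
              (sub_nonpos.2 hpy)) (Real.rpow_nonneg hu0.le _)
        _ = T ^ (p x - p y) * T ^ (1 - p x) * ‖u y‖ ^ p y := by
            rw [← Real.rpow_add hT0]
            congr 2
            ring
        _ ≤ S * ‖u y‖ ^ p y := by
            rw [hS]
            gcongr
        _ ≤ T + S * ‖u y‖ ^ p y := by linarith
  have hmain : ‖mollify Ω e u x‖ₑ ≤
      ENNReal.ofReal (bumpBound n * h * (T * ((e x) ^ n * unitBallVolume n) + S * r)) := by
    calc ‖mollify Ω e u x‖ₑ ≤ ∫⁻ y in Ω, ‖kernel e x y • u y‖ₑ :=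
          enorm_integral_le_lintegral_enorm _
      _ ≤ ∫⁻ y in Ω, (Metric.ball x (e x)).indicator (fun y => ENNReal.ofReal (bumpBound n * h) *
            (ENNReal.ofReal T + ENNReal.ofReal S * ENNReal.ofReal (‖u y‖ ^ p y))) y := by
          refine lintegral_mono fun y => ?_
          by_cases hy : y ∈ Metric.ball x (e x)
          · have hup := Real.rpow_nonneg (norm_nonneg (u y)) (p y)
            rw [Set.indicator_of_mem hy, ← ENNReal.ofReal_mul hS0, ← ENNReal.ofReal_add hT0.le
              (mul_nonneg hS0 hup), ← ENNReal.ofReal_mul (by positivity), ← ofReal_norm,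
              norm_smul, Real.norm_of_nonneg (kernel_nonneg hε.le y)]
            exact ENNReal.ofReal_le_ofReal (mul_le_mul (kernel_le hε.le y) (hpt y hy)
              (norm_nonneg _) (by positivity))
          · rw [kernel_eq_zero hε, zero_smul, enorm_zero]
            · exact zero_le
            · rw [Metric.mem_ball, dist_comm] at hy
              linarith
      _ ≤ ∫⁻ y, (Metric.ball x (e x)).indicator (fun y => ENNReal.ofReal (bumpBound n * h) *
            (ENNReal.ofReal T + ENNReal.ofReal S * ENNReal.ofReal (‖u y‖ ^ p y))) y :=
          setLIntegral_le_lintegral _ _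
      _ = _ := by
          rw [lintegral_indicator Metric.isOpen_ball.measurableSet,
            lintegral_const_mul' _ _ ENNReal.ofReal_ne_top, lintegral_add_left measurable_const,
            lintegral_const_mul' _ _ ENNReal.ofReal_ne_top, hrE, setLIntegral_const,
            volume_ball_eq x hε, ← ENNReal.ofReal_mul hT0.le, ← ENNReal.ofReal_mul hS0,
            ← ENNReal.ofReal_add (by positivity) (by positivity),
            ← ENNReal.ofReal_mul (by positivity)]
  rw [← ofReal_norm, ENNReal.ofReal_le_ofReal_iff (by positivity)] at hmain
  have hεh : h * (e x) ^ n = 1 := by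
    rw [hh, ← mul_pow, inv_mul_cancel₀ hε.ne', one_pow]
  have hSr : S * (h * r) ≤ K * T := by
    have h1 : T ^ (1 - p x) * T ^ p x = T := by
      rw [← Real.rpow_add hT0, sub_add_cancel, Real.rpow_one]
    calc S * (h * r) ≤ S * T ^ p x := by
          rw [hTp]
          gcongr
          linarith
      _ = K * T := by rw [hS, mul_assoc, h1]
  calc ‖mollify Ω e u x‖ ≤ bumpBound n * h * (T * ((e x) ^ n * unitBallVolume n) + S * r) := hmain
    _ = bumpBound n * (T * unitBallVolume n * (h * (e x) ^ n) + S * (h * r)) := by ring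
    _ ≤ bumpBound n * (T * unitBallVolume n * 1 + K * T) := by
        rw [hεh]
        gcongr
    _ = _ := by ring

/-- Each entry is a pairing with a row of the kernel field. Applying `divPairing_le` to this field
and to its negative bounds the absolute value. -/
theorem norm_mollifyGrad_le (hp : IsLogExponent Ω p P L) (he : IsMollifyRadius A e R)
    (hA : A ⊆ Ω) (hu : IntegrableOn u Ω) (hR0 : 0 ≤ R) {x : Vec n} (hx : x ∈ A)
    (hfin : dualEnergy (powPhi p) Ω u (Metric.ball x (e x)) ≤ ENNReal.ofReal R) :
    ‖mollifyGrad Ω e u x‖ ≤ √(m * n) * gradConst n P L (2 * bumpBound n) *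
      (1 + (e x)⁻¹ ^ n *
        (dualEnergy (powPhi p) Ω u (Metric.ball x (e x))).toReal) ^ (p x)⁻¹ := by
  have hε : 0 < e x := (he.scale.pos_iff x).2 hx
  have hball := (he.scale.ball_subset x).trans hA
  have hB := one_le_bumpBound (n := n)
  have key : ∀ {w : Vec n → Mat m n}, IsTestField (Metric.ball x (e x)) w →
      (∀ y, ‖w y‖ ≤ 2 * bumpBound n * (e x)⁻¹ ^ n) → divPairing Ω u w ≤ _ := fun hw hwc =>
    hp.divPairing_le (hA hx) hε (he.le_half x) hR0 (he.mul_le x) hball (by positivity) hfin hw hwc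
  have hle : ∀ q : Fin m × Fin n, |mollifyGrad Ω e u x q| ≤
      gradConst n P L (2 * bumpBound n) * (1 + (e x)⁻¹ ^ n *
        (dualEnergy (powPhi p) Ω u (Metric.ball x (e x))).toReal) ^ (p x)⁻¹ := by
    intro q
    have hw := isTestField_kernelField (m := m) hε (EuclideanSpace.single q.2 1) q.1
    have hwc : ∀ y, ‖rowEmbed n q.1 (kernelField e x (EuclideanSpace.single q.2 1) y)‖ ≤
        2 * bumpBound n * (e x)⁻¹ ^ n := fun y => by
      rw [norm_rowEmbed]
      exact norm_kernelField_le he.scale hε (by simp) y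
    have hq : mollifyGrad Ω e u x q = divPairing Ω u
        (fun y => rowEmbed n q.1 (kernelField e x (EuclideanSpace.single q.2 1) y)) :=
      fderiv_mollify_apply he.scale hu hx _ _
    rw [hq]
    refine abs_le'.2 ⟨key hw hwc, ?_⟩
    have h1 := key (hw.const_smul (-1)) (fun y => by
      rw [Pi.smul_apply, norm_smul]
      simpa using hwc y)
    rwa [divPairing_const_smul u hw, neg_one_mul] at h1
  rw [mul_assoc]
  -- The nonnegativity of the bound is read off from an entry, so a matrix without entries is
  -- treated apart.
  rcases isEmpty_or_nonempty (Fin m × Fin n) with hempty | ⟨⟨q⟩⟩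
  · have h1 := norm_le_of_forall_abs_le (mollifyGrad Ω e u x) le_rfl fun q => hempty.elim q
    have h2 : (m * n : ℝ) = 0 := by
      have := Fintype.card_eq_zero (α := Fin m × Fin n)
      rw [Fintype.card_prod, Fintype.card_fin, Fintype.card_fin] at this
      exact_mod_cast this
    rw [h2, Real.sqrt_zero, zero_mul]
    simpa using h1
  · have := norm_le_of_forall_abs_le (mollifyGrad Ω e u x) ((abs_nonneg _).trans (hle q)) hle
    simpa using this

end IsLogExponent

/-! ### Modulars and Luxemburg norms -/

theorem mul_rpow_le {c t q P : ℝ} (hc : 0 ≤ c) (ht : 0 ≤ t) (hq : 1 ≤ q) (hqP : q ≤ P) :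
    (c * t) ^ q ≤ max 1 c ^ P * t ^ q := by
  rw [Real.mul_rpow hc ht]
  refine mul_le_mul_of_nonneg_right ?_ (Real.rpow_nonneg ht _)
  calc c ^ q ≤ max 1 c ^ q := Real.rpow_le_rpow hc (le_max_right _ _) (by linarith)
    _ ≤ max 1 c ^ P := Real.rpow_le_rpow_of_exponent_le (le_max_left _ _) hqP

theorem add_rpow_le {s t q P : ℝ} (hs : 0 ≤ s) (ht : 0 ≤ t) (hq : 1 ≤ q) (hqP : q ≤ P) :
    (s + t) ^ q ≤ 2 ^ P * (s ^ q + t ^ q) := by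
  have hm : 0 ≤ max s t := le_max_of_le_left hs
  have hs' := Real.rpow_nonneg hs q
  have ht' := Real.rpow_nonneg ht q
  calc (s + t) ^ q ≤ (2 * max s t) ^ q := by
        refine Real.rpow_le_rpow (by linarith) ?_ (by linarith)
        linarith [le_max_left s t, le_max_right s t]
    _ ≤ max 1 2 ^ P * max s t ^ q := mul_rpow_le two_pos.le hm hq hqP
    _ ≤ 2 ^ P * (s ^ q + t ^ q) := by
        rw [max_eq_right one_le_two]
        gcongr
        rcases max_choice s t with h | h <;> rw [h] <;> linarith

theorem le_one_add_rpow {t q : ℝ} (ht : 0 ≤ t) (hq : 1 ≤ q) : t ≤ 1 + t ^ q := by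
  have h := Real.rpow_nonneg ht q
  rcases le_total t 1 with h1 | h1
  · linarith
  · have := Real.rpow_le_rpow_of_exponent_le h1 hq
    rw [Real.rpow_one] at this
    linarith

theorem ofReal_rpow_le {X C B q P : ℝ} {r : ℝ≥0∞} (hX : 0 ≤ X) (hB : 0 ≤ B) (hr : r ≠ ⊤)
    (hq : 1 ≤ q) (hqP : q ≤ P) (h : X ≤ C * (1 + B * r.toReal) ^ q⁻¹) :
    ENNReal.ofReal (X ^ q) ≤ ENNReal.ofReal (max 1 C ^ P) * (1 + ENNReal.ofReal B * r) := by
  have hr0 : 0 ≤ r.toReal := ENNReal.toReal_nonneg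
  have hBr : 0 ≤ 1 + B * r.toReal := by positivity
  have h1 : X ^ q ≤ max 1 C ^ P * (1 + B * r.toReal) :=
    rpow_le_of_le_mul_rpow_inv hX (le_max_left _ _) hBr hq hqP
      (h.trans (mul_le_mul_of_nonneg_right (le_max_right _ _) (Real.rpow_nonneg hBr _)))
  refine (ENNReal.ofReal_le_ofReal h1).trans (le_of_eq ?_)
  rw [ENNReal.ofReal_mul (by positivity), ENNReal.ofReal_add one_pos.le (by positivity),
    ENNReal.ofReal_mul hB, ENNReal.ofReal_toReal hr, ENNReal.ofReal_one]

theorem luxNorm_le {F : Type*} [NormedAddCommGroup F] [NormedSpace ℝ F]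
    {φ : Vec n → ℝ → ℝ≥0∞} {A : Set (Vec n)} {g : Vec n → F} {c : ℝ} (hc : 0 < c)
    (h : modular φ A (fun x => c⁻¹ • g x) ≤ 1) : luxNorm φ A g ≤ ENNReal.ofReal c :=
  (iInf_le _ c).trans ((iInf_le _ hc).trans (iInf_le _ h))

theorem exists_modular_le_of_luxNorm_lt {F : Type*} [NormedAddCommGroup F] [NormedSpace ℝ F]
    {φ : Vec n → ℝ → ℝ≥0∞} {A : Set (Vec n)} {g : Vec n → F} {δ : ℝ}
    (h : luxNorm φ A g < ENNReal.ofReal δ) :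
    ∃ c, 0 < c ∧ c < δ ∧ modular φ A (fun x => c⁻¹ • g x) ≤ 1 := by
  obtain ⟨c, h1⟩ := iInf_lt_iff.1 h
  obtain ⟨hc, h2⟩ := iInf_lt_iff.1 h1
  obtain ⟨hm, h3⟩ := iInf_lt_iff.1 h2
  exact ⟨c, hc, (ENNReal.ofReal_lt_ofReal_iff_of_nonneg hc.le).1 h3, hm⟩

/-- The integral `∫_A |g|^{p(x)} dx`. -/
noncomputable def powModular {F : Type*} [NormedAddCommGroup F] (p : Vec n → ℝ) (A : Set (Vec n))
    (g : Vec n → F) : ℝ≥0∞ :=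
  ∫⁻ x in A, ENNReal.ofReal (‖g x‖ ^ p x)

namespace IsLogExponent

variable {Ω A : Set (Vec n)} {p : Vec n → ℝ} {P L R : ℝ} {e : Vec n → ℝ} {u : Vec n → Vec m}
  {F : Type*} [NormedAddCommGroup F] {g : Vec n → F}

theorem modular_le_powModular (hp : IsLogExponent Ω p P L) (hA : IsOpen A) (hAΩ : A ⊆ Ω) :
    modular (powPhi p) A g ≤ powModular p A g := by
  refine setLIntegral_mono' hA.measurableSet fun x hx => ENNReal.ofReal_le_ofReal ?_
  exact div_le_self (Real.rpow_nonneg (norm_nonneg _) _) (hp.one_le x (hAΩ hx))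

theorem powModular_smul_le [NormedSpace ℝ F] (hp : IsLogExponent Ω p P L) (hA : IsOpen A) (hAΩ : A ⊆ Ω) {c : ℝ}
    (hc : 0 ≤ c) :
    powModular p A (fun x => c • g x) ≤ ENNReal.ofReal (max 1 c ^ P) * powModular p A g := by
  unfold powModular
  rw [← lintegral_const_mul' _ _ ENNReal.ofReal_ne_top]
  refine setLIntegral_mono' hA.measurableSet fun x hx => ?_
  rw [← ENNReal.ofReal_mul (by positivity), norm_smul, Real.norm_of_nonneg hc]
  exact ENNReal.ofReal_le_ofReal
    (mul_rpow_le hc (norm_nonneg _) (hp.one_le x (hAΩ hx)) (hp.le x (hAΩ hx)))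

theorem powModular_le_modular (hp : IsLogExponent Ω p P L) (hA : IsOpen A) (hAΩ : A ⊆ Ω) :
    powModular p A g ≤ ENNReal.ofReal P * modular (powPhi p) A g := by
  unfold powModular modular
  rw [← lintegral_const_mul' _ _ ENNReal.ofReal_ne_top]
  refine setLIntegral_mono' hA.measurableSet fun x hx => ?_
  have h1 := hp.one_le x (hAΩ hx)
  have h2 := hp.le x (hAΩ hx)
  rw [powPhi, ← ENNReal.ofReal_mul (by linarith)]
  refine ENNReal.ofReal_le_ofReal ?_
  rw [mul_div_assoc', le_div_iff₀ (by linarith), mul_comm]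
  exact mul_le_mul_of_nonneg_right h2 (Real.rpow_nonneg (norm_nonneg _) _)

theorem powModular_lt_top [NormedSpace ℝ F] (hp : IsLogExponent Ω p P L) (hA : IsOpen A) (hAΩ : A ⊆ Ω)
    (hg : MemLphi (powPhi p) A g) : powModular p A g < ⊤ := by
  obtain ⟨_, c, hc, hfin⟩ := hg
  have h1 : g = fun x => c⁻¹ • (c • g x) := by
    funext x
    rw [smul_smul, inv_mul_cancel₀ hc.ne', one_smul]
  rw [h1]
  refine (hp.powModular_smul_le hA hAΩ (inv_nonneg.2 hc.le)).trans_lt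
    (ENNReal.mul_lt_top ENNReal.ofReal_lt_top ?_)
  exact (hp.powModular_le_modular hA hAΩ).trans_lt (ENNReal.mul_lt_top ENNReal.ofReal_lt_top hfin)

theorem memLphi [NormedSpace ℝ F] (hp : IsLogExponent Ω p P L) (hA : IsOpen A) (hAΩ : A ⊆ Ω)
    (hg : AEStronglyMeasurable g (volume.restrict A)) (h : powModular p A g < ⊤) :
    MemLphi (powPhi p) A g :=
  ⟨hg, 1, one_pos, by simpa using (hp.modular_le_powModular hA hAΩ).trans_lt h⟩

theorem aemeasurable_rpow (hp : IsLogExponent Ω p P L) (hAΩ : A ⊆ Ω) {g : Vec n → ℝ}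
    (hg : AEMeasurable g (volume.restrict A)) :
    AEMeasurable (fun x => ENNReal.ofReal (g x ^ p x)) (volume.restrict A) :=
  (hg.pow (hp.aemeasurable.mono_set hAΩ)).ennreal_ofReal

theorem integrableOn (hp : IsLogExponent Ω p P L) (hA : IsOpen A) (hAΩ : A ⊆ Ω)
    (hAfin : volume A < ⊤)
    (hg : AEStronglyMeasurable g (volume.restrict A)) (h : powModular p A g < ⊤) :
    IntegrableOn g A := by
  refine ⟨hg, ?_⟩
  calc ∫⁻ x in A, ‖g x‖ₑ ≤ ∫⁻ x in A, (1 + ENNReal.ofReal (‖g x‖ ^ p x)) := by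
        refine setLIntegral_mono' hA.measurableSet fun x hx => ?_
        rw [← ofReal_norm, ← ENNReal.ofReal_one,
          ← ENNReal.ofReal_add one_pos.le (Real.rpow_nonneg (norm_nonneg _) _)]
        exact ENNReal.ofReal_le_ofReal (le_one_add_rpow (norm_nonneg _) (hp.one_le x (hAΩ hx)))
    _ = volume A + powModular p A g := by
        rw [lintegral_add_left measurable_const, lintegral_one, Measure.restrict_apply_univ]
        rfl
    _ < ⊤ := ENNReal.add_lt_top.2 ⟨hAfin, h⟩

/-! ### Modular estimates for mollifications -/

theorem ofReal_norm_mollify_rpow_le (hp : IsLogExponent Ω p P L) (he : IsMollifyRadius A e R)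
    (hA : A ⊆ Ω) (hR0 : 0 ≤ R) (hfin : powModular p Ω u ≤ ENNReal.ofReal R) {x : Vec n}
    (hx : x ∈ A) :
    ENNReal.ofReal (‖mollify Ω e u x‖ ^ p x) ≤
      ENNReal.ofReal (max 1 (bumpBound n * (unitBallVolume n + Real.exp (L * (n + 2)))) ^ P) *
        (1 + ENNReal.ofReal ((e x)⁻¹ ^ n) *
          ∫⁻ y in Metric.ball x (e x), ENNReal.ofReal (‖u y‖ ^ p y)) := by
  have h1 : ∫⁻ y in Metric.ball x (e x), ENNReal.ofReal (‖u y‖ ^ p y) ≤ ENNReal.ofReal R :=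
    (lintegral_mono_set ((he.scale.ball_subset x).trans hA)).trans hfin
  exact ofReal_rpow_le (norm_nonneg _) (pow_nonneg (inv_nonneg.2 (he.scale.nonneg x)) _)
    (ne_top_of_le_ne_top ENNReal.ofReal_ne_top h1) (hp.one_le x (hA hx)) (hp.le x (hA hx))
    (hp.norm_mollify_le he hA hR0 hx h1)

/-- All balls lie in `A`, so the right side sees only the dual energy of `A`. `R` limits the
admissible radii but does not enter the constant. -/
theorem powModular_mollifyGrad_le (hp : IsLogExponent Ω p P L) (he : IsMollifyRadius A e R)
    (hA : IsOpen A) (hAΩ : A ⊆ Ω) (hu : IntegrableOn u Ω) (hR0 : 0 ≤ R)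
    (hfin : dualEnergy (powPhi p) Ω u Ω ≤ ENNReal.ofReal R) :
    powModular p A (mollifyGrad Ω e u) ≤
      ENNReal.ofReal (max 1 (√(m * n) * gradConst n P L (2 * bumpBound n)) ^ P) *
        (volume A + ENNReal.ofReal (3 ^ n * unitBallVolume n) * dualEnergy (powPhi p) Ω u A) := by
  obtain ⟨μ, hμ, _, hμA⟩ := exists_measure_eq_dualEnergy hp.isOpen hu
    (hfin.trans_lt ENNReal.ofReal_lt_top)
  set C := ENNReal.ofReal (max 1 (√(m * n) * gradConst n P L (2 * bumpBound n)) ^ P)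
  calc powModular p A (mollifyGrad Ω e u)
      ≤ ∫⁻ x in A, C * (1 + ENNReal.ofReal ((e x)⁻¹ ^ n) * μ (Metric.ball x (e x))) := by
        refine setLIntegral_mono' hA.measurableSet fun x hx => ?_
        have hball := (he.scale.ball_subset x).trans hAΩ
        have h1 : dualEnergy (powPhi p) Ω u (Metric.ball x (e x)) ≤ ENNReal.ofReal R :=
          (dualEnergy_mono hball).trans hfin
        rw [← hμA _ Metric.isOpen_ball hball]
        exact ofReal_rpow_le (norm_nonneg _) (pow_nonneg (inv_nonneg.2 (he.scale.nonneg x)) _)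
          (ne_top_of_le_ne_top ENNReal.ofReal_ne_top h1) (hp.one_le x (hAΩ hx))
          (hp.le x (hAΩ hx)) (hp.norm_mollifyGrad_le he hAΩ hu hR0 hx h1)
    _ = C * (volume A +
          ∫⁻ x in A, ENNReal.ofReal ((e x)⁻¹ ^ n) * μ (Metric.ball x (e x))) := by
        rw [lintegral_const_mul' _ _ ENNReal.ofReal_ne_top, lintegral_add_left measurable_const,
          lintegral_one, Measure.restrict_apply_univ]
    _ ≤ _ := by
        rw [hμA A hA hAΩ]
        gcongr
        exact he.scale.lintegral_measure_ball_le hA.measurableSet μ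

end IsLogExponent

/-! ### Convergence of mollifications -/

theorem continuousOn_mollify {A Ω : Set (Vec n)} {e : Vec n → ℝ} (he : IsScale A e)
    {u : Vec n → Vec m} (hu : IntegrableOn u Ω) : ContinuousOn (mollify Ω e u) A :=
  fun _ hx => (hasFDerivAt_mollify he hu hx).continuousAt.continuousWithinAt

theorem measurable_mollifyGrad (Ω : Set (Vec n)) (e : Vec n → ℝ) (u : Vec n → Vec m) :
    Measurable (mollifyGrad Ω e u) := by
  refine (WithLp.measurable_toLp 2 _).comp (measurable_pi_lambda _ fun q => ?_)
  have h : Measurable fun x => fderiv ℝ (mollify Ω e u) x (EuclideanSpace.single q.2 1) :=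
    measurable_fderiv_apply_const ℝ _ _
  exact (EuclideanSpace.proj (𝕜 := ℝ) q.1 : Vec m →L[ℝ] ℝ).continuous.measurable.comp h

/-- Almost everywhere convergence of mollifications. -/
theorem ae_tendsto_mollify {A Ω : Set (Vec n)} (hA : IsOpen A) (hAΩ : A ⊆ Ω)
    (hΩ : MeasurableSet Ω)
    {e : ℕ → Vec n → ℝ} (he : ∀ k, IsScale A (e k))
    (hlim : ∀ x, Tendsto (fun k => e k x) atTop (𝓝 0))
    {u : Vec n → Vec m} (hu : IntegrableOn u Ω) :
    ∀ᵐ x ∂volume.restrict A, Tendsto (fun k => mollify Ω (e k) u x) atTop (𝓝 (u x)) := by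
  let U : Vec n → Vec m := Ω.indicator u
  have hU : Integrable U := hu.integrable_indicator hΩ
  -- The kernel is at most `bumpBound n * (e x)⁻ⁿ` and lives in the ball, so the error is a constant
  -- times the mean oscillation, which vanishes at Lebesgue points.
  have hleb := IsUnifLocDoublingMeasure.ae_tendsto_average_norm_sub (volume : Measure (Vec n))
    hU.locallyIntegrable 1
  rw [ae_restrict_iff' hA.measurableSet]
  filter_upwards [hleb] with x hx hxA
  have hpos : ∀ k, 0 < e k x := fun k => ((he k).pos_iff x).2 hxA
  have h1 := hx (fun _ : ℕ => x) (fun k => e k x)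
    (tendsto_nhdsWithin_iff.2 ⟨hlim x, Eventually.of_forall hpos⟩)
    (Eventually.of_forall fun k => by simp [(hpos k).le])
  have hUx : U x = u x := Set.indicator_of_mem (hAΩ hxA) u
  rw [← hUx, tendsto_iff_norm_sub_tendsto_zero]
  have h2 := h1.const_mul (bumpBound n * unitBallVolume n)
  rw [mul_zero] at h2
  refine squeeze_zero (fun _ => norm_nonneg _) (fun k => ?_) h2
  have hk := hpos k
  have hint1 : Integrable (fun y => kernel (e k) x y • U y) := by
    rw [← integrableOn_univ]
    exact integrableOn_kernel_smul hU.integrableOn hk.le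
  have hker : Integrable (kernel (e k) x) := by
    by_contra h
    have := integral_kernel hk
    rw [integral_undef h] at this
    exact zero_ne_one this
  have hm : mollify Ω (e k) u x = ∫ y, kernel (e k) x y • U y := by
    rw [mollify, ← integral_indicator hΩ]
    congr 1
    funext y
    by_cases hy : y ∈ Ω <;> simp [U, hy]
  have hsub : mollify Ω (e k) u x - U x = ∫ y, kernel (e k) x y • (U y - U x) := by
    simp only [smul_sub]
    rw [integral_sub hint1 (hker.smul_const _), integral_smul_const, integral_kernel hk, one_smul,
      hm]
  have hUint : IntegrableOn (fun y => ‖U y - U x‖) (Metric.closedBall x (e k x)) :=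
    (hU.integrableOn.sub (integrableOn_const
      (measure_closedBall_lt_top.ne))).norm
  calc ‖mollify Ω (e k) u x - U x‖ ≤ ∫ y, ‖kernel (e k) x y • (U y - U x)‖ := by
        rw [hsub]
        exact norm_integral_le_integral_norm _
    _ ≤ ∫ y, (Metric.closedBall x (e k x)).indicator
          (fun y => bumpBound n * (e k x)⁻¹ ^ n * ‖U y - U x‖) y := by
        refine integral_mono_of_nonneg (ae_of_all _ fun _ => norm_nonneg _) ?_
          (ae_of_all _ fun y => ?_)
        · exact IntegrableOn.integrable_indicator (hUint.const_mul _) measurableSet_closedBall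
        · by_cases hy : y ∈ Metric.closedBall x (e k x)
          · simp only [Set.indicator_of_mem hy]
            rw [norm_smul, Real.norm_of_nonneg (kernel_nonneg hk.le y)]
            exact mul_le_mul_of_nonneg_right (kernel_le hk.le y) (norm_nonneg _)
          · simp only [Set.indicator_of_notMem hy]
            rw [kernel_eq_zero hk, zero_smul, norm_zero]
            rw [Metric.mem_closedBall, dist_comm, not_le] at hy
            linarith
    _ = bumpBound n * (e k x)⁻¹ ^ n * ∫ y in Metric.closedBall x (e k x), ‖U y - U x‖ := by
        rw [integral_indicator measurableSet_closedBall, integral_const_mul]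
    _ = bumpBound n * unitBallVolume n * ⨍ y in Metric.closedBall x (e k x), ‖U y - U x‖ := by
        have hvol : volume.real (Metric.closedBall x (e k x)) = e k x ^ n * unitBallVolume n := by
          rw [Measure.real, Measure.addHaar_closedBall _ x hk.le,
            ← Measure.addHaar_ball_of_pos _ x hk, volume_ball_eq x hk, ENNReal.toReal_ofReal (mul_nonneg (by positivity) (unitBallVolume_nonneg n))]
        have hω : unitBallVolume n ≠ 0 := by
          refine (ENNReal.toReal_pos ?_ measure_ball_lt_top.ne).ne'
          exact (Metric.measure_ball_pos _ _ one_pos).ne'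
        rw [setAverage_eq, hvol, smul_eq_mul, mul_inv, inv_pow]
        field_simp

namespace IsLogExponent

variable {Ω A : Set (Vec n)} {p : Vec n → ℝ} {P L R : ℝ} {u : Vec n → Vec m}

theorem powModular_add_le {F : Type*} [NormedAddCommGroup F] (hp : IsLogExponent Ω p P L)
    (hA : IsOpen A) (hAΩ : A ⊆ Ω) {g g' : Vec n → F}
    (hg : AEStronglyMeasurable g (volume.restrict A)) :
    powModular p A (fun x => g x + g' x) ≤
      ENNReal.ofReal (2 ^ P) * (powModular p A g + powModular p A g') := by
  unfold powModular
  rw [← lintegral_add_left' (hp.aemeasurable_rpow hAΩ hg.norm.aemeasurable),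
    ← lintegral_const_mul' _ _ ENNReal.ofReal_ne_top]
  refine setLIntegral_mono' hA.measurableSet fun x hx => ?_
  have h1 := hp.one_le x (hAΩ hx)
  rw [← ENNReal.ofReal_add (Real.rpow_nonneg (norm_nonneg _) _)
    (Real.rpow_nonneg (norm_nonneg _) _), ← ENNReal.ofReal_mul (by positivity)]
  refine ENNReal.ofReal_le_ofReal (le_trans ?_
    (add_rpow_le (norm_nonneg _) (norm_nonneg _) h1 (hp.le x (hAΩ hx))))
  exact Real.rpow_le_rpow (norm_nonneg _) (norm_add_le _ _) (by linarith)

/-- Almost everywhere convergence is known, but the natural majorants depend on `k`. Truncating `|u|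
^ p` at a level `N` leaves a bounded part, handled by dominated convergence, and a tail whose
contribution is small uniformly in `k` by `lintegral_measure_ball_le`. -/
theorem tendsto_powModular_mollify_sub (hp : IsLogExponent Ω p P L) (hA : IsOpen A) (hAΩ : A ⊆ Ω)
    (hAfin : volume A < ⊤) {e : ℕ → Vec n → ℝ} (he : ∀ k, IsMollifyRadius A (e k) R)
    (hlim : ∀ x, Tendsto (fun k => e k x) atTop (𝓝 0)) (hu : IntegrableOn u Ω) (hR0 : 0 ≤ R)
    (hfin : powModular p Ω u ≤ ENNReal.ofReal R) :
    Tendsto (fun k => powModular p A (fun x => mollify Ω (e k) u x - u x)) atTop (𝓝 0) := by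
  let g : Vec n → ℝ≥0∞ := fun x => ENNReal.ofReal (‖u x‖ ^ p x)
  let a : ℕ → Vec n → ℝ≥0∞ := fun k x => ENNReal.ofReal (‖mollify Ω (e k) u x - u x‖ ^ p x)
  let D : ℝ≥0∞ := ENNReal.ofReal (2 ^ P) *
    ENNReal.ofReal (max 1 (bumpBound n * (unitBallVolume n + Real.exp (L * (n + 2)))) ^ P)
  have hDtop : D ≠ ⊤ := ENNReal.mul_ne_top ENNReal.ofReal_ne_top ENNReal.ofReal_ne_top
  have hgm : AEMeasurable g (volume.restrict Ω) :=
    hp.aemeasurable_rpow subset_rfl hu.aestronglyMeasurable.norm.aemeasurable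
  have hgfin : ∫⁻ x in Ω, g x ≠ ⊤ := ne_top_of_le_ne_top ENNReal.ofReal_ne_top hfin
  have ham : ∀ k, AEMeasurable (a k) (volume.restrict A) := fun k =>
    hp.aemeasurable_rpow hAΩ ((((continuousOn_mollify (he k).scale hu).aestronglyMeasurable
      hA.measurableSet).sub (hu.mono_set hAΩ).aestronglyMeasurable).norm.aemeasurable)
  have hae : ∀ᵐ x ∂volume.restrict A, Tendsto (fun k => a k x) atTop (𝓝 0) := by
    filter_upwards [ae_tendsto_mollify hA hAΩ hp.isOpen.measurableSet (fun k => (he k).scale)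
      hlim hu, ae_restrict_mem hA.measurableSet] with x hx hxA
    have h1 := hp.one_le x (hAΩ hxA)
    have h2 := (tendsto_iff_norm_sub_tendsto_zero.1 hx).rpow_const
      (Or.inr (zero_le_one.trans h1))
    rw [Real.zero_rpow (by linarith)] at h2
    have h3 := ENNReal.tendsto_ofReal h2
    rwa [ENNReal.ofReal_zero] at h3
  -- The tail of `|u| ^ p` above the level `N`; `ν N` below is the measure with this density.
  let gN : ℕ → Vec n → ℝ≥0∞ := fun N x => g x - N
  have hgNm : ∀ N, AEMeasurable (gN N) (volume.restrict Ω) := fun N => hgm.sub aemeasurable_const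
  have hgN : Tendsto (fun N => ∫⁻ x in Ω, gN N x) atTop (𝓝 0) := by
    have h := tendsto_lintegral_of_dominated_convergence' (μ := volume.restrict Ω) (F := gN)
      (f := fun _ => 0) g hgNm (fun N => ae_of_all _ fun x => tsub_le_self) hgfin
      (ae_of_all _ fun x => ?_)
    · simpa using h
    · obtain ⟨N, hN⟩ := ENNReal.exists_nat_gt (r := g x) ENNReal.ofReal_ne_top
      refine tendsto_const_nhds.congr' ?_
      filter_upwards [eventually_ge_atTop N] with M hM
      refine (tsub_eq_zero_of_le (hN.le.trans ?_)).symm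
      exact_mod_cast hM
  let b : ℕ → ℝ≥0∞ := fun N => D * (1 + ENNReal.ofReal (unitBallVolume n) * N + N)
  let ν : ℕ → Measure (Vec n) := fun N => (volume.restrict Ω).withDensity (gN N)
  -- Averaging the constant `N` over a ball of radius `e k x` cancels the factor `(e k x)⁻ⁿ`, so the
  -- bounded part contributes `b N`, independent of `k` and `x`. The minimum with `a k x` keeps the
  -- convergence to zero.
  have hle : ∀ N k, ∀ x ∈ A, a k x ≤ min (a k x) (b N) +
      D * (ENNReal.ofReal ((e k x)⁻¹ ^ n) * ν N (Metric.ball x (e k x)) + gN N x) := by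
    intro N k x hx
    have hpos : 0 < e k x := ((he k).scale.pos_iff x).2 hx
    have hball := ((he k).scale.ball_subset x).trans hAΩ
    have hsplit : ∀ y, g y ≤ N + gN N y := fun y => le_add_tsub
    have hν : ∫⁻ y in Metric.ball x (e k x), g y ≤
        N * ENNReal.ofReal (e k x ^ n * unitBallVolume n) + ν N (Metric.ball x (e k x)) := by
      calc ∫⁻ y in Metric.ball x (e k x), g y
          ≤ ∫⁻ y in Metric.ball x (e k x), (N + gN N y) := lintegral_mono fun y => hsplit y
        _ = _ := by
          rw [lintegral_add_left measurable_const, setLIntegral_const, volume_ball_eq x hpos,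
            withDensity_apply _ measurableSet_ball, Measure.restrict_restrict measurableSet_ball,
            Set.inter_eq_left.2 hball]
    have hcancel : ENNReal.ofReal ((e k x)⁻¹ ^ n) *
        (N * ENNReal.ofReal (e k x ^ n * unitBallVolume n)) =
          ENNReal.ofReal (unitBallVolume n) * N := by
      rw [mul_left_comm, ← ENNReal.ofReal_mul (by positivity), ← mul_assoc, ← mul_pow,
        inv_mul_cancel₀ hpos.ne', one_pow, one_mul, mul_comm]
    have h1 : a k x ≤ ENNReal.ofReal (2 ^ P) *
        (ENNReal.ofReal (‖mollify Ω (e k) u x‖ ^ p x) + g x) := by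
      have hp1 := hp.one_le x (hAΩ hx)
      rw [← ENNReal.ofReal_add (Real.rpow_nonneg (norm_nonneg _) _)
        (Real.rpow_nonneg (norm_nonneg _) _), ← ENNReal.ofReal_mul (by positivity)]
      refine ENNReal.ofReal_le_ofReal (le_trans ?_
        (add_rpow_le (norm_nonneg _) (norm_nonneg _) hp1 (hp.le x (hAΩ hx))))
      exact Real.rpow_le_rpow (norm_nonneg _) (norm_sub_le _ _) (by linarith)
    have h2 : a k x ≤ b N +
        D * (ENNReal.ofReal ((e k x)⁻¹ ^ n) * ν N (Metric.ball x (e k x)) + gN N x) := by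
      set E := ENNReal.ofReal
        (max 1 (bumpBound n * (unitBallVolume n + Real.exp (L * (n + 2)))) ^ P) with hE
      have hE1 : 1 ≤ E := by
        rw [hE, ENNReal.one_le_ofReal]
        exact Real.one_le_rpow (le_max_left _ _)
          (by linarith [hp.one_le x (hAΩ hx), hp.le x (hAΩ hx)])
      calc a k x ≤ ENNReal.ofReal (2 ^ P) *
            (E * (1 + ENNReal.ofReal ((e k x)⁻¹ ^ n) * (∫⁻ y in Metric.ball x (e k x), g y))
              + E * g x) := by
            refine h1.trans ?_
            gcongr
            · exact hp.ofReal_norm_mollify_rpow_le (he k) hAΩ hR0 hfin hx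
            · exact le_mul_of_one_le_left' hE1
        _ = D * (1 + ENNReal.ofReal ((e k x)⁻¹ ^ n) * (∫⁻ y in Metric.ball x (e k x), g y)
              + g x) := by
            rw [← mul_add, ← mul_assoc]
        _ ≤ D * (1 + ENNReal.ofReal ((e k x)⁻¹ ^ n) *
              (N * ENNReal.ofReal (e k x ^ n * unitBallVolume n) + ν N (Metric.ball x (e k x)))
              + (N + gN N x)) := by
            gcongr
            exact hsplit x
        _ = _ := by
            rw [mul_add (ENNReal.ofReal ((e k x)⁻¹ ^ n)), hcancel]
            simp only [b]
            ring
    rcases le_total (a k x) (b N) with h3 | h3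
    · rw [min_eq_left h3]
      exact le_self_add
    · rw [min_eq_right h3]
      exact h2
  have hint : ∀ N k, ∫⁻ x in A, a k x ≤ (∫⁻ x in A, min (a k x) (b N)) +
      D * ((ENNReal.ofReal (3 ^ n * unitBallVolume n) + 1) * ∫⁻ x in Ω, gN N x) := by
    intro N k
    calc ∫⁻ x in A, a k x ≤ ∫⁻ x in A, (min (a k x) (b N) +
          D * (ENNReal.ofReal ((e k x)⁻¹ ^ n) * ν N (Metric.ball x (e k x)) + gN N x)) :=
        setLIntegral_mono' hA.measurableSet (hle N k)
      _ = (∫⁻ x in A, min (a k x) (b N)) + D *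
          ((∫⁻ x in A, ENNReal.ofReal ((e k x)⁻¹ ^ n) * ν N (Metric.ball x (e k x)))
            + ∫⁻ x in A, gN N x) := by
        rw [lintegral_add_left' ((ham k).min aemeasurable_const),
          lintegral_const_mul' _ _ hDtop,
          lintegral_add_right' _ ((hgNm N).mono_set hAΩ)]
      _ ≤ _ := by
        rw [add_mul, one_mul]
        gcongr
        refine ((he k).scale.lintegral_measure_ball_le hA.measurableSet (ν N)).trans ?_
        gcongr
        rw [withDensity_apply _ hA.measurableSet]
        exact setLIntegral_le_lintegral _ _
  refine ENNReal.tendsto_nhds_zero.2 fun ε hε => ?_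
  have hε2 : 0 < ε / 2 := ENNReal.half_pos hε.ne'
  have h1 : Tendsto (fun N => D * ((ENNReal.ofReal (3 ^ n * unitBallVolume n) + 1) *
      ∫⁻ x in Ω, gN N x)) atTop (𝓝 0) := by
    have h := ENNReal.Tendsto.const_mul (ENNReal.Tendsto.const_mul hgN
      (Or.inr (ENNReal.add_ne_top.2 ⟨ENNReal.ofReal_ne_top, ENNReal.one_ne_top⟩)))
      (Or.inr hDtop) (a := D) (b := (ENNReal.ofReal (3 ^ n * unitBallVolume n) + 1) * 0)
    simpa using h
  -- The level `N` is fixed first, through the tail; only then does `k` tend to infinity.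
  obtain ⟨N, hN⟩ := ((ENNReal.tendsto_nhds_zero.1 h1) (ε / 2) hε2).exists
  have h2 : Tendsto (fun k => ∫⁻ x in A, min (a k x) (b N)) atTop (𝓝 0) := by
    have hbfin : b N ≠ ⊤ := by
      refine ENNReal.mul_ne_top hDtop ?_
      simp [ENNReal.mul_eq_top]
    have h := tendsto_lintegral_of_dominated_convergence' (μ := volume.restrict A)
      (F := fun k x => min (a k x) (b N)) (f := fun _ => 0) (fun _ => b N)
      (fun k => (ham k).min aemeasurable_const) (fun k => ae_of_all _ fun x => min_le_right _ _)
      (by rw [setLIntegral_const]; exact ENNReal.mul_ne_top hbfin hAfin.ne) (by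
        filter_upwards [hae] with x hx
        have := hx.min (tendsto_const_nhds (x := b N))
        simpa using this)
    simpa using h
  filter_upwards [(ENNReal.tendsto_nhds_zero.1 h2) (ε / 2) hε2] with k hk
  calc powModular p A (fun x => mollify Ω (e k) u x - u x) = ∫⁻ x in A, a k x := rfl
    _ ≤ _ := hint N k
    _ ≤ ε / 2 + ε / 2 := add_le_add hk hN
    _ = ε := ENNReal.add_halves ε

end IsLogExponent

/-! ### Sobolev approximation -/

theorem isWeakGradient_mollifyGrad {A Ω : Set (Vec n)} {e : Vec n → ℝ}
    (he : IsScale A e) {u : Vec n → Vec m} (hu : IntegrableOn u Ω)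
    (hv : IntegrableOn (mollify Ω e u) A) (hG : IntegrableOn (mollifyGrad Ω e u) A) :
    IsWeakGradient A (mollify Ω e u) (mollifyGrad Ω e u) := by
  refine ⟨hv.locallyIntegrableOn, hG.locallyIntegrableOn, fun ψ hψ hψc hψA α i => ?_⟩
  have hψ0 : ∀ x, x ∉ A → ψ x = 0 := fun x hx =>
    image_eq_zero_of_notMem_tsupport fun h => hx (hψA h)
  have hdψ0 : ∀ x, x ∉ A → fderiv ℝ ψ x = 0 := fun x hx => by
    by_contra h
    exact hx (hψA (support_fderiv_subset ℝ h))
  have hψcont := hψ.continuous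
  have hdψcont : Continuous fun x => fderiv ℝ ψ x (EuclideanSpace.single i 1) :=
    (hψ.continuous_fderiv (by simp)).clm_apply continuous_const
  obtain ⟨C, hC⟩ := hψc.exists_bound_of_continuous hψcont
  obtain ⟨C', hC'⟩ := (hψc.fderiv_apply ℝ (EuclideanSpace.single i 1)).exists_bound_of_continuous
    hdψcont
  have hvα := integrableOn_apply hv α
  have hGα : IntegrableOn (fun x => mollifyGrad Ω e u x (α, i)) A :=
    (EuclideanSpace.proj (𝕜 := ℝ) (α, i) : Mat m n →L[ℝ] ℝ).integrable_comp hG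
  have hderiv : ∀ x ∈ A, HasFDerivAt (fun x => mollify Ω e u x α)
      ((EuclideanSpace.proj (𝕜 := ℝ) α : Vec m →L[ℝ] ℝ).comp (fderiv ℝ (mollify Ω e u) x)) x :=
    fun x hx => (EuclideanSpace.proj (𝕜 := ℝ) α : Vec m →L[ℝ] ℝ).hasFDerivAt.comp x
      (hasFDerivAt_mollify he hu hx).differentiableAt.hasFDerivAt
  have hGeq : ∀ x ∈ A, fderiv ℝ (fun x => mollify Ω e u x α) x (EuclideanSpace.single i 1)
      = mollifyGrad Ω e u x (α, i) := fun x hx => by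
    rw [(hderiv x hx).fderiv]
    rfl
  -- The mollification is known to be differentiable only in `A`, but all products with `ψ` vanish
  -- outside, so integration by parts can be done on the whole space.
  have hext : ∀ f : Vec n → ℝ, (∀ x, x ∉ A → f x = 0) → ∫ x in A, f x = ∫ x, f x := fun f hf =>
    setIntegral_eq_integral_of_forall_compl_eq_zero hf
  have hextI : ∀ f : Vec n → ℝ, (∀ x, x ∉ A → f x = 0) → IntegrableOn f A → Integrable f :=
    fun f hf hi => (integrableOn_iff_integrable_of_support_subset
      (fun x hx => by_contra fun h => hx (hf x h))).1 hi
  have hcongr : ∀ x, fderiv ℝ (fun x => mollify Ω e u x α) x (EuclideanSpace.single i 1) * ψ x =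
      mollifyGrad Ω e u x (α, i) * ψ x := fun x => by
    by_cases hx : x ∈ A
    · rw [hGeq x hx]
    · rw [hψ0 x hx, mul_zero, mul_zero]
  have hI1 : Integrable fun x => mollifyGrad Ω e u x (α, i) * ψ x :=
    hextI _ (fun x hx => by rw [hψ0 x hx, mul_zero])
      (hGα.mul_bdd hψcont.aestronglyMeasurable (ae_of_all _ hC))
  rw [hext _ fun x hx => by rw [hdψ0 x hx]; simp, hext _ fun x hx => by rw [hψ0 x hx, mul_zero]]
  simp only [← hcongr] at hI1 ⊢
  refine integral_mul_fderiv_eq_neg_fderiv_mul_of_integrable hI1 ?_ ?_ ?_ ?_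
  · exact hextI _ (fun x hx => by rw [hdψ0 x hx]; simp)
      (hvα.mul_bdd hdψcont.aestronglyMeasurable (ae_of_all _ hC'))
  · exact hextI _ (fun x hx => by rw [hψ0 x hx, mul_zero])
      (hvα.mul_bdd hψcont.aestronglyMeasurable (ae_of_all _ hC))
  · exact fun x hx => (hderiv x (hψA hx)).differentiableAt
  · exact fun x _ => hψ.differentiable (by simp) x

/-- The gradient bound does not depend on `δ`, so approximations converging to `u` all obey it. -/
theorem IsLogExponent.exists_memSobolev_near {Ω A : Set (Vec n)} {p : Vec n → ℝ} {P L : ℝ}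
    {u : Vec n → Vec m} (hp : IsLogExponent Ω p P L) (hb : Bornology.IsBounded Ω)
    (hA : IsOpen A) (hAΩ : A ⊆ Ω) (hu : IntegrableOn u Ω) (hup : powModular p Ω u < ⊤)
    (hfin : dualEnergy (powPhi p) Ω u Ω < ⊤) {δ : ℝ} (hδ : 0 < δ) :
    ∃ v G, MemSobolev p A v G ∧ luxNorm (powPhi p) A (fun x => v x - u x) < ENNReal.ofReal δ ∧
      powModular p A G ≤
        ENNReal.ofReal (max 1 (√(m * n) * gradConst n P L (2 * bumpBound n)) ^ P) *
        (volume A + ENNReal.ofReal (3 ^ n * unitBallVolume n) * dualEnergy (powPhi p) Ω u A) := by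
  have hAfin : volume A < ⊤ := (hb.subset hAΩ).measure_lt_top
  set R := (powModular p Ω u).toReal + (dualEnergy (powPhi p) Ω u Ω).toReal with hR
  have hR1 : 0 ≤ (powModular p Ω u).toReal := ENNReal.toReal_nonneg
  have hR2 : 0 ≤ (dualEnergy (powPhi p) Ω u Ω).toReal := ENNReal.toReal_nonneg
  have hR0 : 0 ≤ R := add_nonneg hR1 hR2
  have hupR : powModular p Ω u ≤ ENNReal.ofReal R := by
    rw [← ENNReal.ofReal_toReal hup.ne]
    exact ENNReal.ofReal_le_ofReal (by linarith)
  have hfinR : dualEnergy (powPhi p) Ω u Ω ≤ ENNReal.ofReal R := by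
    rw [← ENNReal.ofReal_toReal hfin.ne]
    exact ENNReal.ofReal_le_ofReal (by linarith)
  -- The summand 2 gives radii at most `1 / 2`, and the summand `R` gives `ε k * R ≤ 1`.
  let ε : ℕ → ℝ := fun k => ((k : ℝ) + 2 + R)⁻¹
  have hε : ∀ k, 0 < ε k := fun k => by positivity
  choose e he hee using fun k => exists_isScale hA (hb.subset hAΩ) (hε k)
  have hεlim : Tendsto ε atTop (𝓝 0) := by
    refine tendsto_inv_atTop_zero.comp ?_
    exact tendsto_atTop_add_const_right _ _ (tendsto_atTop_add_const_right _ _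
      tendsto_natCast_atTop_atTop)
  have hrad : ∀ k, IsMollifyRadius A (e k) R := fun k => by
    have hk : (0 : ℝ) ≤ k := Nat.cast_nonneg k
    refine ⟨he k, fun x => (hee k x).trans ?_, fun x => ?_⟩
    · rw [one_div]
      exact inv_anti₀ two_pos (by linarith)
    · calc e k x * R ≤ ε k * R := by gcongr; exact hee k x
        _ ≤ 1 := by
          rw [inv_mul_le_iff₀ (by positivity)]
          linarith
  have hlim : ∀ x, Tendsto (fun k => e k x) atTop (𝓝 0) := fun x =>
    squeeze_zero (fun k => (he k).nonneg x) (fun k => hee k x) hεlim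
  have hconv := hp.tendsto_powModular_mollify_sub hA hAΩ hAfin hrad hlim hu hR0 hupR
  have hδ2 : 0 < δ / 2 := by positivity
  have hconv2 := ENNReal.Tendsto.const_mul hconv (Or.inr ENNReal.ofReal_ne_top)
    (a := ENNReal.ofReal (max 1 (δ / 2)⁻¹ ^ P))
  rw [mul_zero] at hconv2
  obtain ⟨k, hk1, hk2⟩ := (((ENNReal.tendsto_nhds_zero.1 hconv2) 1 one_pos).and
    ((ENNReal.tendsto_nhds_zero.1 hconv) 1 one_pos)).exists
  have hgrad := hp.powModular_mollifyGrad_le (hrad k) hA hAΩ hu hR0 hfinR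
  have hgradfin : powModular p A (mollifyGrad Ω (e k) u) < ⊤ := by
    refine hgrad.trans_lt (ENNReal.mul_lt_top ENNReal.ofReal_lt_top (ENNReal.add_lt_top.2
      ⟨hAfin, ENNReal.mul_lt_top ENNReal.ofReal_lt_top ((dualEnergy_mono hAΩ).trans_lt hfin)⟩))
  have hvm : AEStronglyMeasurable (mollify Ω (e k) u) (volume.restrict A) :=
    (continuousOn_mollify (he k) hu).aestronglyMeasurable hA.measurableSet
  have hum := (hu.mono_set hAΩ).aestronglyMeasurable
  have hvfin : powModular p A (mollify Ω (e k) u) < ⊤ := by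
    have h1 := hp.powModular_add_le hA hAΩ (g' := u) (hvm.sub hum)
    simp only [Pi.sub_apply, sub_add_cancel] at h1
    refine h1.trans_lt (ENNReal.mul_lt_top ENNReal.ofReal_lt_top (ENNReal.add_lt_top.2 ⟨?_, ?_⟩))
    · exact hk2.trans_lt ENNReal.one_lt_top
    · exact (lintegral_mono_set hAΩ).trans_lt hup
  have hGm := (measurable_mollifyGrad Ω (e k) u).aestronglyMeasurable (μ := volume.restrict A)
  refine ⟨mollify Ω (e k) u, mollifyGrad Ω (e k) u, ⟨hp.memLphi hA hAΩ hvm hvfin, ?_,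
    hp.memLphi hA hAΩ hGm hgradfin⟩, ?_, hgrad⟩
  · exact isWeakGradient_mollifyGrad (he k) hu (hp.integrableOn hA hAΩ hAfin hvm hvfin)
      (hp.integrableOn hA hAΩ hAfin hGm hgradfin)
  · refine (luxNorm_le hδ2 ?_).trans_lt ((ENNReal.ofReal_lt_ofReal_iff hδ).2 (by linarith))
    exact (hp.modular_le_powModular hA hAΩ).trans
      ((hp.powModular_smul_le hA hAΩ (inv_nonneg.2 hδ2.le)).trans hk1)

/-! ### Gluing Sobolev functions -/

/-- `ζ` is a smooth cutoff function between `A'` and `A` with gradient bounded by `Λ`. -/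
structure IsCutoff (A' A : Set (Vec n)) (ζ : Vec n → ℝ) (Λ : ℝ) : Prop where
  contDiff : ContDiff ℝ ∞ ζ
  tsupport_subset : tsupport ζ ⊆ A
  nonneg : ∀ x, 0 ≤ ζ x
  le_one : ∀ x, ζ x ≤ 1
  eq_one : ∀ x ∈ A', ζ x = 1
  fderiv_le : ∀ x, ‖fderiv ℝ ζ x‖ ≤ Λ

/-- Composing one cutoff `χ` with `N` shifted steps makes the `i`-th transition take place in `{i <
N χ < i + 1}`. These layers are disjoint, which is the source of De Giorgi's averaging. The gradient
bound `Λ` may depend on `N`. -/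
theorem exists_cutoff_layers {A' A : Set (Vec n)} (hA : IsOpen A) (hc : IsCompact (closure A'))
    (hA'A : closure A' ⊆ A) (N : ℕ) :
    ∃ (ζ : ℕ → Vec n → ℝ) (S : ℕ → Set (Vec n)) (Λ : ℝ), (∀ i < N, IsCutoff A' A (ζ i) Λ) ∧
      (∀ i, IsOpen (S i)) ∧ (∀ i < N, S i ⊆ A \ A') ∧ Pairwise (Function.onFun Disjoint S) ∧
      ∀ i, ∀ x ∉ S i, (ζ i x = 0 ∨ ζ i x = 1) ∧ fderiv ℝ (ζ i) x = 0 := by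
  obtain ⟨χ, hχ, hχc, hχA, hχ0, hχ1, hχK⟩ := exists_cutoff hc hA hA'A
  let ζ : ℕ → Vec n → ℝ := fun i x => Real.smoothTransition (N * χ x - i)
  let S : ℕ → Set (Vec n) := fun i => {x | (i : ℝ) < N * χ x ∧ N * χ x < i + 1}
  have hζ : ∀ i, ContDiff ℝ ∞ (ζ i) := fun i =>
    Real.smoothTransition.contDiff.comp ((contDiff_const.mul hχ).sub contDiff_const)
  have hts : ∀ i, tsupport (ζ i) ⊆ tsupport χ := fun i => by
    refine closure_mono fun x hx => ?_
    by_contra h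
    refine hx (Real.smoothTransition.zero_of_nonpos ?_)
    rw [Function.notMem_support.1 h]
    simp
  have hcomp : ∀ i, HasCompactSupport (ζ i) := fun i =>
    hχc.of_isClosed_subset (isClosed_tsupport _) (hts i)
  choose C hC using fun i => ((hcomp i).fderiv ℝ).exists_bound_of_continuous
    ((hζ i).continuous_fderiv (by simp))
  have hNpos : ∀ {i x}, (i : ℝ) < N * χ x → i < N := fun {i x} h => by
    have : (i : ℝ) < N := h.trans_le (mul_le_of_le_one_right (Nat.cast_nonneg _) (hχ1 x))
    exact_mod_cast this
  refine ⟨ζ, S, ∑ i ∈ Finset.range N, |C i|, fun i hi => ⟨hζ i, (hts i).trans hχA,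
    fun x => Real.smoothTransition.nonneg _, fun x => Real.smoothTransition.le_one _,
    fun x hx => ?_, fun x => ?_⟩, fun i => ?_, fun i hi x hx => ?_, fun i j hij => ?_,
    fun i x hx => ?_⟩
  · refine Real.smoothTransition.one_of_one_le ?_
    rw [hχK x (subset_closure hx), mul_one, le_sub_iff_add_le]
    exact_mod_cast (by omega : 1 + i ≤ N)
  · refine ((hC i x).trans (le_abs_self _)).trans ?_
    exact Finset.single_le_sum (f := fun i => |C i|) (fun _ _ => abs_nonneg _)
      (Finset.mem_range.2 hi)
  · have hcont : Continuous fun x => N * χ x := continuous_const.mul hχ.continuous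
    exact (isOpen_lt continuous_const hcont).inter (isOpen_lt hcont continuous_const)
  · refine ⟨hχA (subset_tsupport _ ?_), fun hxA' => ?_⟩
    · intro h
      have h1 := hx.1
      rw [h, mul_zero] at h1
      exact absurd h1 (not_lt.2 (Nat.cast_nonneg i))
    · have h1 := hx.2
      rw [hχK x (subset_closure hxA'), mul_one] at h1
      have : N < i + 1 := by exact_mod_cast h1
      omega
  · rw [Function.onFun, Set.disjoint_left]
    rintro x ⟨h1, h2⟩ ⟨h3, h4⟩
    have h5 : (i : ℝ) < j + 1 := h1.trans h4
    have h6 : (j : ℝ) < i + 1 := h3.trans h2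
    have h5' : i < j + 1 := by exact_mod_cast h5
    have h6' : j < i + 1 := by exact_mod_cast h6
    omega
  · rcases le_or_gt (N * χ x) i with h | h
    · have h0 : ζ i x = 0 := Real.smoothTransition.zero_of_nonpos (by linarith)
      -- Outside its layer the cutoff attains its global minimum 0 or maximum 1, so the derivative
      -- vanishes there, also on the boundary of the layer.
      refine ⟨Or.inl h0, IsLocalMin.fderiv_eq_zero (Eventually.of_forall fun y => ?_)⟩
      rw [h0]
      exact Real.smoothTransition.nonneg _
    · have h1 : ζ i x = 1 := by
        refine Real.smoothTransition.one_of_one_le ?_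
        have : ¬ N * χ x < i + 1 := fun h' => hx ⟨h, h'⟩
        linarith
      refine ⟨Or.inr h1, IsLocalMax.fderiv_eq_zero (Eventually.of_forall fun y => ?_)⟩
      rw [h1]
      exact Real.smoothTransition.le_one _

/-- The rank one matrix `a ⊗ l`. -/
noncomputable def rankOne (a : Vec m) (l : Vec n →L[ℝ] ℝ) : Mat m n :=
  WithLp.toLp 2 fun q => a q.1 * l (EuclideanSpace.single q.2 1)

theorem rankOne_apply (a : Vec m) (l : Vec n →L[ℝ] ℝ) (α : Fin m) (i : Fin n) :
    rankOne a l (α, i) = a α * l (EuclideanSpace.single i 1) := rfl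

theorem norm_rankOne_le (a : Vec m) (l : Vec n →L[ℝ] ℝ) :
    ‖rankOne a l‖ ≤ √(m * n) * ‖l‖ * ‖a‖ := by
  have h := norm_le_of_forall_abs_le (rankOne a l) (M := ‖l‖ * ‖a‖) (by positivity) fun q => by
    change |a q.1 * l (EuclideanSpace.single q.2 1)| ≤ _
    rw [abs_mul, mul_comm]
    refine mul_le_mul ?_ (PiLp.norm_apply_le a q.1) (abs_nonneg _) (norm_nonneg _)
    simpa using l.le_opNorm (EuclideanSpace.single q.2 1)
  simpa [mul_assoc] using h

theorem continuous_rankOne : Continuous fun q : Vec m × (Vec n →L[ℝ] ℝ) => rankOne q.1 q.2 := by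
  refine (PiLp.continuous_toLp 2 _).comp (continuous_pi fun q => ?_)
  fun_prop

theorem rankOne_zero (a : Vec m) : rankOne a (0 : Vec n →L[ℝ] ℝ) = 0 := by
  ext q
  change a q.1 * (0 : Vec n →L[ℝ] ℝ) _ = 0
  simp

/-- The function equal to `ζ v + (1 - ζ) w`, where `v` and `w` are defined in `A` and `B`. -/
noncomputable def glue (A B : Set (Vec n)) (ζ : Vec n → ℝ) {F : Type*} [NormedAddCommGroup F]
    [NormedSpace ℝ F] (v w : Vec n → F) (x : Vec n) : F :=
  ζ x • A.indicator v x + (1 - ζ x) • B.indicator w x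

/-- The weak gradient of `ζ v + (1 - ζ) w`. -/
noncomputable def glueGrad (A B : Set (Vec n)) (ζ : Vec n → ℝ) (v w : Vec n → Vec m)
    (G H : Vec n → Mat m n) (x : Vec n) : Mat m n :=
  glue A B ζ G H x + rankOne (A.indicator v x - B.indicator w x) (fderiv ℝ ζ x)

section Glue

variable {A' A B Ω : Set (Vec n)} {ζ : Vec n → ℝ} {Λ : ℝ}

theorem IsCutoff.norm_le_one (hζ : IsCutoff A' A ζ Λ) (x : Vec n) : ‖ζ x‖ ≤ 1 := by
  rw [Real.norm_of_nonneg (hζ.nonneg x)]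
  exact hζ.le_one x

theorem IsCutoff.norm_one_sub_le_one (hζ : IsCutoff A' A ζ Λ) (x : Vec n) : ‖1 - ζ x‖ ≤ 1 := by
  rw [Real.norm_of_nonneg (sub_nonneg.2 (hζ.le_one x))]
  linarith [hζ.nonneg x]

theorem IsCutoff.integrable_glue {F : Type*} [NormedAddCommGroup F] [NormedSpace ℝ F]
    {v w : Vec n → F} (hζ : IsCutoff A' A ζ Λ) (hA : IsOpen A) (hB : IsOpen B)
    (hv : IntegrableOn v A) (hw : IntegrableOn w B) : Integrable (glue A B ζ v w) :=
  ((hv.integrable_indicator hA.measurableSet).bdd_smul 1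
    hζ.contDiff.continuous.aestronglyMeasurable (ae_of_all _ hζ.norm_le_one)).add
  ((hw.integrable_indicator hB.measurableSet).bdd_smul (φ := fun x => 1 - ζ x) 1
    (continuous_const.sub hζ.contDiff.continuous).aestronglyMeasurable
    (ae_of_all _ hζ.norm_one_sub_le_one))

theorem IsCutoff.norm_rankOne_le (hζ : IsCutoff A' A ζ Λ) (a : Vec m) (x : Vec n) :
    ‖rankOne a (fderiv ℝ ζ x)‖ ≤ √(m * n) * Λ * ‖a‖ := by
  refine (VarExp.norm_rankOne_le _ _).trans ?_
  gcongr
  exact hζ.fderiv_le x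

theorem IsCutoff.integrable_rankOne {a : Vec n → Vec m} (hζ : IsCutoff A' A ζ Λ)
    (ha : Integrable a) : Integrable fun x => rankOne (a x) (fderiv ℝ ζ x) :=
  (ha.norm.const_mul (√(m * n) * Λ)).mono' (continuous_rankOne.comp_aestronglyMeasurable
    (ha.aestronglyMeasurable.prodMk
      (hζ.contDiff.continuous_fderiv (by simp)).aestronglyMeasurable))
    (ae_of_all _ fun x => hζ.norm_rankOne_le (a x) x)

theorem IsWeakGradient.mono {v : Vec n → Vec m} {G : Vec n → Mat m n} (hA : MeasurableSet A)
    (h : IsWeakGradient A v G) (hBA : B ⊆ A) : IsWeakGradient B v G := by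
  refine ⟨h.1.mono_set hBA, h.2.1.mono_set hBA, fun ψ hψ hψc hψB α i => ?_⟩
  have h1 := h.2.2 ψ hψ hψc (hψB.trans hBA) α i
  rw [setIntegral_eq_of_subset_of_forall_sdiff_eq_zero hA hBA,
    setIntegral_eq_of_subset_of_forall_sdiff_eq_zero hA hBA] at h1
  · exact h1
  · intro x hx
    rw [image_eq_zero_of_notMem_tsupport fun h => hx.2 (hψB h), mul_zero]
  · intro x hx
    have h0 : fderiv ℝ ψ x = 0 := by
      by_contra h
      exact hx.2 (hψB (support_fderiv_subset ℝ h))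
    simp [h0]

/-- A test function `ψ` on `A' ∪ B` splits as `ζ ψ + (1 - ζ) ψ`, with supports in `A` and in `B`.
The two weak gradient identities are added, and the derivative of `ζ` collects into the rank one
term. -/
theorem IsCutoff.isWeakGradient_glue {v w : Vec n → Vec m} {G H : Vec n → Mat m n}
    (hζ : IsCutoff A' A ζ Λ) (hA' : IsOpen A') (hA : IsOpen A) (hB : IsOpen B)
    (hv : IntegrableOn v A) (hw : IntegrableOn w B) (hG : IntegrableOn G A)
    (hH : IntegrableOn H B) (hvG : IsWeakGradient A v G) (hwH : IsWeakGradient B w H) :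
    IsWeakGradient (A' ∪ B) (glue A B ζ v w) (glueGrad A B ζ v w G H) := by
  have hvi := hv.integrable_indicator hA.measurableSet
  have hwi := hw.integrable_indicator hB.measurableSet
  have hGi := hG.integrable_indicator hA.measurableSet
  have hHi := hH.integrable_indicator hB.measurableSet
  refine ⟨((hζ.integrable_glue hA hB hv hw).locallyIntegrable).locallyIntegrableOn _,
    (((hζ.integrable_glue hA hB hG hH).add
      (hζ.integrable_rankOne (hvi.sub hwi))).locallyIntegrable).locallyIntegrableOn _,
    fun ψ hψ hψc hψU α i => ?_⟩
  have hψ0 : ∀ x, x ∉ A' ∪ B → ψ x = 0 := fun x hx =>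
    image_eq_zero_of_notMem_tsupport fun h => hx (hψU h)
  have hdψ0 : ∀ x, x ∉ A' ∪ B → fderiv ℝ ψ x = 0 := fun x hx => by
    by_contra h
    exact hx (hψU (support_fderiv_subset ℝ h))
  rw [setIntegral_eq_integral_of_forall_compl_eq_zero fun x hx => by rw [hdψ0 x hx]; simp,
    setIntegral_eq_integral_of_forall_compl_eq_zero fun x hx => by rw [hψ0 x hx, mul_zero]]
  set b : Vec n := EuclideanSpace.single i 1 with hb
  have hdζ : ∀ x, DifferentiableAt ℝ ζ x := fun x => hζ.contDiff.differentiable (by simp) x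
  have hdψ : ∀ x, DifferentiableAt ℝ ψ x := fun x => hψ.differentiable (by simp) x
  -- the two products of the test function with the cutoffs
  have hts1 : tsupport (fun x => ζ x * ψ x) ⊆ A :=
    (tsupport_smul_subset_left ζ ψ).trans hζ.tsupport_subset
  have hts2 : tsupport (fun x => (1 - ζ x) * ψ x) ⊆ B :=
    (Set.subset_inter (tsupport_smul_subset_left (fun x => 1 - ζ x) ψ)
      (tsupport_smul_subset_right (fun x => 1 - ζ x) ψ)).trans
      (tsupport_one_sub_inter_subset hA' hζ.eq_one hψU)
  have e1 := hvG.2.2 (fun x => ζ x * ψ x) (hζ.contDiff.mul hψ) hψc.mul_left hts1 α i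
  have e2 := hwH.2.2 (fun x => (1 - ζ x) * ψ x) ((contDiff_const.sub hζ.contDiff).mul hψ)
    hψc.mul_left hts2 α i
  have hf1 : ∀ x, fderiv ℝ (fun x => ζ x * ψ x) x b =
      ζ x * fderiv ℝ ψ x b + ψ x * fderiv ℝ ζ x b := fun x => by
    rw [fderiv_fun_mul (hdζ x) (hdψ x)]
    simp
  have hf2 : ∀ x, fderiv ℝ (fun x => (1 - ζ x) * ψ x) x b =
      (1 - ζ x) * fderiv ℝ ψ x b - ψ x * fderiv ℝ ζ x b := fun x => by
    rw [fderiv_fun_mul ((hdζ x).const_sub 1) (hdψ x), fderiv_const_sub]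
    simp
    ring
  simp only [← hb, hf1] at e1
  simp only [← hb, hf2] at e2
  have hind : ∀ {D : Set (Vec n)} (_ : IsOpen D) {k : ℕ} (g : Vec n → EuclideanSpace ℝ (Fin k))
      (h : Vec n → ℝ) (j : Fin k), ∫ x in D, g x j * h x = ∫ x, D.indicator g x j * h x := by
    intro D hD k g h j
    rw [← integral_indicator hD.measurableSet]
    congr 1
    funext x
    by_cases hx : x ∈ D <;> simp [hx]
  have hind' : ∀ {D : Set (Vec n)} (_ : IsOpen D) (g : Vec n → Mat m n)
      (h : Vec n → ℝ) (q : Fin m × Fin n),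
      ∫ x in D, g x q * h x = ∫ x, D.indicator g x q * h x := by
    intro D hD g h q
    rw [← integral_indicator hD.measurableSet]
    congr 1
    funext x
    by_cases hx : x ∈ D <;> simp [hx]
  rw [hind hA, hind' hA] at e1
  rw [hind hB, hind' hB] at e2
  have hcψ := hψ.continuous
  have hcζ := hζ.contDiff.continuous
  have hcdψ : Continuous fun x => fderiv ℝ ψ x b :=
    (hψ.continuous_fderiv (by simp)).clm_apply continuous_const
  have hcdζ : Continuous fun x => fderiv ℝ ζ x b :=
    (hζ.contDiff.continuous_fderiv (by simp)).clm_apply continuous_const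
  have hbdd : ∀ {f : Vec n → ℝ} (_ : Continuous f) (_ : ∀ x, x ∉ tsupport ψ → f x = 0)
      {g : Vec n → ℝ} (_ : Integrable g), Integrable fun x => g x * f x := by
    intro f hf hf0 g hg
    obtain ⟨C, hC⟩ := HasCompactSupport.exists_bound_of_continuous
      (HasCompactSupport.intro hψc fun x hx => hf0 x hx) hf
    exact hg.mul_bdd hf.aestronglyMeasurable (ae_of_all _ hC)
  have hψt : ∀ x, x ∉ tsupport ψ → ψ x = 0 := fun x => image_eq_zero_of_notMem_tsupport
  have hdψt : ∀ x, x ∉ tsupport ψ → fderiv ℝ ψ x b = 0 := fun x hx => by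
    have : fderiv ℝ ψ x = 0 := by
      by_contra h
      exact hx (support_fderiv_subset ℝ h)
    simp [this]
  have hva : Integrable fun x => A.indicator v x α :=
    (EuclideanSpace.proj (𝕜 := ℝ) α : Vec m →L[ℝ] ℝ).integrable_comp hvi
  have hwa : Integrable fun x => B.indicator w x α :=
    (EuclideanSpace.proj (𝕜 := ℝ) α : Vec m →L[ℝ] ℝ).integrable_comp hwi
  have hGa : Integrable fun x => A.indicator G x (α, i) :=
    (EuclideanSpace.proj (𝕜 := ℝ) (α, i) : Mat m n →L[ℝ] ℝ).integrable_comp hGi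
  have hHa : Integrable fun x => B.indicator H x (α, i) :=
    (EuclideanSpace.proj (𝕜 := ℝ) (α, i) : Mat m n →L[ℝ] ℝ).integrable_comp hHi
  have I1 := hbdd (f := fun x => ζ x * fderiv ℝ ψ x b) (by fun_prop)
    (fun x hx => by rw [hdψt x hx, mul_zero]) hva
  have I2 := hbdd (f := fun x => ψ x * fderiv ℝ ζ x b) (by fun_prop)
    (fun x hx => by rw [hψt x hx, zero_mul]) hva
  have I3 := hbdd (f := fun x => (1 - ζ x) * fderiv ℝ ψ x b) (by fun_prop)
    (fun x hx => by rw [hdψt x hx, mul_zero]) hwa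
  have I4 := hbdd (f := fun x => ψ x * fderiv ℝ ζ x b) (by fun_prop)
    (fun x hx => by rw [hψt x hx, zero_mul]) hwa
  have I5 := hbdd (f := fun x => ζ x * ψ x) (by fun_prop)
    (fun x hx => by rw [hψt x hx, mul_zero]) hGa
  have I6 := hbdd (f := fun x => (1 - ζ x) * ψ x) (by fun_prop)
    (fun x hx => by rw [hψt x hx, mul_zero]) hHa
  simp only [mul_add] at e1
  simp only [mul_sub] at e2
  rw [integral_add I1 I2] at e1
  simp only [← mul_sub] at e2
  have e2' : (∫ x, B.indicator w x α * ((1 - ζ x) * fderiv ℝ ψ x b)) -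
      ∫ x, B.indicator w x α * (ψ x * fderiv ℝ ζ x b) =
      - ∫ x, B.indicator H x (α, i) * ((1 - ζ x) * ψ x) := by
    rw [← integral_sub I3 I4, ← e2]
    congr 1
    funext x
    ring
  have eL : ∫ x, glue A B ζ v w x α * fderiv ℝ ψ x b =
      (∫ x, A.indicator v x α * (ζ x * fderiv ℝ ψ x b)) +
        ∫ x, B.indicator w x α * ((1 - ζ x) * fderiv ℝ ψ x b) := by
    rw [← integral_add I1 I3]
    congr 1
    funext x
    simp only [glue, PiLp.add_apply, PiLp.smul_apply, smul_eq_mul]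
    ring
  have eR : ∫ x, glueGrad A B ζ v w G H x (α, i) * ψ x =
      ((∫ x, A.indicator G x (α, i) * (ζ x * ψ x)) +
        ∫ x, B.indicator H x (α, i) * ((1 - ζ x) * ψ x)) +
      ((∫ x, A.indicator v x α * (ψ x * fderiv ℝ ζ x b)) -
        ∫ x, B.indicator w x α * (ψ x * fderiv ℝ ζ x b)) := by
    have I56 := I5.add I6
    have I24 := I2.sub I4
    simp only [Pi.add_def, Pi.sub_def] at I56 I24
    rw [← integral_add I5 I6, ← integral_sub I2 I4, ← integral_add I56 I24]
    congr 1
    funext x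
    simp only [glueGrad, glue, PiLp.add_apply, PiLp.smul_apply, smul_eq_mul, rankOne_apply,
      PiLp.sub_apply]
    ring
  rw [eL, eR]
  linarith

end Glue

/-! ### Growth of the integrand and energy of glued functions -/

/-- `f` is a continuous integrand of linear growth. -/
structure IsLinearGrowth (f : Mat m n → ℝ) (c M : ℝ) : Prop where
  continuous : Continuous f
  nonneg : ∀ ξ, 0 ≤ f ξ
  pos : 0 < c
  le : ∀ ξ, c * ‖ξ‖ ≤ f ξ
  one_le : 1 ≤ M
  le_mul : ∀ ξ, f ξ ≤ M * (1 + ‖ξ‖)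

namespace IsLinearGrowth

variable {f : Mat m n → ℝ} {c M : ℝ}

theorem ofReal_rpow_le (hf : IsLinearGrowth f c M) {q P : ℝ} (hq : 1 ≤ q) (hqP : q ≤ P)
    (ξ : Mat m n) : ENNReal.ofReal (f ξ ^ q) ≤
      ENNReal.ofReal (M ^ P * 2 ^ P) * (1 + ENNReal.ofReal (‖ξ‖ ^ q)) := by
  have hM := hf.one_le
  have hξ := Real.rpow_nonneg (norm_nonneg ξ) q
  rw [← ENNReal.ofReal_one, ← ENNReal.ofReal_add one_pos.le hξ,
    ← ENNReal.ofReal_mul (by positivity)]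
  refine ENNReal.ofReal_le_ofReal ?_
  calc f ξ ^ q ≤ (M * (1 + ‖ξ‖)) ^ q := Real.rpow_le_rpow (hf.nonneg ξ) (hf.le_mul ξ) (by linarith)
    _ ≤ max 1 M ^ P * (1 + ‖ξ‖) ^ q := mul_rpow_le (by linarith) (by positivity) hq hqP
    _ ≤ M ^ P * (2 ^ P * (1 ^ q + ‖ξ‖ ^ q)) := by
        rw [max_eq_right hM]
        gcongr
        exact add_rpow_le one_pos.le (norm_nonneg _) hq hqP
    _ = _ := by rw [Real.one_rpow, mul_assoc]

theorem norm_rpow_le (hf : IsLinearGrowth f c M) {q P : ℝ} (hq : 1 ≤ q) (hqP : q ≤ P)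
    (ξ : Mat m n) : ‖ξ‖ ^ q ≤ max 1 c⁻¹ ^ P * f ξ ^ q := by
  have hc := hf.pos
  refine le_trans (Real.rpow_le_rpow (norm_nonneg _) ?_ (by linarith))
    (mul_rpow_le (inv_nonneg.2 hc.le) (hf.nonneg ξ) hq hqP)
  rw [← div_eq_inv_mul, le_div_iff₀ hc, mul_comm]
  exact hf.le ξ

end IsLinearGrowth

theorem setLIntegral_le_add {U A B S : Set (Vec n)} (hU : MeasurableSet U) (hA : MeasurableSet A)
    (hB : MeasurableSet B) (hS : MeasurableSet S) {F a b q : Vec n → ℝ≥0∞}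
    (ha : AEMeasurable a (volume.restrict A)) (h1 : ∀ x ∈ U ∩ S, F x ≤ q x)
    (h2 : ∀ x ∈ U \ S, F x ≤ A.indicator a x + B.indicator b x) :
    ∫⁻ x in U, F x ≤ (∫⁻ x in A, a x) + (∫⁻ x in B, b x) + ∫⁻ x in U ∩ S, q x := by
  rw [← lintegral_inter_add_sdiff F U hS, add_comm]
  refine add_le_add ?_ (setLIntegral_mono' (hU.inter hS) h1)
  calc ∫⁻ x in U \ S, F x ≤ ∫⁻ x in U \ S, (A.indicator a x + B.indicator b x) :=
        setLIntegral_mono' (hU.diff hS) h2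
    _ ≤ ∫⁻ x, (A.indicator a x + B.indicator b x) := setLIntegral_le_lintegral _ _
    _ = _ := by
        rw [lintegral_add_left' ((aemeasurable_indicator_iff hA).2 ha), lintegral_indicator hA,
          lintegral_indicator hB]

namespace IsLogExponent

variable {Ω A' A B : Set (Vec n)} {p : Vec n → ℝ} {P L : ℝ} {ζ : Vec n → ℝ} {Λ c M : ℝ}
  {f : Mat m n → ℝ}

theorem powModular_mono {F F' : Type*} [NormedAddCommGroup F] [NormedAddCommGroup F']
    {g : Vec n → F} {g' : Vec n → F'} (hp : IsLogExponent Ω p P L) (hA : IsOpen A) (hAΩ : A ⊆ Ω)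
    (h : ∀ x, ‖g x‖ ≤ ‖g' x‖) : powModular p A g ≤ powModular p A g' :=
  setLIntegral_mono' hA.measurableSet fun x hx => ENNReal.ofReal_le_ofReal
    (Real.rpow_le_rpow (norm_nonneg _) (h x) (zero_le_one.trans (hp.one_le x (hAΩ hx))))

theorem powModular_indicator_le {F : Type*} [NormedAddCommGroup F] {g : Vec n → F}
    {U : Set (Vec n)} (hp : IsLogExponent Ω p P L) (hU : IsOpen U) (hUΩ : U ⊆ Ω) (hA : IsOpen A) :
    powModular p U (A.indicator g) ≤ powModular p A g := by
  calc powModular p U (A.indicator g)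
      ≤ ∫⁻ x in U, A.indicator (fun x => ENNReal.ofReal (‖g x‖ ^ p x)) x := by
        refine setLIntegral_mono' hU.measurableSet fun x hx => ?_
        by_cases hxA : x ∈ A
        · simp [hxA]
        · have := hp.one_le x (hUΩ hx)
          simp [hxA, Real.zero_rpow (by linarith : p x ≠ 0)]
    _ ≤ ∫⁻ x, A.indicator (fun x => ENNReal.ofReal (‖g x‖ ^ p x)) x :=
        setLIntegral_le_lintegral _ _
    _ = powModular p A g := lintegral_indicator hA.measurableSet _

/-- For `c < δ ≤ 1` and `p ≥ 1`, `|g| ^ p = c ^ p |g / c| ^ p ≤ c |g / c| ^ p`, so a small norm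
forces a small modular. -/
theorem powModular_le_of_luxNorm_lt {F : Type*} [NormedAddCommGroup F] [NormedSpace ℝ F]
    {g : Vec n → F} (hp : IsLogExponent Ω p P L) (hP : 1 ≤ P) (hA : IsOpen A) (hAΩ : A ⊆ Ω) {δ : ℝ}
    (hδ : δ ≤ 1) (h : luxNorm (powPhi p) A g < ENNReal.ofReal δ) :
    powModular p A g ≤ ENNReal.ofReal (P * δ) := by
  obtain ⟨c, hc, hcδ, hmod⟩ := exists_modular_le_of_luxNorm_lt h
  calc powModular p A g
      ≤ ∫⁻ x in A, ENNReal.ofReal (P * c) * powPhi p x ‖c⁻¹ • g x‖ := by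
        refine setLIntegral_mono' hA.measurableSet fun x hx => ?_
        have h1 := hp.one_le x (hAΩ hx)
        have h2 := hp.le x (hAΩ hx)
        rw [powPhi, ← ENNReal.ofReal_mul (by positivity)]
        refine ENNReal.ofReal_le_ofReal ?_
        have h3 : ‖g x‖ = c * ‖c⁻¹ • g x‖ := by
          rw [norm_smul, norm_inv, Real.norm_of_nonneg hc.le, mul_inv_cancel_left₀ hc.ne']
        set t := ‖c⁻¹ • g x‖
        have ht : 0 ≤ t := norm_nonneg _
        have h4 : c ^ p x ≤ c := by
          simpa using Real.rpow_le_rpow_of_exponent_ge hc (by linarith : c ≤ 1) h1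
        rw [h3, Real.mul_rpow hc.le ht, mul_div_assoc', le_div_iff₀ (by linarith)]
        have h5 := Real.rpow_nonneg ht (p x)
        calc c ^ p x * t ^ p x * p x ≤ c * t ^ p x * P := by gcongr
          _ = P * c * t ^ p x := by ring
    _ = ENNReal.ofReal (P * c) * modular (powPhi p) A (fun x => c⁻¹ • g x) :=
        lintegral_const_mul' _ _ ENNReal.ofReal_ne_top
    _ ≤ ENNReal.ofReal (P * c) * 1 := by gcongr
    _ ≤ ENNReal.ofReal (P * δ) := by
        rw [mul_one]
        exact ENNReal.ofReal_le_ofReal (by gcongr)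

theorem energy_le (hp : IsLogExponent Ω p P L) (hf : IsLinearGrowth f c M) (hA : IsOpen A)
    (hAΩ : A ⊆ Ω) (G : Vec n → Mat m n) :
    energy p f A G ≤ ENNReal.ofReal (M ^ P * 2 ^ P) * (volume A + powModular p A G) := by
  calc energy p f A G
      ≤ ∫⁻ x in A, ENNReal.ofReal (M ^ P * 2 ^ P) * (1 + ENNReal.ofReal (‖G x‖ ^ p x)) :=
        setLIntegral_mono' hA.measurableSet fun x hx =>
          hf.ofReal_rpow_le (hp.one_le x (hAΩ hx)) (hp.le x (hAΩ hx)) (G x)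
    _ = _ := by
        rw [lintegral_const_mul' _ _ ENNReal.ofReal_ne_top, lintegral_add_left measurable_const,
          lintegral_one, Measure.restrict_apply_univ]
        rfl

theorem powModular_le_energy (hp : IsLogExponent Ω p P L) (hf : IsLinearGrowth f c M)
    (hA : IsOpen A) (hAΩ : A ⊆ Ω) (G : Vec n → Mat m n) :
    powModular p A G ≤ ENNReal.ofReal (max 1 c⁻¹ ^ P) * energy p f A G := by
  unfold powModular energy
  rw [← lintegral_const_mul' _ _ ENNReal.ofReal_ne_top]
  refine setLIntegral_mono' hA.measurableSet fun x hx => ?_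
  rw [← ENNReal.ofReal_mul (by positivity)]
  exact ENNReal.ofReal_le_ofReal
    (hf.norm_rpow_le (hp.one_le x (hAΩ hx)) (hp.le x (hAΩ hx)) (G x))

theorem memSobolev_integrableOn (hp : IsLogExponent Ω p P L) (hA : IsOpen A) (hAΩ : A ⊆ Ω)
    (hAfin : volume A < ⊤) {v : Vec n → Vec m} {G : Vec n → Mat m n} (h : MemSobolev p A v G) :
    IntegrableOn v A ∧ IntegrableOn G A :=
  ⟨hp.integrableOn hA hAΩ hAfin h.1.1 (hp.powModular_lt_top hA hAΩ h.1),
    hp.integrableOn hA hAΩ hAfin h.2.2.1 (hp.powModular_lt_top hA hAΩ h.2.2)⟩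

theorem powModular_glue_lt_top {F : Type*} [NormedAddCommGroup F] [NormedSpace ℝ F]
    (hp : IsLogExponent Ω p P L) (hA' : IsOpen A') (hA : IsOpen A) (hB : IsOpen B)
    (hA'Ω : A' ⊆ Ω) (hBΩ : B ⊆ Ω) (hζ : IsCutoff A' A ζ Λ) {v w : Vec n → F}
    (hvm : AEStronglyMeasurable v (volume.restrict A)) (hv : powModular p A v < ⊤)
    (hw : powModular p B w < ⊤) : powModular p (A' ∪ B) (glue A B ζ v w) < ⊤ := by
  have hU : IsOpen (A' ∪ B) := hA'.union hB
  have hUΩ : A' ∪ B ⊆ Ω := Set.union_subset hA'Ω hBΩ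
  have hvm' : AEStronglyMeasurable (fun x => ζ x • A.indicator v x)
      (volume.restrict (A' ∪ B)) :=
    (hζ.contDiff.continuous.aestronglyMeasurable.smul
      ((aestronglyMeasurable_indicator_iff hA.measurableSet).2 hvm)).restrict
  refine (hp.powModular_add_le hU hUΩ hvm').trans_lt
    (ENNReal.mul_lt_top ENNReal.ofReal_lt_top (ENNReal.add_lt_top.2 ⟨?_, ?_⟩))
  · refine ((hp.powModular_mono hU hUΩ (g' := A.indicator v) fun x => ?_).trans
      (hp.powModular_indicator_le hU hUΩ hA)).trans_lt hv
    rw [norm_smul]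
    exact mul_le_of_le_one_left (norm_nonneg _) (hζ.norm_le_one x)
  · refine ((hp.powModular_mono hU hUΩ (g' := B.indicator w) fun x => ?_).trans
      (hp.powModular_indicator_le hU hUΩ hB)).trans_lt hw
    rw [norm_smul]
    exact mul_le_of_le_one_left (norm_nonneg _) (hζ.norm_one_sub_le_one x)

theorem memSobolev_glue (hp : IsLogExponent Ω p P L) (hΩ : volume Ω < ⊤) (hA' : IsOpen A')
    (hA : IsOpen A) (hB : IsOpen B) (hA'Ω : A' ⊆ Ω) (hAΩ : A ⊆ Ω) (hBΩ : B ⊆ Ω)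
    (hζ : IsCutoff A' A ζ Λ) {v w : Vec n → Vec m} {G H : Vec n → Mat m n}
    (hv : MemSobolev p A v G) (hw : MemSobolev p B w H) :
    MemSobolev p (A' ∪ B) (glue A B ζ v w) (glueGrad A B ζ v w G H) := by
  have hU : IsOpen (A' ∪ B) := hA'.union hB
  have hUΩ : A' ∪ B ⊆ Ω := Set.union_subset hA'Ω hBΩ
  obtain ⟨hvi, hGi⟩ := hp.memSobolev_integrableOn hA hAΩ ((measure_mono hAΩ).trans_lt hΩ) hv
  obtain ⟨hwi, hHi⟩ := hp.memSobolev_integrableOn hB hBΩ ((measure_mono hBΩ).trans_lt hΩ) hw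
  have hvf := hp.powModular_lt_top hA hAΩ hv.1
  have hwf := hp.powModular_lt_top hB hBΩ hw.1
  have hGf := hp.powModular_lt_top hA hAΩ hv.2.2
  have hHf := hp.powModular_lt_top hB hBΩ hw.2.2
  have hvw := (hvi.integrable_indicator hA.measurableSet).sub
    (hwi.integrable_indicator hB.measurableSet)
  have hg := hζ.integrable_glue hA hB hGi hHi
  have hr := hζ.integrable_rankOne hvw
  refine ⟨hp.memLphi hU hUΩ (hζ.integrable_glue hA hB hvi hwi).aestronglyMeasurable.restrict
    (hp.powModular_glue_lt_top hA' hA hB hA'Ω hBΩ hζ hv.1.1 hvf hwf),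
    hζ.isWeakGradient_glue hA' hA hB hvi hwi hGi hHi hv.2.1 hw.2.1,
    hp.memLphi hU hUΩ (hg.add hr).aestronglyMeasurable.restrict ?_⟩
  refine (hp.powModular_add_le hU hUΩ hg.aestronglyMeasurable.restrict).trans_lt
    (ENNReal.mul_lt_top ENNReal.ofReal_lt_top (ENNReal.add_lt_top.2
      ⟨hp.powModular_glue_lt_top hA' hA hB hA'Ω hBΩ hζ hv.2.2.1 hGf hHf, ?_⟩))
  have hΛ : 0 ≤ √(m * n) * Λ :=
    mul_nonneg (Real.sqrt_nonneg _) ((norm_nonneg _).trans (hζ.fderiv_le 0))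
  refine ((hp.powModular_mono hU hUΩ (g' := fun x => (√(m * n) * Λ) •
    (A.indicator v x + -B.indicator w x)) fun x => ?_).trans
      (hp.powModular_smul_le hU hUΩ hΛ)).trans_lt
      (ENNReal.mul_lt_top ENNReal.ofReal_lt_top ?_)
  · rw [norm_smul, Real.norm_of_nonneg hΛ, ← sub_eq_add_neg]
    exact hζ.norm_rankOne_le _ x
  · refine (hp.powModular_add_le hU hUΩ (hvi.integrable_indicator
      hA.measurableSet).aestronglyMeasurable.restrict).trans_lt
      (ENNReal.mul_lt_top ENNReal.ofReal_lt_top (ENNReal.add_lt_top.2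
        ⟨(hp.powModular_indicator_le hU hUΩ hA).trans_lt hvf, ?_⟩))
    refine ((hp.powModular_mono hU hUΩ (g' := B.indicator w) fun x => (norm_neg _).le).trans
      (hp.powModular_indicator_le hU hUΩ hB)).trans_lt hwf

/-- Where both functions are used, the error is a convex combination of the two errors, hence at
most their maximum. -/
theorem powModular_glue_sub_le (hp : IsLogExponent Ω p P L) (hA' : IsOpen A')
    (hA : IsOpen A) (hB : IsOpen B) (hA'A : A' ⊆ A) (hAΩ : A ⊆ Ω)
    (hζ : IsCutoff A' A ζ Λ) {u v w : Vec n → Vec m}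
    (hu : AEStronglyMeasurable u (volume.restrict A))
    (hv : AEStronglyMeasurable v (volume.restrict A)) :
    powModular p (A' ∪ B) (fun x => glue A B ζ v w x - u x) ≤
      powModular p A (fun x => v x - u x) + powModular p B (fun x => w x - u x) := by
  have h := setLIntegral_le_add (U := A' ∪ B) (S := ∅) (hA'.union hB).measurableSet
    hA.measurableSet hB.measurableSet MeasurableSet.empty
    (F := fun x => ENNReal.ofReal (‖glue A B ζ v w x - u x‖ ^ p x))
    (a := fun x => ENNReal.ofReal (‖v x - u x‖ ^ p x))
    (b := fun x => ENNReal.ofReal (‖w x - u x‖ ^ p x)) (q := 0)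
    (hp.aemeasurable_rpow hAΩ (hv.sub hu).norm.aemeasurable) (by simp) ?_
  · simpa [powModular] using h
  · rintro x ⟨hxU, -⟩
    by_cases hxA : x ∈ A
    · by_cases hxB : x ∈ B
      · simp only [glue, Set.indicator_of_mem hxA, Set.indicator_of_mem hxB]
        have hpx := hp.one_le x (hAΩ hxA)
        have h1 : ζ x • v x + (1 - ζ x) • w x - u x =
            ζ x • (v x - u x) + (1 - ζ x) • (w x - u x) := by module
        have h2 : ‖ζ x • v x + (1 - ζ x) • w x - u x‖ ≤ max ‖v x - u x‖ ‖w x - u x‖ := by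
          rw [h1]
          refine (norm_add_le _ _).trans ?_
          have h3 := hζ.nonneg x
          have h4 := sub_nonneg.2 (hζ.le_one x)
          rw [norm_smul, norm_smul, Real.norm_of_nonneg h3, Real.norm_of_nonneg h4]
          calc ζ x * ‖v x - u x‖ + (1 - ζ x) * ‖w x - u x‖
              ≤ ζ x * max ‖v x - u x‖ ‖w x - u x‖ + (1 - ζ x) * max ‖v x - u x‖ ‖w x - u x‖ := by
                gcongr
                · exact le_max_left _ _
                · exact le_max_right _ _
            _ = _ := by ring
        refine (ENNReal.ofReal_le_ofReal (Real.rpow_le_rpow (norm_nonneg _) h2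
          (zero_le_one.trans hpx))).trans ?_
        rcases max_choice ‖v x - u x‖ ‖w x - u x‖ with h | h <;> rw [h]
        · exact le_self_add
        · exact le_add_self
      · have hxA' : x ∈ A' := hxU.resolve_right hxB
        simp [glue, hxA, hxB, hζ.eq_one x hxA']
    · have hxB : x ∈ B := hxU.resolve_left fun h => hxA (hA'A h)
      have h0 : ζ x = 0 := image_eq_zero_of_notMem_tsupport fun h => hxA (hζ.tsupport_subset h)
      simp [glue, hxA, hxB, h0]

/-- Outside the layer `S` the glued gradient is exactly `G` or `H`, so the energies enter with
constant 1; the growth constants are paid only in `S`. -/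
theorem energy_glueGrad_le (hp : IsLogExponent Ω p P L) (hf : IsLinearGrowth f c M) (hP : 0 ≤ P)
    (hA' : IsOpen A') (hA : IsOpen A) (hB : IsOpen B) (hAΩ : A ⊆ Ω)
    (hζ : IsCutoff A' A ζ Λ) {S : Set (Vec n)} (hS : IsOpen S) (hSA : S ⊆ A \ A')
    (hζS : ∀ x ∉ S, (ζ x = 0 ∨ ζ x = 1) ∧ fderiv ℝ ζ x = 0)
    {v w : Vec n → Vec m} {G H : Vec n → Mat m n}
    (hG : AEStronglyMeasurable G (volume.restrict A)) :
    energy p f (A' ∪ B) (glueGrad A B ζ v w G H) ≤ energy p f A G + energy p f B H +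
      ∫⁻ x in (A' ∪ B) ∩ S, ENNReal.ofReal (M ^ P * 2 ^ P) *
        (1 + ENNReal.ofReal (2 ^ P * 2 ^ P) * (ENNReal.ofReal (‖G x‖ ^ p x) +
          ENNReal.ofReal (‖H x‖ ^ p x) +
          ENNReal.ofReal (max 1 (√(m * n) * Λ) ^ P) * ENNReal.ofReal (‖v x - w x‖ ^ p x))) := by
  refine setLIntegral_le_add (hA'.union hB).measurableSet hA.measurableSet hB.measurableSet
    hS.measurableSet (hp.aemeasurable_rpow hAΩ
      (hf.continuous.comp_aestronglyMeasurable hG).aemeasurable) ?_ ?_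
  · rintro x ⟨hxU, hxS⟩
    have hxA := (hSA hxS).1
    have hxB := hxU.resolve_left (hSA hxS).2
    have hpx := hp.one_le x (hAΩ hxA)
    have hpP := hp.le x (hAΩ hxA)
    refine (hf.ofReal_rpow_le hpx hpP _).trans ?_
    gcongr
    have hΛ : 0 ≤ √(m * n) * Λ :=
      mul_nonneg (Real.sqrt_nonneg _) ((norm_nonneg _).trans (hζ.fderiv_le 0))
    have h1 : ‖glueGrad A B ζ v w G H x‖ ≤
        ‖G x‖ + (‖H x‖ + √(m * n) * Λ * ‖v x - w x‖) := by
      simp only [glueGrad, glue, Set.indicator_of_mem hxA, Set.indicator_of_mem hxB]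
      refine (norm_add_le _ _).trans ?_
      have h2 : ‖ζ x • G x + (1 - ζ x) • H x‖ ≤ ‖G x‖ + ‖H x‖ := by
        refine (norm_add_le _ _).trans ?_
        rw [norm_smul, norm_smul]
        exact add_le_add (mul_le_of_le_one_left (norm_nonneg _) (hζ.norm_le_one x))
          (mul_le_of_le_one_left (norm_nonneg _) (hζ.norm_one_sub_le_one x))
      have h3 := hζ.norm_rankOne_le (v x - w x) x
      linarith
    have h2P : (1 : ℝ) ≤ 2 ^ P := Real.one_le_rpow one_le_two hP
    have hGp := Real.rpow_nonneg (norm_nonneg (G x)) (p x)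
    have hHp := Real.rpow_nonneg (norm_nonneg (H x)) (p x)
    have hvp := Real.rpow_nonneg (norm_nonneg (v x - w x)) (p x)
    rw [← ENNReal.ofReal_add hGp hHp, ← ENNReal.ofReal_mul (by positivity),
      ← ENNReal.ofReal_add (by positivity) (by positivity), ← ENNReal.ofReal_mul (by positivity)]
    refine ENNReal.ofReal_le_ofReal ?_
    calc ‖glueGrad A B ζ v w G H x‖ ^ p x
        ≤ (‖G x‖ + (‖H x‖ + √(m * n) * Λ * ‖v x - w x‖)) ^ p x :=
          Real.rpow_le_rpow (norm_nonneg _) h1 (by linarith)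
      _ ≤ 2 ^ P * (‖G x‖ ^ p x + (‖H x‖ + √(m * n) * Λ * ‖v x - w x‖) ^ p x) :=
          add_rpow_le (norm_nonneg _) (by positivity) hpx hpP
      _ ≤ 2 ^ P * (2 ^ P * ‖G x‖ ^ p x +
            2 ^ P * (‖H x‖ ^ p x + max 1 (√(m * n) * Λ) ^ P * ‖v x - w x‖ ^ p x)) := by
          gcongr
          · exact le_mul_of_one_le_left hGp h2P
          · refine (add_rpow_le (norm_nonneg _) (by positivity) hpx hpP).trans ?_
            gcongr
            exact mul_rpow_le hΛ (norm_nonneg _) hpx hpP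
      _ = _ := by ring
  · rintro x ⟨hxU, hxS⟩
    obtain ⟨h01, hd⟩ := hζS x hxS
    rcases h01 with h0 | h1
    · have hxB : x ∈ B := hxU.resolve_left fun h => by
        rw [hζ.eq_one x h] at h0
        exact one_ne_zero h0
      refine le_add_left (le_of_eq ?_)
      simp [glueGrad, glue, h0, hd, rankOne_zero, hxB]
    · have hxA : x ∈ A := hζ.tsupport_subset (subset_tsupport _ (by simp [h1]))
      refine le_add_right (le_of_eq ?_)
      simp [glueGrad, glue, h1, hd, rankOne_zero, hxA]

end IsLogExponent

/-! ### The relaxed functional as a set function -/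

theorem MemLphi.mono {F : Type*} [NormedAddCommGroup F] [NormedSpace ℝ F]
    {φ : Vec n → ℝ → ℝ≥0∞} {A B : Set (Vec n)} {g : Vec n → F} (h : MemLphi φ A g)
    (hBA : B ⊆ A) : MemLphi φ B g := by
  obtain ⟨hg, c, hc, hfin⟩ := h
  exact ⟨hg.mono_set hBA, c, hc, (lintegral_mono_set hBA).trans_lt hfin⟩

theorem luxNorm_mono {F : Type*} [NormedAddCommGroup F] [NormedSpace ℝ F]
    {φ : Vec n → ℝ → ℝ≥0∞} {A B : Set (Vec n)} {g : Vec n → F} (hBA : B ⊆ A) :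
    luxNorm φ B g ≤ luxNorm φ A g :=
  le_iInf fun _ => le_iInf fun hc => le_iInf fun h =>
    luxNorm_le hc ((lintegral_mono_set hBA).trans h)

theorem MemSobolev.mono {p : Vec n → ℝ} {A B : Set (Vec n)} {v : Vec n → Vec m}
    {G : Vec n → Mat m n} (hA : MeasurableSet A) (h : MemSobolev p A v G) (hBA : B ⊆ A) :
    MemSobolev p B v G :=
  ⟨h.1.mono hBA, h.2.1.mono hA hBA, h.2.2.mono hBA⟩

section Relaxed

variable {p : Vec n → ℝ} {f : Mat m n → ℝ} {u : Vec n → Vec m} {A B : Set (Vec n)} {a : ℝ≥0∞}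

/-- With the next two lemmas this replaces sequences by single functions at distance `δ`; a sequence
is recovered from `δ = 1 / (k + 1)`. -/
theorem relaxed_le_of_forall (h : ∀ δ : ℝ, 0 < δ → ∃ v G, MemSobolev p A v G ∧
    luxNorm (powPhi p) A (fun x => v x - u x) < ENNReal.ofReal δ ∧ energy p f A G ≤ a) :
    relaxed p f u A ≤ a := by
  choose v G h1 h2 h3 using fun k : ℕ => h (1 / ((k : ℝ) + 1)) (by positivity)
  have hlim : Tendsto (fun k : ℕ => ENNReal.ofReal (1 / ((k : ℝ) + 1))) atTop (𝓝 0) := by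
    simpa using ENNReal.tendsto_ofReal tendsto_one_div_add_atTop_nhds_zero_nat
  refine (iInf₂_le v G).trans ((iInf₂_le h1 ?_).trans ?_)
  · exact tendsto_of_tendsto_of_tendsto_of_le_of_le tendsto_const_nhds hlim
      (fun _ => zero_le) (fun k => (h2 k).le)
  · exact (liminf_le_liminf (Eventually.of_forall h3)).trans (liminf_const a).le

theorem exists_of_relaxed_lt (h : relaxed p f u A < a) {δ : ℝ} (hδ : 0 < δ) :
    ∃ v G, MemSobolev p A v G ∧
      luxNorm (powPhi p) A (fun x => v x - u x) < ENNReal.ofReal δ ∧ energy p f A G < a := by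
  obtain ⟨v, h⟩ := iInf_lt_iff.1 h
  obtain ⟨G, h⟩ := iInf_lt_iff.1 h
  obtain ⟨hS, h⟩ := iInf_lt_iff.1 h
  obtain ⟨hlim, h⟩ := iInf_lt_iff.1 h
  obtain ⟨k, hk1, hk2⟩ := ((frequently_lt_of_liminf_lt (by isBoundedDefault) h).and_eventually
    (hlim.eventually_lt_const (ENNReal.ofReal_pos.2 hδ))).exists
  exact ⟨v k, G k, hS k, hk2, hk1⟩

theorem exists_lt_energy_of_lt_relaxed (h : a < relaxed p f u A) :
    ∃ δ : ℝ, 0 < δ ∧ ∀ v G, MemSobolev p A v G →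
      luxNorm (powPhi p) A (fun x => v x - u x) < ENNReal.ofReal δ → a < energy p f A G := by
  by_contra! hc
  exact (relaxed_le_of_forall hc).not_gt h

theorem relaxed_mono (hA : MeasurableSet A) (hBA : B ⊆ A) :
    relaxed p f u B ≤ relaxed p f u A := by
  refine le_of_forall_gt fun a ha => ?_
  obtain ⟨b, hb, hba⟩ := exists_between ha
  refine lt_of_le_of_lt (relaxed_le_of_forall fun δ hδ => ?_) hba
  obtain ⟨v, G, hS, hlux, hE⟩ := exists_of_relaxed_lt hb hδ
  exact ⟨v, G, hS.mono hA hBA, (luxNorm_mono hBA).trans_lt hlux,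
    (lintegral_mono_set hBA).trans hE.le⟩

theorem relaxed_empty : relaxed p f u ∅ = 0 := by
  refine le_antisymm (relaxed_le_of_forall fun δ hδ => ⟨0, 0, ?_, ?_, ?_⟩) zero_le
  · refine ⟨⟨aestronglyMeasurable_zero, 1, one_pos, by simp [modular]⟩,
      ⟨by simp [LocallyIntegrableOn], by simp [LocallyIntegrableOn], by simp⟩,
      ⟨aestronglyMeasurable_zero, 1, one_pos, by simp [modular]⟩⟩
  · refine (luxNorm_le (half_pos hδ) (by simp [modular])).trans_lt ?_
    exact (ENNReal.ofReal_lt_ofReal_iff hδ).2 (half_lt_self hδ)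
  · simp [energy]

/-- One function nearly optimal on `A ∪ B` competes on both sets, and its energy is additive. -/
theorem relaxed_superadditive (hA : IsOpen A) (hB : IsOpen B) (hAB : Disjoint A B) :
    relaxed p f u A + relaxed p f u B ≤ relaxed p f u (A ∪ B) := by
  have hAm := (hA.union hB).measurableSet
  by_contra! hc
  rcases eq_or_ne (relaxed p f u A) 0 with hA0 | hA0
  · rw [hA0, zero_add] at hc
    exact (relaxed_mono hAm Set.subset_union_right).not_gt hc
  rcases eq_or_ne (relaxed p f u B) 0 with hB0 | hB0
  · rw [hB0, add_zero] at hc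
    exact (relaxed_mono hAm Set.subset_union_left).not_gt hc
  obtain ⟨a, ha, b, hb, hc⟩ := ENNReal.exists_lt_add_of_lt_add hc hA0 hB0
  obtain ⟨δ₁, hδ₁, h1⟩ := exists_lt_energy_of_lt_relaxed ha
  obtain ⟨δ₂, hδ₂, h2⟩ := exists_lt_energy_of_lt_relaxed hb
  obtain ⟨v, G, hS, hlux, hE⟩ := exists_of_relaxed_lt hc (lt_min hδ₁ hδ₂)
  have hE1 := h1 v G (hS.mono hAm Set.subset_union_left)
    ((luxNorm_mono Set.subset_union_left).trans_lt
      (hlux.trans_le (ENNReal.ofReal_le_ofReal (min_le_left _ _))))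
  have hE2 := h2 v G (hS.mono hAm Set.subset_union_right)
    ((luxNorm_mono Set.subset_union_right).trans_lt
      (hlux.trans_le (ENNReal.ofReal_le_ofReal (min_le_right _ _))))
  rw [energy, lintegral_union hB.measurableSet hAB] at hE
  exact (add_le_add hE1.le hE2.le).not_gt hE

end Relaxed

/-! ### Upper bound, subadditivity and inner regularity -/

namespace IsLogExponent

variable {Ω A' A B : Set (Vec n)} {p : Vec n → ℝ} {P L c M : ℝ} {f : Mat m n → ℝ}

theorem exists_relaxed_le (hp : IsLogExponent Ω p P L) (hb : Bornology.IsBounded Ω)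
    (hf : IsLinearGrowth f c M) :
    ∃ C : ℝ≥0, ∀ u : Vec n → Vec m, IntegrableOn u Ω → powModular p Ω u < ⊤ →
      dualEnergy (powPhi p) Ω u Ω < ⊤ → ∀ A, IsOpen A → A ⊆ Ω →
        relaxed p f u A ≤ C * (volume A + dualEnergy (powPhi p) Ω u A) := by
  set C₁ := (M ^ P * 2 ^ P).toNNReal
  set C₂ := (max 1 (√(m * n) * gradConst n P L (2 * bumpBound n)) ^ P).toNNReal
  set C₃ := (3 ^ n * unitBallVolume n).toNNReal
  refine ⟨C₁ * (1 + C₂ * (1 + C₃)), fun u hu hup hfin A hA hAΩ =>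
    relaxed_le_of_forall fun δ hδ => ?_⟩
  obtain ⟨v, G, hS, hlux, hG⟩ := hp.exists_memSobolev_near hb hA hAΩ hu hup hfin hδ
  refine ⟨v, G, hS, hlux, ?_⟩
  set T := volume A + dualEnergy (powPhi p) Ω u A
  calc energy p f A G ≤ C₁ * (volume A + powModular p A G) := hp.energy_le hf hA hAΩ G
    _ ≤ C₁ * (T + C₂ * (T + C₃ * T)) := by
        gcongr
        · exact le_self_add
        · refine hG.trans ?_
          change (C₂ : ℝ≥0∞) * (_ + C₃ * _) ≤ _
          gcongr
          · exact le_self_add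
          · exact le_add_self
    _ = _ := by
        push_cast
        ring

theorem sum_layers_le (hp : IsLogExponent Ω p P L)
    (hAΩ : A ⊆ Ω) {S : ℕ → Set (Vec n)} {N : ℕ} (hS : ∀ i, IsOpen (S i))
    (hSA : ∀ i < N, S i ⊆ A) (hd : Pairwise (Function.onFun Disjoint S))
    {C₁ C₂ C₃ : ℝ≥0∞} (h1 : C₁ ≠ ⊤) (h2 : C₂ ≠ ⊤) (h3 : C₃ ≠ ⊤)
    {G H : Vec n → Mat m n} {e : Vec n → Vec m}
    (hG : AEStronglyMeasurable G (volume.restrict A))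
    (hH : AEStronglyMeasurable H (volume.restrict A)) :
    ∑ i ∈ Finset.range N, ∫⁻ x in S i, C₁ * (1 + C₂ * (ENNReal.ofReal (‖G x‖ ^ p x) +
        ENNReal.ofReal (‖H x‖ ^ p x) + C₃ * ENNReal.ofReal (‖e x‖ ^ p x))) ≤
      C₁ * (volume A + C₂ * (powModular p A G + powModular p A H + C₃ * powModular p A e)) := by
  rw [← lintegral_biUnion_finset (fun i _ j _ hij => hd hij) fun i _ => (hS i).measurableSet]
  refine (lintegral_mono_set (Set.iUnion₂_subset fun i hi =>
    hSA i (Finset.mem_range.1 hi))).trans (le_of_eq ?_)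
  have hGm := hp.aemeasurable_rpow hAΩ hG.norm.aemeasurable
  have hHm := hp.aemeasurable_rpow hAΩ hH.norm.aemeasurable
  rw [lintegral_const_mul' _ _ h1, lintegral_add_left measurable_const, lintegral_one,
    Measure.restrict_apply_univ, lintegral_const_mul' _ _ h2, lintegral_add_left' (by exact hGm.add hHm),
    lintegral_add_left' hGm, lintegral_const_mul' _ _ h3]
  rfl

end IsLogExponent

namespace IsLogExponent

variable {Ω A' A B : Set (Vec n)} {p : Vec n → ℝ} {P L c M : ℝ} {f : Mat m n → ℝ}
  {u : Vec n → Vec m}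

/-- A bound `δ` on the Luxemburg norm which makes modulars, multiplied by `κ`, small. -/
theorem exists_delta_mul_le_one (hP : 1 ≤ P) {κ : ℝ} (hκ : 0 < κ) :
    ∃ δ : ℝ, 0 < δ ∧ δ ≤ 1 ∧
      ENNReal.ofReal κ * (ENNReal.ofReal (P * δ) + ENNReal.ofReal (P * δ)) ≤ 1 := by
  have hP0 : 0 < P := by linarith
  refine ⟨min 1 (1 / (κ * (2 * P))), by positivity, min_le_left _ _, ?_⟩
  set δ := min 1 (1 / (κ * (2 * P)))
  have hδ : 0 < δ := by positivity
  rw [← ENNReal.ofReal_add (by positivity) (by positivity), ← ENNReal.ofReal_mul hκ.le,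
    ENNReal.ofReal_le_one]
  have h : δ ≤ 1 / (κ * (2 * P)) := min_le_right _ _
  rw [le_div_iff₀ (by positivity)] at h
  linarith

theorem powModular_sub_le (hp : IsLogExponent Ω p P L) (hA : IsOpen A) (hAΩ : A ⊆ Ω)
    {v w : Vec n → Vec m} (hv : AEStronglyMeasurable v (volume.restrict A))
    (hu : AEStronglyMeasurable u (volume.restrict A)) :
    powModular p A (fun x => v x - w x) ≤ ENNReal.ofReal (2 ^ P) *
      (powModular p A (fun x => v x - u x) + powModular p A (fun x => w x - u x)) := by
  have h := hp.powModular_add_le hA hAΩ (g := fun x => v x - u x) (g' := fun x => u x - w x)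
    (hv.sub hu)
  simp only [sub_add_sub_cancel] at h
  refine h.trans ?_
  gcongr 2
  exact hp.powModular_mono hA hAΩ fun x => (norm_sub_rev _ _).le

theorem luxNorm_lt_of_powModular_le (hp : IsLogExponent Ω p P L) (hA : IsOpen A) (hAΩ : A ⊆ Ω)
    {g : Vec n → Vec m} {δ : ℝ} (hδ : 0 < δ)
    (h : ENNReal.ofReal (max 1 (δ / 2)⁻¹ ^ P) * powModular p A g ≤ 1) :
    luxNorm (powPhi p) A g < ENNReal.ofReal δ :=
  (luxNorm_le (half_pos hδ) ((hp.modular_le_powModular hA hAΩ).trans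
    ((hp.powModular_smul_le hA hAΩ (by positivity)).trans h))).trans_lt
    ((ENNReal.ofReal_lt_ofReal_iff hδ).2 (half_lt_self hδ))

/-- De Giorgi's slicing. The total cost of `N` disjoint layers is at most `T`, independently of `N`,
so for large `N` some layer costs less than `θ`. -/
theorem exists_glue_near (hp : IsLogExponent Ω p P L) (hP : 1 ≤ P) (hΩ : volume Ω < ⊤)
    (hf : IsLinearGrowth f c M) (hu : AEStronglyMeasurable u (volume.restrict Ω))
    (hA' : IsOpen A') (hA : IsOpen A) (hB : IsOpen B) (hAΩ : A ⊆ Ω) (hBΩ : B ⊆ Ω)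
    (hc : IsCompact (closure A')) (hA'A : closure A' ⊆ A) {a b θ : ℝ≥0∞} (ha : a < ⊤) (hb : b < ⊤)
    (hθ : θ ≠ 0) (hra : relaxed p f u A < a) (hrb : relaxed p f u B < b) :
    relaxed p f u (A' ∪ B) ≤ a + b + θ := by
  have hsub : A' ⊆ A := subset_closure.trans hA'A
  have hP0 : 0 ≤ P := by linarith
  have hUΩ : A' ∪ B ⊆ Ω := Set.union_subset (hsub.trans hAΩ) hBΩ
  have hU := hA'.union hB
  set C₁ := ENNReal.ofReal (M ^ P * 2 ^ P) with hC₁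
  set C₂ := ENNReal.ofReal (2 ^ P * 2 ^ P) with hC₂
  set C₄ := ENNReal.ofReal (max 1 c⁻¹ ^ P) with hC₄
  -- Coercivity of `f` bounds the gradients by the energies `a` and `b`. The summand 1 is reserved
  -- for the term with `v - w`, whatever the size of `Λ`.
  set T := C₁ * (volume Ω + C₂ * (C₄ * a + C₄ * b + 1)) with hT
  have hTtop : T ≠ ⊤ := by
    refine ENNReal.mul_ne_top ENNReal.ofReal_ne_top (ENNReal.add_ne_top.2 ⟨hΩ.ne, ?_⟩)
    refine ENNReal.mul_ne_top ENNReal.ofReal_ne_top (ENNReal.add_ne_top.2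
      ⟨ENNReal.add_ne_top.2 ⟨?_, ?_⟩, ENNReal.one_ne_top⟩)
    · exact ENNReal.mul_ne_top ENNReal.ofReal_ne_top ha.ne
    · exact ENNReal.mul_ne_top ENNReal.ofReal_ne_top hb.ne
  obtain ⟨N, hN⟩ := ENNReal.exists_nat_mul_gt hθ hTtop
  obtain ⟨ζ, S, Λ, hζ, hSo, hSA, hSd, hζS⟩ := exists_cutoff_layers hA hc hA'A N
  refine relaxed_le_of_forall fun δ hδ => ?_
  set C₃ := max 1 (√(m * n) * Λ) ^ P with hC₃
  have hC₃0 : 0 < C₃ := by positivity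
  -- `v` and `w` are chosen after `N` and `Λ`. The first summand of `κ` makes the `v - w` term at
  -- most 1; the second makes the glued function `δ`-close to `u`.
  obtain ⟨δ', hδ', hδ'1, hsmall⟩ := exists_delta_mul_le_one hP
    (κ := C₃ * 2 ^ P + max 1 (δ / 2)⁻¹ ^ P) (by positivity)
  obtain ⟨v, G, hvS, hvl, hvE⟩ := exists_of_relaxed_lt hra hδ'
  obtain ⟨w, H, hwS, hwl, hwE⟩ := exists_of_relaxed_lt hrb hδ'
  have hvu := hp.powModular_le_of_luxNorm_lt hP hA hAΩ hδ'1 hvl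
  have hwu := hp.powModular_le_of_luxNorm_lt hP hB hBΩ hδ'1 hwl
  have hAB := hA.inter hB
  have hABA : A ∩ B ⊆ A := Set.inter_subset_left
  have hABB : A ∩ B ⊆ B := Set.inter_subset_right
  have hvw : ENNReal.ofReal C₃ * powModular p (A ∩ B) (fun x => v x - w x) ≤ 1 := by
    refine le_trans ?_ hsmall
    calc ENNReal.ofReal C₃ * powModular p (A ∩ B) (fun x => v x - w x)
        ≤ ENNReal.ofReal C₃ * (ENNReal.ofReal (2 ^ P) *
          (powModular p (A ∩ B) (fun x => v x - u x) +
            powModular p (A ∩ B) (fun x => w x - u x))) := by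
          gcongr
          exact hp.powModular_sub_le hAB (hABA.trans hAΩ) (hvS.1.1.mono_set hABA)
            (hu.mono_set (hABA.trans hAΩ))
      _ ≤ ENNReal.ofReal (C₃ * 2 ^ P) * (ENNReal.ofReal (P * δ') + ENNReal.ofReal (P * δ')) := by
          rw [ENNReal.ofReal_mul hC₃0.le, mul_assoc]
          gcongr
          · exact (lintegral_mono_set hABA).trans hvu
          · exact (lintegral_mono_set hABB).trans hwu
      _ ≤ _ := by
          gcongr
          have : 0 ≤ max 1 (δ / 2)⁻¹ ^ P := by positivity
          linarith
  have hsum : ∑ i ∈ Finset.range N, ∫⁻ x in (A' ∪ B) ∩ S i, C₁ * (1 + C₂ *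
      (ENNReal.ofReal (‖G x‖ ^ p x) + ENNReal.ofReal (‖H x‖ ^ p x) +
        ENNReal.ofReal C₃ * ENNReal.ofReal (‖v x - w x‖ ^ p x))) ≤ T := by
    refine (hp.sum_layers_le (A := A ∩ B) (e := fun x => v x - w x) (hABA.trans hAΩ)
      (fun i => hU.inter (hSo i)) (fun i hi x hx => ?_)
      (fun i j hij => (hSd hij).mono Set.inter_subset_right Set.inter_subset_right)
      ENNReal.ofReal_ne_top ENNReal.ofReal_ne_top ENNReal.ofReal_ne_top
      (hvS.2.2.1.mono_set hABA) (hwS.2.2.1.mono_set hABB)).trans ?_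
    · exact ⟨(hSA i hi hx.2).1, hx.1.resolve_left (hSA i hi hx.2).2⟩
    · rw [hT]
      gcongr
      · exact hABA.trans hAΩ
      · exact (lintegral_mono_set hABA).trans ((hp.powModular_le_energy hf hA hAΩ G).trans
          (mul_le_mul_right hvE.le _))
      · exact (lintegral_mono_set hABB).trans ((hp.powModular_le_energy hf hB hBΩ H).trans
          (mul_le_mul_right hwE.le _))
  obtain ⟨i, hi, hiθ⟩ := Finset.exists_lt_of_sum_lt
    (g := fun _ : ℕ => θ) (hsum.trans_lt (by simpa using hN))
  have hi' := Finset.mem_range.1 hi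
  refine ⟨glue A B (ζ i) v w, glueGrad A B (ζ i) v w G H,
    hp.memSobolev_glue hΩ hA' hA hB (hsub.trans hAΩ) hAΩ hBΩ (hζ i hi') hvS hwS,
    hp.luxNorm_lt_of_powModular_le hU hUΩ hδ ?_, ?_⟩
  · refine le_trans ?_ hsmall
    gcongr
    · have : 0 ≤ C₃ * 2 ^ P := by positivity
      linarith
    · exact (hp.powModular_glue_sub_le hA' hA hB hsub hAΩ (hζ i hi') (hu.mono_set hAΩ)
        hvS.1.1).trans (add_le_add hvu hwu)
  · refine (hp.energy_glueGrad_le hf hP0 hA' hA hB hAΩ (hζ i hi') (hSo i) (hSA i hi') (hζS i)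
      hvS.2.2.1).trans ?_
    exact add_le_add (add_le_add hvE.le hwE.le) hiθ.le

theorem relaxed_nested (hp : IsLogExponent Ω p P L) (hP : 1 ≤ P) (hΩ : volume Ω < ⊤)
    (hf : IsLinearGrowth f c M) (hu : AEStronglyMeasurable u (volume.restrict Ω))
    (hA' : IsOpen A') (hA : IsOpen A) (hB : IsOpen B) (hAΩ : A ⊆ Ω) (hBΩ : B ⊆ Ω)
    (hc : IsCompact (closure A')) (hA'A : closure A' ⊆ A) :
    relaxed p f u (A' ∪ B) ≤ relaxed p f u A + relaxed p f u B := by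
  refine ENNReal.le_of_forall_pos_le_add fun ε hε hfin => ?_
  obtain ⟨hra, hrb⟩ := ENNReal.add_lt_top.1 hfin
  have hθ : ((ε / 3 : ℝ≥0) : ℝ≥0∞) ≠ 0 := by
    rw [ENNReal.coe_ne_zero]
    positivity
  refine (hp.exists_glue_near hP hΩ hf hu hA' hA hB hAΩ hBΩ hc hA'A
    (ENNReal.add_lt_top.2 ⟨hra, ENNReal.coe_lt_top⟩)
    (ENNReal.add_lt_top.2 ⟨hrb, ENNReal.coe_lt_top⟩) hθ (ENNReal.lt_add_right hra.ne hθ)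
    (ENNReal.lt_add_right hrb.ne hθ)).trans (le_of_eq ?_)
  have h3 : (ε : ℝ≥0∞) = ((ε / 3 : ℝ≥0) : ℝ≥0∞) + ((ε / 3 : ℝ≥0) : ℝ≥0∞) +
      ((ε / 3 : ℝ≥0) : ℝ≥0∞) := by
    rw [← ENNReal.coe_add, ← ENNReal.coe_add, add_thirds]
  rw [h3]
  ring

/-- The upper bound dominates the functional by a finite measure `ν`, so a compact `K ⊆ A` leaves `A
\ K` with little energy. Subadditivity on a neighbourhood of `K` and `A \ K` then forces almost all
of the value onto a set compactly contained in `A`. -/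
theorem exists_lt_relaxed (hp : IsLogExponent Ω p P L) (hP : 1 ≤ P) (hb : Bornology.IsBounded Ω)
    (hf : IsLinearGrowth f c M) (hu : IntegrableOn u Ω) (hup : powModular p Ω u < ⊤)
    (hfin : dualEnergy (powPhi p) Ω u Ω < ⊤) (hA : IsOpen A) (hAΩ : A ⊆ Ω) {a : ℝ≥0∞}
    (ha : a < relaxed p f u A) :
    ∃ A', IsOpen A' ∧ IsCompact (closure A') ∧ closure A' ⊆ A ∧ a < relaxed p f u A' := by
  obtain ⟨C, hC⟩ := hp.exists_relaxed_le hb hf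
  obtain ⟨μ, hμ, -, hμA⟩ := exists_measure_eq_dualEnergy hp.isOpen hu hfin
  have hΩ : volume Ω < ⊤ := hb.measure_lt_top
  have := isFiniteMeasure_restrict.2 hΩ.ne
  let ν : Measure (Vec n) := C • (volume.restrict Ω + μ)
  have hν : ∀ B, IsOpen B → B ⊆ Ω → relaxed p f u B ≤ ν B := fun B hB hBΩ => by
    refine (hC u hu hup hfin B hB hBΩ).trans (le_of_eq ?_)
    rw [hμA B hB hBΩ]
    simp [ν, Measure.restrict_apply hB.measurableSet, Set.inter_eq_self_of_subset_left hBΩ]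
    exact mul_add _ _ _
  obtain ⟨b, hab, hbA⟩ := exists_between ha
  have hη : b - a ≠ 0 := (tsub_pos_of_lt hab).ne'
  obtain ⟨K, hKA, hK, hKη⟩ := hA.measurableSet.exists_isCompact_sdiff_lt (μ := ν)
    (measure_ne_top _ _) hη
  obtain ⟨V, hV, hKV, hVA, hVc⟩ := exists_open_between_and_isCompact_closure hK hA hKA
  -- A second intermediate set is needed because subadditivity enlarges `V` to `W`.
  obtain ⟨W, hW, hVW, hWA, hWc⟩ := exists_open_between_and_isCompact_closure hVc hA hVA
  refine ⟨W, hW, hWc, hWA, ?_⟩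
  have hD : IsOpen (A \ K) := hA.sdiff hK.isClosed
  have hWΩ := (subset_closure.trans hWA).trans hAΩ
  have hDΩ : A \ K ⊆ Ω := Set.sdiff_subset.trans hAΩ
  have hcover : A ⊆ V ∪ A \ K := fun x hx => by
    by_cases hxK : x ∈ K
    · exact Or.inl (hKV hxK)
    · exact Or.inr ⟨hx, hxK⟩
  have h1 : relaxed p f u A ≤ relaxed p f u W + relaxed p f u (A \ K) :=
    (relaxed_mono (hV.union hD).measurableSet hcover).trans
      (hp.relaxed_nested hP hΩ hf hu.aestronglyMeasurable hV hW hD hWΩ hDΩ hVc hVW)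
  by_contra! hW
  refine (hbA.trans_le h1).not_ge ?_
  calc relaxed p f u W + relaxed p f u (A \ K) ≤ a + (b - a) :=
        add_le_add hW ((hν _ hD hDΩ).trans hKη.le)
    _ = b := add_tsub_cancel_of_le hab.le

end IsLogExponent

/-! ### Boundedness of the exponent and the conclusion -/

theorem exists_isLogExponent {Ω : Set (Vec n)} {p : Vec n → ℝ} (hΩ : IsOpen Ω)
    (hp : IsVariableExponent Ω p) (hlog : IsLogHolder Ω p) :
    ∃ P L, 1 ≤ P ∧ IsLogExponent Ω p P L := by
  obtain ⟨L, hL, hlog⟩ := hlog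
  obtain ⟨hm, h1⟩ := hp
  have hae : AEMeasurable p (volume.restrict Ω) :=
    aemeasurable_restrict_of_measurable_subtype hΩ.measurableSet hm
  rcases Ω.eq_empty_or_nonempty with rfl | ⟨x₀, hx₀⟩
  · exact ⟨1, L, le_rfl, hΩ, hae, h1, by simp, hL, hlog⟩
  · refine ⟨p x₀ + L, L, by linarith [h1 x₀ hx₀], hΩ, hae, h1, fun x hx => ?_, hL, hlog⟩
    have h2 := (le_abs_self _).trans (hlog x hx x₀ hx₀)
    -- The logarithm is at least `log e = 1`, so `p` differs from `p x₀` by at most `L` throughout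
    -- `Ω`.
    have h3 : 1 ≤ Real.log (Real.exp 1 + 1 / ‖x - x₀‖) := by
      rw [Real.le_log_iff_exp_le (by positivity)]
      have : 0 ≤ 1 / ‖x - x₀‖ := by positivity
      linarith
    linarith [div_le_self hL.le h3]

namespace IsLogExponent

variable {Ω : Set (Vec n)} {p : Vec n → ℝ} {P L : ℝ} {u : Vec n → Vec m}

theorem ae_le_pPlus (hp : IsLogExponent Ω p P L) :
    ∀ᵐ x ∂volume.restrict Ω, p x ≤ pPlus Ω p :=
  ae_le_essSup (isBoundedUnder_of_eventually_le
    (ae_restrict_of_forall_mem hp.isOpen.measurableSet hp.le))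

theorem pPlus_nonneg (hp : IsLogExponent Ω p P L) (h : Ω.Nonempty) : 0 ≤ pPlus Ω p := by
  have : NeZero (volume.restrict Ω) :=
    ⟨Measure.restrict_eq_zero.not.2 (hp.isOpen.measure_pos volume h).ne'⟩
  obtain ⟨x, hx, hx'⟩ := ((ae_restrict_of_forall_mem hp.isOpen.measurableSet hp.one_le).and
    hp.ae_le_pPlus).exists
  linarith

theorem dualEnergy_lt_top (hp : IsLogExponent Ω p P L) (hP : 1 ≤ P)
    (hu : MemBV (powPhi p) Ω u) : dualEnergy (powPhi p) Ω u Ω < ⊤ := by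
  have hV : variation (powPhi p) u Ω < ⊤ := le_add_self.trans_lt hu.2
  exact (dualEnergy_powPhi_le hp.isOpen subset_rfl (zero_le_one.trans hP) hp.one_le
    (ae_restrict_of_forall_mem hp.isOpen.measurableSet hp.le) u).trans_lt
    (ENNReal.add_lt_top.2 ⟨hV, ENNReal.rpow_lt_top_of_nonneg (zero_le_one.trans hP) hV.ne⟩)

end IsLogExponent

end VarExp

theorem proposition4p4 {n m : ℕ} (hn : 2 ≤ n)
    (Ω : Set (VarExp.Vec n)) (hΩ : IsOpen Ω) (hΩb : Bornology.IsBounded Ω)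
    (p : VarExp.Vec n → ℝ) (hp : VarExp.IsVariableExponent Ω p) (hlog : VarExp.IsLogHolder Ω p)
    (f : VarExp.Mat m n → ℝ) (hf : ∀ ξ, 0 ≤ f ξ)
    (H0 : Continuous f ∧ f 0 = 0)
    (H2 : ∃ c : ℝ, 0 < c ∧ ∀ ξ, c * ‖ξ‖ ≤ f ξ)
    (H3 : ∃ M : ℝ, 1 ≤ M ∧ ∀ ξ, f ξ ≤ M * (1 + ‖ξ‖)) :
    (∃ C : ℝ≥0, ∀ u : VarExp.Vec n → VarExp.Vec m, VarExp.MemBV (VarExp.powPhi p) Ω u →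
      ∀ A : Set (VarExp.Vec n), IsOpen A → A ⊆ Ω →
        VarExp.relaxed p f u A ≤
          C * (volume A + VarExp.variation (VarExp.powPhi p) u A
            + VarExp.variation (VarExp.powPhi p) u A ^ VarExp.pPlus Ω p)) ∧
    (∀ u : VarExp.Vec n → VarExp.Vec m, VarExp.MemBV (VarExp.powPhi p) Ω u →
      ∃ μ : Measure (VarExp.Vec n), IsFiniteMeasure μ ∧ μ.Regular ∧ μ Ωᶜ = 0 ∧
        ∀ A : Set (VarExp.Vec n), IsOpen A → A ⊆ Ω → VarExp.relaxed p f u A = μ A) := by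
  obtain ⟨P, L, hP, hp'⟩ := VarExp.exists_isLogExponent hΩ hp hlog
  obtain ⟨c, hc, hcf⟩ := H2
  obtain ⟨M, hM, hMf⟩ := H3
  have hf' : VarExp.IsLinearGrowth f c M := ⟨H0.1, hf, hc, hcf, hM, hMf⟩
  have hΩv : volume Ω < ⊤ := hΩb.measure_lt_top
  obtain ⟨C, hC⟩ := hp'.exists_relaxed_le hΩb hf'
  have hpow : ∀ u : VarExp.Vec n → VarExp.Vec m, VarExp.MemBV (VarExp.powPhi p) Ω u →
      VarExp.powModular p Ω u < ⊤ := fun u hu => hp'.powModular_lt_top hΩ subset_rfl hu.1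
  have hint : ∀ u : VarExp.Vec n → VarExp.Vec m, VarExp.MemBV (VarExp.powPhi p) Ω u →
      IntegrableOn u Ω := fun u hu => hp'.integrableOn hΩ subset_rfl hΩv hu.1.1 (hpow u hu)
  refine ⟨⟨C, fun u hu A hA hAΩ => ?_⟩, fun u hu => ?_⟩
  -- For empty `Ω` the essential supremum is taken over the zero measure and `p⁺ ≥ 0` is not
  -- available; the functional is zero anyway.
  · rcases Ω.eq_empty_or_nonempty with hΩe | hΩne
    · rw [Set.subset_eq_empty hAΩ hΩe, VarExp.relaxed_empty]
      exact zero_le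
    · refine (hC u (hint u hu) (hpow u hu) (hp'.dualEnergy_lt_top hP hu) A hA hAΩ).trans ?_
      rw [add_assoc]
      gcongr
      exact VarExp.dualEnergy_powPhi_le hΩ hAΩ (hp'.pPlus_nonneg hΩne) hp'.one_le
        hp'.ae_le_pPlus u
  · have hfin := hp'.dualEnergy_lt_top hP hu
    have hrel : VarExp.relaxed p f u Ω < ⊤ :=
      (hC u (hint u hu) (hpow u hu) hfin Ω hΩ subset_rfl).trans_lt
        (ENNReal.mul_lt_top ENNReal.coe_lt_top (ENNReal.add_lt_top.2 ⟨hΩv, hfin⟩))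
    obtain ⟨μ, hμ, hμΩ, hμA⟩ := VarExp.exists_measure_eq_on_isOpen hΩ (VarExp.relaxed p f u)
      (fun _ _ _ hB h _ => VarExp.relaxed_mono hB.measurableSet h) VarExp.relaxed_empty
      (fun _ _ hA hB _ _ hAB => VarExp.relaxed_superadditive hA hB hAB)
      (fun _ _ _ hA' hA hB hAΩ hBΩ hc hA'A => hp'.relaxed_nested hP hΩv hf'
        (hint u hu).aestronglyMeasurable hA' hA hB hAΩ hBΩ hc hA'A)
      (fun _ hA hAΩ _ ha => hp'.exists_lt_relaxed hP hΩb hf' (hint u hu) (hpow u hu) hfin hA hAΩ ha)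
      hrel
    exact ⟨μ, hμ, inferInstance, hμΩ, hμA⟩
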